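/- Let $\mathbb{K}$ be $\mathbb{R}$ or $\mathbb{C}$. Manifolds are Hausdorff, second countable, of pure finite dimension over $\mathbb{K}$; they and all maps and forms are smooth (holomorphic if $\mathbb{K}=\mathbb{C}$). A Lie groupoid $\mathcal{G}$ has objects $\mathcal{G}^0$, arrows $\mathcal{G}^1$, source $s$ (a submersion), target $t$, identity section $u$, and composes $gh$ when $s(g)=t(h)$; its Lie algebroid is $A_{\mathcal{G}}=\ker s_*$ along $u$, with anchor $\rho=t_*$. **Definitions.** A *quasi-symplectic groupoid* $(\mathcal{G},\omega,\phi)$ is a Lie groupoid with a multiplicative 2-form $\omega$ on $\mathcal{G}^1$ and a closed 3-form $\phi$ on $\mathcal{G}^0$ such that $d\omega=s^*\phi-t^*\phi$, $\dim\mathcal{G}^1=2\dim\mathcal{G}^0$, and $\ker\omega_{x}\cap\ker s_*\cap\ker t_*=0$ at the identity arrows. Put $\sigma_\omega(a)=u^*(i_a\omega)$ for $a\in A_{\mathcal{G}}$, and $\mathcal{G}^-=(\mathcal{G},-\omega,-\phi)$. A *1-shifted Lagrangian* on $\mathcal{G}$ is a Lie groupoid morphism $\mu:\mathcal{L}\to\mathcal{G}$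 with a 2-form $\gamma$ on $\mathcal{L}^0$ such that $\mu^*\omega=t^*\gamma-s^*\gamma$, $\mu^*\phi=-d\gamma$, and $b\mapsto(\rho(b),\mu_*b)$ is an isomorphism from $A_{\mathcal{L}}$ onto $\{(v,a)\in T\mathcal{L}^0\oplus\mu^*A_{\mathcal{G}}:\mu_*v=\rho(a),\ i_v\gamma=\mu^*\sigma_\omega(a)\}$. A *1-shifted Lagrangian correspondence* $\mathcal{G}_1\leftarrow\mathcal{L}\to\mathcal{G}_2$ is a 1-shifted Lagrangian on $\mathcal{G}_1\times\mathcal{G}_2^-$. Correspondences $\mathcal{G}_1\xleftarrow{\mu_{11}}\mathcal{L}_1\xrightarrow{\mu_{12}}\mathcal{G}_2$ and $\mathcal{G}_2\xleftarrow{\mu_{22}}\mathcal{L}_2\xrightarrow{\mu_{23}}\mathcal{G}_3$ are *transverse* if $\mu_{12}\times\mu_{22}:\mathcal{L}_1^0\times\mathcal{L}_2^0\to\mathcal{G}_2^0\times\mathcal{G}_2^0$ and $(s,t):\mathcal{G}_2^1\to\mathcal{G}_2^0\times\mathcal{G}_2^0$ are transverse. Then their *composition* is the homotopy fibre product $\mathcal{L}_1\times^h_{\mathcal{G}_2}\mathcal{L}_2$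 (objects $(x,g,y)$ with $g:\mu_{12}(x)\to\mu_{22}(y)$; arrows $(l,g,m):(s(l),g,s(m))\to(t(l),\mu_{22}(m)\,g\,\mu_{12}(l)^{-1},t(m))$) with the 2-form $\mathrm{pr}_{\mathcal{L}_1}^*\gamma_1+\mathrm{pr}_{\mathcal{L}_2}^*\gamma_2-\mathrm{pr}_{\mathcal{G}_2^1}^*\omega_2$ and the evident maps to $\mathcal{G}_1$ and $\mathcal{G}_3$. A *Morita morphism* $\varphi:\mathcal{H}\to\mathcal{G}$ is a morphism that is a surjective submersion on objects and induces an isomorphism $\mathcal{H}\cong\varphi^*\mathcal{G}$. A *symplectic Morita equivalence* $(\mathcal{H},\delta):\mathcal{G}\xleftarrow{\varphi}\mathcal{H}\xrightarrow{\varphi'}\mathcal{G}'$ is a 1-shifted Lagrangian correspondence whose two legs are Morita morphisms. Let $(\mathcal{H}_i,\delta_i)$ be symplectic Morita equivalences between $\mathcal{G}_i$ and $\mathcal{G}_i'$ ($i=1,2$). A *Lagrangian Morita equivalence over $(\mathcal{H}_1,\mathcal{H}_2)$* between $\mathcal{G}_1\xleftarrow{\mu_1}(\mathcal{L},\gamma)\xrightarrow{\mu_2}\mathcal{G}_2$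 and $\mathcal{G}_1'\xleftarrow{\mu_1'}(\mathcal{L}',\gamma')\xrightarrow{\mu_2'}\mathcal{G}_2'$ consists of Morita morphisms $\mathcal{L}\xleftarrow{\psi}\mathcal{M}\xrightarrow{\psi'}\mathcal{L}'$, morphisms $\nu_i:\mathcal{M}\to\mathcal{H}_i$, and natural transformations $\theta_i:\mu_i\psi\Rightarrow\varphi_i\nu_i$ and $\theta_i':\mu_i'\psi'\Rightarrow\varphi_i'\nu_i$ ($i=1,2$) such that $$\psi^*\gamma-\psi'^*\gamma'=\nu_1^*\delta_1-\nu_2^*\delta_2-\theta_1^*\omega_1+\theta_2^*\omega_2+\theta_1'^*\omega_1'-\theta_2'^*\omega_2'.$$ A *weak equivalence* between correspondences $(\mathcal{L},\gamma)$ and $(\mathcal{L}',\gamma')$ from $\mathcal{G}_1$ to $\mathcal{G}_2$ consists of Morita morphisms $\mathcal{L}\xleftarrow{\psi}\mathcal{M}\xrightarrow{\psi'}\mathcal{L}'$ and natural transformations $\theta_i:\mu_i\psi\Rightarrow\mu_i'\psi'$ such that $\psi'^*\gamma'-\psi^*\gamma=\theta_1^*\omega_1-\theta_2^*\omega_2$.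 **Proposition.** (1) Let $(\mathcal{H}_i,\delta_i)$ be symplectic Morita equivalences between quasi-symplectic groupoids $\mathcal{G}_i$ and $\mathcal{G}_i'$, $i=1,2,3$. Let $\mathcal{G}_1\leftarrow\mathcal{L}_1\to\mathcal{G}_2\leftarrow\mathcal{L}_2\to\mathcal{G}_3$ and $\mathcal{G}_1'\leftarrow\mathcal{L}_1'\to\mathcal{G}_2'\leftarrow\mathcal{L}_2'\to\mathcal{G}_3'$ be two pairs of 1-shifted Lagrangian correspondences such that $\mathcal{L}_1,\mathcal{L}_1'$ are Lagrangially Morita equivalent over $(\mathcal{H}_1,\mathcal{H}_2)$, and $\mathcal{L}_2,\mathcal{L}_2'$ are Lagrangially Morita equivalent over $(\mathcal{H}_2,\mathcal{H}_3)$. Then the first pair is transverse if and only if the second is. In this case the compositions $\mathcal{L}_1\times^h_{\mathcal{G}_2}\mathcal{L}_2$ and $\mathcal{L}_1'\times^h_{\mathcal{G}_2'}\mathcal{L}_2'$ are 1-shifted Lagrangian correspondences, and they are Lagrangially Morita equivalent over $(\mathcal{H}_1,\mathcal{H}_3)$. (2) Consequently, composition of weak equivalence classes is well defined: if $\mathcal{L}_1,\mathcal{L}_1'$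 are weakly equivalent correspondences from $\mathcal{G}_1$ to $\mathcal{G}_2$, and $\mathcal{L}_2,\mathcal{L}_2'$ are weakly equivalent correspondences from $\mathcal{G}_2$ to $\mathcal{G}_3$, then $(\mathcal{L}_1,\mathcal{L}_2)$ is transverse if and only if $(\mathcal{L}_1',\mathcal{L}_2')$ is, and in this case the compositions are 1-shifted Lagrangian correspondences that are weakly equivalent. -/

import Mathlib

open scoped Manifold ContDiff Topology
universe u v

namespace ShiftedSymplectic

section Slice
variable {𝕜 : Type*} [RCLike 𝕜]
  {E : Type*} [NormedAddCommGroup E] [NormedSpace 𝕜 E] [FiniteDimensional 𝕜 E]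
  {H : Type*} [TopologicalSpace H] {I : ModelWithCorners 𝕜 E H} [I.Boundaryless]
  {M : Type*} [TopologicalSpace M] [ChartedSpace H M] [IsManifold I ∞ M]
  {F : Type*} [NormedAddCommGroup F] [NormedSpace 𝕜 F] [FiniteDimensional 𝕜 F]
  {G : Type*} [TopologicalSpace G] {J : ModelWithCorners 𝕜 F G}
  {Y : Type*} [TopologicalSpace Y] [ChartedSpace G Y] [IsManifold J ∞ Y]
  {K : Type*} [NormedAddCommGroup K] [NormedSpace 𝕜 K] [FiniteDimensional 𝕜 K]

variable (I J) in
/-- The differential `T_p M → T_{f p} Y` of a map between manifolds. The tangent space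
`TangentSpace I p` is by definition the model space `E`, and `E` is how we write it here. -/
noncomputable def tangentMapAt (f : M → Y) (p : M) : E →L[𝕜] F := mfderiv I J f p

/-- A surjective linear map extends to an isomorphism onto a product. -/
theorem exists_equiv_prod (D : E →L[𝕜] F) (hD : Function.Surjective D)
    (hK : Module.finrank 𝕜 E = Module.finrank 𝕜 F + Module.finrank 𝕜 K) :
    ∃ A : E ≃L[𝕜] F × K, ∀ e, (A e).1 = D e := by
  obtain ⟨P, hP⟩ := (LinearMap.ker (D : E →ₗ[𝕜] F)).exists_isCompl
  have hr := LinearMap.finrank_range_add_finrank_ker (D : E →ₗ[𝕜] F)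
  have htop : LinearMap.range (D : E →ₗ[𝕜] F) = ⊤ := LinearMap.range_eq_top.2 hD
  rw [htop, finrank_top] at hr
  have hk : Module.finrank 𝕜 (LinearMap.ker (D : E →ₗ[𝕜] F)) = Module.finrank 𝕜 K := by omega
  let κ := LinearEquiv.ofFinrankEq (R := 𝕜) _ _ hk
  let π : E →ₗ[𝕜] K := κ.toLinearMap ∘ₗ (Submodule.projectionOnto _ P hP)
  let B : E →ₗ[𝕜] F × K := (D : E →ₗ[𝕜] F).prod π
  have hinj : Function.Injective B := by
    rw [← LinearMap.ker_eq_bot, Submodule.eq_bot_iff]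
    intro x hx
    have h1 : D x = 0 := congrArg Prod.fst hx
    have h2 : κ (Submodule.projectionOnto _ P hP x) = 0 := congrArg Prod.snd hx
    have h3 := (LinearEquiv.map_eq_zero_iff κ).1 h2
    have h4 := Submodule.projectionOnto_apply_left hP ⟨x, h1⟩
    exact (congrArg Subtype.val (h3.symm.trans h4)).symm
  have hfr : Module.finrank 𝕜 E = Module.finrank 𝕜 (F × K) := by
    rw [Module.finrank_prod, hK]
  let A := LinearEquiv.ofInjectiveOfFinrankEq B hinj hfr
  exact ⟨A.toContinuousLinearEquiv, fun e => rfl⟩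

theorem exists_slice {f g : M → Y} (hf : ContMDiff I J ∞ f) (hg : ContMDiff I J ∞ g)
    {p : M} (hp : f p = g p)
    (hD : ∀ w : F, ∃ v : E, tangentMapAt I J f p v - tangentMapAt I J g p v = w)
    (hK : Module.finrank 𝕜 E = Module.finrank 𝕜 F + Module.finrank 𝕜 K) :
    ∃ Φ : OpenPartialHomeomorph M (F × K), p ∈ Φ.source ∧
      ContMDiffOn I 𝓘(𝕜, F × K) ∞ Φ Φ.source ∧
      ContMDiffOn 𝓘(𝕜, F × K) I ∞ Φ.symm Φ.target ∧
      ∀ q ∈ Φ.source, f q = g q ↔ (Φ q).1 = 0 := by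
  have : CompleteSpace E := FiniteDimensional.complete 𝕜 E
  have : CompleteSpace F := FiniteDimensional.complete 𝕜 F
  have : CompleteSpace K := FiniteDimensional.complete 𝕜 K
  let c : OpenPartialHomeomorph M E := (chartAt H p).transHomeomorph I.toHomeomorph
  have hcs : c.source = (chartAt H p).source := rfl
  have hct : c.target = (extChartAt I p).target := by
    ext e; simp [c, extChartAt, ModelWithCorners.toHomeomorph, I.range_eq_univ]
  have hc : ∀ q, c q = extChartAt I p q := fun q => rfl
  have hc' : ∀ e, c.symm e = (extChartAt I p).symm e := fun e => rfl
  have hcsm : ContMDiffOn I 𝓘(𝕜, E) ∞ c c.source := contMDiffOn_extChartAt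
  have hcsm' : ContMDiffOn 𝓘(𝕜, E) I ∞ c.symm c.target := by
    rw [hct]; exact contMDiffOn_extChartAt_symm p
  let ψ := extChartAt J (f p)
  have hψs : IsOpen ψ.source := isOpen_extChartAt_source _
  have hψ : ContMDiffOn J 𝓘(𝕜, F) ∞ ψ ψ.source := by
    simpa [ψ, extChartAt_source] using contMDiffOn_extChartAt (I := J) (x := f p) (n := ∞)
  let W : Set E := c.target ∩ c.symm ⁻¹' (f ⁻¹' ψ.source ∩ g ⁻¹' ψ.source)
  have hWo : IsOpen W := c.symm.isOpen_inter_preimage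
    ((hψs.preimage hf.continuous).inter (hψs.preimage hg.continuous))
  have hps : p ∈ c.source := mem_chart_source H p
  have hpW : c p ∈ W := by
    refine ⟨c.map_source hps, ?_⟩
    simp only [Set.mem_preimage, c.left_inv hps, Set.mem_inter_iff]
    exact ⟨mem_extChartAt_source _, hp ▸ mem_extChartAt_source _⟩
  have hfW : ContDiffOn 𝕜 ∞ (fun e => ψ (f (c.symm e))) W := by
    rw [← contMDiffOn_iff_contDiffOn]
    exact (hψ.comp (hf.comp_contMDiffOn (hcsm'.mono Set.inter_subset_left))
      (fun e he => he.2.1))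
  have hgW : ContDiffOn 𝕜 ∞ (fun e => ψ (g (c.symm e))) W := by
    rw [← contMDiffOn_iff_contDiffOn]
    exact (hψ.comp (hg.comp_contMDiffOn (hcsm'.mono Set.inter_subset_left))
      (fun e he => he.2.2))
  let u : E → F := fun e => ψ (f (c.symm e)) - ψ (g (c.symm e))
  have huW : ContDiffOn 𝕜 ∞ u W := hfW.sub hgW
  have hWn : W ∈ 𝓝 (c p) := hWo.mem_nhds hpW
  have hdf : fderiv 𝕜 (fun e => ψ (f (c.symm e))) (c p) = tangentMapAt I J f p := by
    have := (hf.mdifferentiable (by simp)) p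
    have h2 : tangentMapAt I J f p = fderivWithin 𝕜 (writtenInExtChartAt I J p f) (Set.range I)
      (extChartAt I p p) := if_pos this
    rw [h2, I.range_eq_univ, fderivWithin_univ]
    rfl
  have hdg : fderiv 𝕜 (fun e => ψ (g (c.symm e))) (c p) = tangentMapAt I J g p := by
    have := (hg.mdifferentiable (by simp)) p
    have h2 : tangentMapAt I J g p = fderivWithin 𝕜 (writtenInExtChartAt I J p g) (Set.range I)
      (extChartAt I p p) := if_pos this
    rw [h2, I.range_eq_univ, fderivWithin_univ]
    have : writtenInExtChartAt I J p g = (fun e => ψ (g (c.symm e))) := by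
      simp only [ψ, hp]; rfl
    rw [this]; rfl
  have hdu : ∀ v : E, fderiv 𝕜 u (c p) v = tangentMapAt I J f p v - tangentMapAt I J g p v := by
    intro v
    have h1 := ((hfW.contDiffAt hWn).differentiableAt (by simp))
    have h2 := ((hgW.contDiffAt hWn).differentiableAt (by simp))
    change (fderiv 𝕜 (fun e => ψ (f (c.symm e)) - ψ (g (c.symm e))) (c p)) v = _
    rw [fderiv_fun_sub h1 h2, hdf, hdg]
    rfl
  obtain ⟨A, hA⟩ := exists_equiv_prod (K := K) (fderiv 𝕜 u (c p))
    (fun w => by obtain ⟨v, hv⟩ := hD w; exact ⟨v, (hdu v).trans hv⟩) hK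
  let π : E →L[𝕜] K := (ContinuousLinearMap.snd 𝕜 F K).comp (A : E →L[𝕜] F × K)
  let Ψ : E → F × K := fun e => (u e, π e)
  have hΨW : ContDiffOn 𝕜 ∞ Ψ W := huW.prodMk π.contDiff.contDiffOn
  have hdΨ : HasFDerivAt Ψ (A : E →L[𝕜] F × K) (c p) := by
    have h1 := ((huW.contDiffAt hWn).differentiableAt (by simp)).hasFDerivAt
    have h2 := h1.prodMk (π.hasFDerivAt (x := c p))
    convert h2 using 1
    ext e
    · exact hA e
    · rfl
  let Ψ₀ := (hΨW.contDiffAt hWn).toOpenPartialHomeomorph Ψ hdΨ (by simp)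
  have hΨ₀ : ∀ e, Ψ₀ e = Ψ e := fun e => rfl
  have hpΨ₀ : c p ∈ Ψ₀.source :=
    (hΨW.contDiffAt hWn).mem_toOpenPartialHomeomorph_source hdΨ (by simp)
  let W' : Set E := W ∩ (fderiv 𝕜 Ψ) ⁻¹' (Set.range ((↑) : (E ≃L[𝕜] F × K) → E →L[𝕜] F × K))
  have hW'o : IsOpen W' := (hΨW.continuousOn_fderiv_of_isOpen hWo (by simp)).isOpen_inter_preimage
    hWo ContinuousLinearEquiv.isOpen
  have hpW' : c p ∈ W' := ⟨hpW, A, hdΨ.fderiv.symm⟩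
  let Ψ₁ := Ψ₀.restrOpen W' hW'o
  have hs1 : Ψ₁.source = Ψ₀.source ∩ W' := rfl
  have hΨ₁ : ∀ e, Ψ₁ e = Ψ e := fun e => rfl
  have hΨ₁s : ContDiffOn 𝕜 ∞ Ψ₁ Ψ₁.source := hΨW.mono (fun e he => he.2.1)
  have hΨ₁s' : ContDiffOn 𝕜 ∞ Ψ₁.symm Ψ₁.target := by
    intro y hy
    have hx := Ψ₁.map_target hy
    obtain ⟨B, hB⟩ := hx.2.2
    have hd : ContDiffAt 𝕜 ∞ Ψ (Ψ₁.symm y) := hΨW.contDiffAt (hWo.mem_nhds hx.2.1)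
    refine (OpenPartialHomeomorph.contDiffAt_symm Ψ₁ (f₀' := B) hy ?_ hd).contDiffWithinAt
    rw [hB]
    exact (hd.differentiableAt (by simp)).hasFDerivAt
  refine ⟨c.trans Ψ₁, ?_, ?_, ?_, ?_⟩
  · simp [hps, hs1, hpΨ₀, hpW']
  · rw [OpenPartialHomeomorph.trans_source]
    exact (contMDiffOn_iff_contDiffOn.2 hΨ₁s).comp (hcsm.mono Set.inter_subset_left)
      (fun q hq => hq.2)
  · rw [OpenPartialHomeomorph.trans_target]
    exact hcsm'.comp ((contMDiffOn_iff_contDiffOn.2 hΨ₁s').mono Set.inter_subset_left)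
      (fun q hq => hq.2)
  · intro q hq
    rw [OpenPartialHomeomorph.trans_source] at hq
    have hqW : c q ∈ W := hq.2.2.1
    have hqi : c.symm (c q) = q := c.left_inv hq.1
    have h1 : f q ∈ ψ.source := by have := hqW.2.1; rwa [Set.mem_preimage, hqi] at this
    have h2 : g q ∈ ψ.source := by have := hqW.2.2; rwa [Set.mem_preimage, hqi] at this
    have : (((c.trans Ψ₁) q).1) = ψ (f q) - ψ (g q) := by
      change u (c q) = _
      simp only [u, hqi]
    rw [this, sub_eq_zero]
    exact ⟨fun h => by rw [h], fun h => ψ.injOn h1 h2 h⟩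

variable (I J) in
/-- `f` and `g` are transverse along the locus `{f = g}`: there, the difference of their
differentials is onto. -/
def EqTransverse (f g : M → Y) : Prop :=
  ∀ p, f p = g p → ∀ w : F, ∃ v : E, tangentMapAt I J f p v - tangentMapAt I J g p v = w

variable (𝕜 E F) in
/-- The model space of the locus `{f = g}`. -/
abbrev EqModel : Type _ :=
  EuclideanSpace 𝕜 (Fin (Module.finrank 𝕜 E - Module.finrank 𝕜 F))

theorem EqTransverse.finrank_eq {f g : M → Y} (ht : EqTransverse I J f g) {p : M}
    (hp : f p = g p) :
    Module.finrank 𝕜 E = Module.finrank 𝕜 F + Module.finrank 𝕜 (EqModel 𝕜 E F) := by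
  have h : Function.Surjective
      ((tangentMapAt I J f p - tangentMapAt I J g p : E →L[𝕜] F) : E →ₗ[𝕜] F) := ht p hp
  have := LinearMap.finrank_le_finrank_of_surjective h
  rw [finrank_euclideanSpace_fin]
  omega

/-- A slice chart of `M` around a point of `{f = g}`. -/
noncomputable def eqSlice {f g : M → Y} (hf : ContMDiff I J ∞ f) (hg : ContMDiff I J ∞ g)
    (ht : EqTransverse I J f g) (p : {p : M // f p = g p}) :
    OpenPartialHomeomorph M (F × EqModel 𝕜 E F) :=
  Classical.choose (exists_slice hf hg p.2 (ht p.1 p.2) (ht.finrank_eq p.2))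

theorem eqSlice_spec {f g : M → Y} (hf : ContMDiff I J ∞ f) (hg : ContMDiff I J ∞ g)
    (ht : EqTransverse I J f g) (p : {p : M // f p = g p}) :
    p.1 ∈ (eqSlice hf hg ht p).source ∧
      ContMDiffOn I 𝓘(𝕜, F × EqModel 𝕜 E F) ∞ (eqSlice hf hg ht p) (eqSlice hf hg ht p).source ∧
      ContMDiffOn 𝓘(𝕜, F × EqModel 𝕜 E F) I ∞ (eqSlice hf hg ht p).symm
        (eqSlice hf hg ht p).target ∧
      ∀ q ∈ (eqSlice hf hg ht p).source, f q = g q ↔ (eqSlice hf hg ht p q).1 = 0 :=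
  Classical.choose_spec (exists_slice hf hg p.2 (ht p.1 p.2) (ht.finrank_eq p.2))

open Classical in
/-- The chart of `{f = g}` cut out by a slice chart of `M`. -/
noncomputable def eqChart {f g : M → Y} (hf : ContMDiff I J ∞ f) (hg : ContMDiff I J ∞ g)
    (ht : EqTransverse I J f g) (p : {p : M // f p = g p}) :
    OpenPartialHomeomorph {p : M // f p = g p} (EqModel 𝕜 E F) where
  toFun q := (eqSlice hf hg ht p q.1).2
  invFun k := if h : f ((eqSlice hf hg ht p).symm (0, k)) = g ((eqSlice hf hg ht p).symm (0, k))
    then ⟨_, h⟩ else p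
  source := Subtype.val ⁻¹' (eqSlice hf hg ht p).source
  target := (fun k => ((0 : F), k)) ⁻¹' (eqSlice hf hg ht p).target
  map_source' q hq := by
    have h0 := ((eqSlice_spec hf hg ht p).2.2.2 q.1 hq).1 q.2
    have : ((0 : F), (eqSlice hf hg ht p q.1).2) = eqSlice hf hg ht p q.1 := Prod.ext h0.symm rfl
    rw [Set.mem_preimage, this]
    exact (eqSlice hf hg ht p).map_source hq
  map_target' k hk := by
    have hs := (eqSlice hf hg ht p).map_target hk
    have h : f ((eqSlice hf hg ht p).symm (0, k)) = g ((eqSlice hf hg ht p).symm (0, k)) := by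
      rw [(eqSlice_spec hf hg ht p).2.2.2 _ hs, (eqSlice hf hg ht p).right_inv hk]
    rw [dif_pos h]
    exact hs
  left_inv' q hq := by
    have h0 := ((eqSlice_spec hf hg ht p).2.2.2 q.1 hq).1 q.2
    have h1 : ((0 : F), (eqSlice hf hg ht p q.1).2) = eqSlice hf hg ht p q.1 :=
      Prod.ext h0.symm rfl
    have h2 : (eqSlice hf hg ht p).symm (0, (eqSlice hf hg ht p q.1).2) = q.1 := by
      rw [h1, (eqSlice hf hg ht p).left_inv hq]
    have h : f ((eqSlice hf hg ht p).symm (0, (eqSlice hf hg ht p q.1).2)) =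
        g ((eqSlice hf hg ht p).symm (0, (eqSlice hf hg ht p q.1).2)) := by
      rw [h2]; exact q.2
    rw [dif_pos h]
    exact Subtype.ext h2
  right_inv' k hk := by
    have hs := (eqSlice hf hg ht p).map_target hk
    have h : f ((eqSlice hf hg ht p).symm (0, k)) = g ((eqSlice hf hg ht p).symm (0, k)) := by
      rw [(eqSlice_spec hf hg ht p).2.2.2 _ hs, (eqSlice hf hg ht p).right_inv hk]
    rw [dif_pos h]
    exact congrArg Prod.snd ((eqSlice hf hg ht p).right_inv hk)
  open_source := (eqSlice hf hg ht p).open_source.preimage continuous_subtype_val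
  open_target := (eqSlice hf hg ht p).open_target.preimage (by fun_prop)
  continuousOn_toFun := continuous_snd.comp_continuousOn
    ((eqSlice hf hg ht p).continuousOn.comp continuous_subtype_val.continuousOn fun _ h => h)
  continuousOn_invFun := by
    refine (Topology.IsEmbedding.subtypeVal (p := fun p => f p = g p)).isInducing.continuousOn_iff.2 ?_
    refine ContinuousOn.congr (f := fun k => (eqSlice hf hg ht p).symm (0, k))
      ((eqSlice hf hg ht p).continuousOn_symm.comp (by fun_prop) fun _ h => h) ?_
    intro k hk
    have hs := (eqSlice hf hg ht p).map_target hk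
    have h : f ((eqSlice hf hg ht p).symm (0, k)) = g ((eqSlice hf hg ht p).symm (0, k)) := by
      rw [(eqSlice_spec hf hg ht p).2.2.2 _ hs, (eqSlice hf hg ht p).right_inv hk]
    simp only [Function.comp_apply]
    rw [dif_pos h]

theorem eqChart_apply {f g : M → Y} (hf : ContMDiff I J ∞ f) (hg : ContMDiff I J ∞ g)
    (ht : EqTransverse I J f g) (p q : {p : M // f p = g p}) :
    eqChart hf hg ht p q = (eqSlice hf hg ht p q.1).2 := rfl

theorem eqChart_symm_val {f g : M → Y} (hf : ContMDiff I J ∞ f) (hg : ContMDiff I J ∞ g)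
    (ht : EqTransverse I J f g) (p : {p : M // f p = g p}) {k : EqModel 𝕜 E F}
    (hk : k ∈ (eqChart hf hg ht p).target) :
    ((eqChart hf hg ht p).symm k).1 = (eqSlice hf hg ht p).symm (0, k) := by
  have hs := (eqSlice hf hg ht p).map_target hk
  have h : f ((eqSlice hf hg ht p).symm (0, k)) = g ((eqSlice hf hg ht p).symm (0, k)) := by
    rw [(eqSlice_spec hf hg ht p).2.2.2 _ hs, (eqSlice hf hg ht p).right_inv hk]
  have h2 : (eqChart hf hg ht p).symm k = ⟨(eqSlice hf hg ht p).symm (0, k), h⟩ := dif_pos h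
  rw [h2]

/-- The smooth structure of `{f = g}` as a submanifold of `M`. -/
@[reducible] noncomputable def eqChartedSpace {f g : M → Y} (hf : ContMDiff I J ∞ f)
    (hg : ContMDiff I J ∞ g) (ht : EqTransverse I J f g) :
    ChartedSpace (EqModel 𝕜 E F) {p : M // f p = g p} where
  atlas := Set.range (eqChart hf hg ht)
  chartAt := eqChart hf hg ht
  mem_chart_source p := (eqSlice_spec hf hg ht p).1
  chart_mem_atlas p := ⟨p, rfl⟩

theorem eqIsManifold {f g : M → Y} (hf : ContMDiff I J ∞ f)
    (hg : ContMDiff I J ∞ g) (ht : EqTransverse I J f g) :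
    letI := eqChartedSpace hf hg ht
    IsManifold 𝓘(𝕜, EqModel 𝕜 E F) ∞ {p : M // f p = g p} := by
  let := eqChartedSpace hf hg ht
  apply isManifold_of_contDiffOn
  rintro _ _ ⟨p, rfl⟩ ⟨q, rfl⟩
  simp only [modelWithCornersSelf_coe, modelWithCornersSelf_coe_symm, Function.comp_id,
    Function.id_comp, Set.range_id, Set.inter_univ, Set.preimage_id]
  rw [← contMDiffOn_iff_contDiffOn]
  have hι : ContMDiff 𝓘(𝕜, EqModel 𝕜 E F) 𝓘(𝕜, F × EqModel 𝕜 E F) ∞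
      (fun k : EqModel 𝕜 E F => ((0 : F), k)) :=
    (contDiff_const.prodMk contDiff_id).contMDiff
  have h1 : ContMDiffOn 𝓘(𝕜, EqModel 𝕜 E F) I ∞
      (fun k => (eqSlice hf hg ht p).symm ((0 : F), k)) (eqChart hf hg ht p).target :=
    (eqSlice_spec hf hg ht p).2.2.1.comp hι.contMDiffOn fun _ h => h
  have hsub : ((eqChart hf hg ht p).symm.trans (eqChart hf hg ht q)).source ⊆
      (eqChart hf hg ht p).target := by
    rw [OpenPartialHomeomorph.trans_source]
    exact Set.inter_subset_left
  have h2 := (eqSlice_spec hf hg ht q).2.1.comp (h1.mono hsub) (fun k hk => by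
    have hk' := hk
    rw [OpenPartialHomeomorph.trans_source] at hk'
    have := hk'.2
    rw [Set.mem_preimage, ← eqChart_symm_val hf hg ht p (hsub hk)]
    exact this)
  have hs : ContMDiff 𝓘(𝕜, F × EqModel 𝕜 E F) 𝓘(𝕜, EqModel 𝕜 E F) ∞
      (Prod.snd : F × EqModel 𝕜 E F → EqModel 𝕜 E F) := contDiff_snd.contMDiff
  refine (hs.comp_contMDiffOn h2).congr fun k hk => ?_
  simp only [Function.comp_apply, OpenPartialHomeomorph.trans_apply]
  rw [eqChart_apply, eqChart_symm_val hf hg ht p (hsub hk)]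

theorem contMDiff_eq_val {f g : M → Y} (hf : ContMDiff I J ∞ f)
    (hg : ContMDiff I J ∞ g) (ht : EqTransverse I J f g) :
    letI := eqChartedSpace hf hg ht
    ContMDiff 𝓘(𝕜, EqModel 𝕜 E F) I ∞ (Subtype.val : {p : M // f p = g p} → M) := by
  let := eqChartedSpace hf hg ht
  have := eqIsManifold hf hg ht
  intro p
  have hι : ContMDiff 𝓘(𝕜, EqModel 𝕜 E F) 𝓘(𝕜, F × EqModel 𝕜 E F) ∞
      (fun k : EqModel 𝕜 E F => ((0 : F), k)) :=
    (contDiff_const.prodMk contDiff_id).contMDiff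
  have h1 : ContMDiffOn 𝓘(𝕜, EqModel 𝕜 E F) I ∞
      (fun k => (eqSlice hf hg ht p).symm ((0 : F), k)) (eqChart hf hg ht p).target :=
    (eqSlice_spec hf hg ht p).2.2.1.comp hι.contMDiffOn fun _ h => h
  have h2 : ContMDiffOn 𝓘(𝕜, EqModel 𝕜 E F) 𝓘(𝕜, EqModel 𝕜 E F) ∞ (eqChart hf hg ht p)
      (eqChart hf hg ht p).source :=
    contMDiffOn_chart (I := 𝓘(𝕜, EqModel 𝕜 E F)) (x := p)
  have h3 := h1.comp h2 (fun q hq => (eqChart hf hg ht p).map_source hq)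
  refine ((h3.congr (f₁ := Subtype.val) fun q hq => ?_).contMDiffAt
    ((eqChart hf hg ht p).open_source.mem_nhds (eqSlice_spec hf hg ht p).1))
  simp only [Function.comp_apply]
  rw [← eqChart_symm_val hf hg ht p ((eqChart hf hg ht p).map_source hq),
    (eqChart hf hg ht p).left_inv hq]

theorem contMDiffWithinAt_eq_lift {f g : M → Y} (hf : ContMDiff I J ∞ f)
    (hg : ContMDiff I J ∞ g) (ht : EqTransverse I J f g)
    {E' : Type*} [NormedAddCommGroup E'] [NormedSpace 𝕜 E']
    {H' : Type*} [TopologicalSpace H'] {I' : ModelWithCorners 𝕜 E' H'}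
    {N : Type*} [TopologicalSpace N] [ChartedSpace H' N]
    {h : N → {p : M // f p = g p}} {s : Set N} {x : N}
    (hh : ContMDiffWithinAt I' I ∞ (fun y => (h y).1) s x) :
    letI := eqChartedSpace hf hg ht
    ContMDiffWithinAt I' 𝓘(𝕜, EqModel 𝕜 E F) ∞ h s x := by
  let := eqChartedSpace hf hg ht
  have := eqIsManifold hf hg ht
  rw [contMDiffWithinAt_iff_target]
  refine ⟨Topology.IsInducing.subtypeVal.continuousWithinAt_iff.2 hh.continuousWithinAt, ?_⟩
  have h1 : ContMDiffAt I 𝓘(𝕜, F × EqModel 𝕜 E F) ∞ (eqSlice hf hg ht (h x)) (h x).1 :=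
    (eqSlice_spec hf hg ht (h x)).2.1.contMDiffAt
      ((eqSlice hf hg ht (h x)).open_source.mem_nhds (eqSlice_spec hf hg ht (h x)).1)
  have hs : ContMDiff 𝓘(𝕜, F × EqModel 𝕜 E F) 𝓘(𝕜, EqModel 𝕜 E F) ∞
      (Prod.snd : F × EqModel 𝕜 E F → EqModel 𝕜 E F) := contDiff_snd.contMDiff
  exact ContMDiffAt.comp_contMDiffWithinAt (f := fun y => (h y).1) x (hs.contMDiffAt.comp _ h1) hh

/-- The tangent space of `{f = g}` is the kernel of `f_* - g_*`. -/
theorem eq_tangent {f g : M → Y} (hf : ContMDiff I J ∞ f)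
    (hg : ContMDiff I J ∞ g) (ht : EqTransverse I J f g) (p : {p : M // f p = g p}) :
    letI := eqChartedSpace hf hg ht
    Function.Injective (tangentMapAt 𝓘(𝕜, EqModel 𝕜 E F) I
      (Subtype.val : {p : M // f p = g p} → M) p) ∧
    ∀ v : E, tangentMapAt I J f p.1 v = tangentMapAt I J g p.1 v →
      ∃ k, tangentMapAt 𝓘(𝕜, EqModel 𝕜 E F) I
        (Subtype.val : {p : M // f p = g p} → M) p k = v := by
  let := eqChartedSpace hf hg ht
  have := eqIsManifold hf hg ht
  have hv := contMDiff_eq_val hf hg ht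
  have hinj : Function.Injective (tangentMapAt 𝓘(𝕜, EqModel 𝕜 E F) I
      (Subtype.val : {p : M // f p = g p} → M) p) := by
    have h1 : MDifferentiableAt I 𝓘(𝕜, F × EqModel 𝕜 E F) (eqSlice hf hg ht p) p.1 :=
      ((eqSlice_spec hf hg ht p).2.1.contMDiffAt ((eqSlice hf hg ht p).open_source.mem_nhds
        (eqSlice_spec hf hg ht p).1)).mdifferentiableAt (by simp)
    have hs : MDifferentiableAt 𝓘(𝕜, F × EqModel 𝕜 E F) 𝓘(𝕜, EqModel 𝕜 E F)
      (Prod.snd : F × EqModel 𝕜 E F → EqModel 𝕜 E F) (eqSlice hf hg ht p p.1) :=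
      (contDiff_snd.contMDiff (n := 1)).mdifferentiableAt (by simp)
    have h2 : MDifferentiableAt I 𝓘(𝕜, EqModel 𝕜 E F)
      (Prod.snd ∘ eqSlice hf hg ht p) p.1 := hs.comp _ h1
    have h3 : MDifferentiableAt 𝓘(𝕜, EqModel 𝕜 E F) I
      (Subtype.val : {p : M // f p = g p} → M) p := (hv p).mdifferentiableAt (by simp)
    have h4 := mfderiv_comp p h2 h3
    have h5 : ((Prod.snd ∘ eqSlice hf hg ht p) ∘ (Subtype.val : {p : M // f p = g p} → M)) =
        extChartAt 𝓘(𝕜, EqModel 𝕜 E F) p := rfl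
    rw [h5] at h4
    obtain ⟨B, hB⟩ := isInvertible_mfderiv_extChartAt (I := 𝓘(𝕜, EqModel 𝕜 E F))
      (mem_extChartAt_source (I := 𝓘(𝕜, EqModel 𝕜 E F)) p)
    rw [← hB] at h4
    intro a b hab
    apply B.injective
    have e1 := congrArg (fun L => L a) h4
    have e2 := congrArg (fun L => L b) h4
    refine e1.trans (Eq.trans ?_ e2.symm)
    exact congrArg (mfderiv I 𝓘(𝕜, EqModel 𝕜 E F) (Prod.snd ∘ eqSlice hf hg ht p) p.1) hab
  refine ⟨hinj, ?_⟩
  let D : E →L[𝕜] F := tangentMapAt I J f p.1 - tangentMapAt I J g p.1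
  let V : EqModel 𝕜 E F →L[𝕜] E := tangentMapAt 𝓘(𝕜, EqModel 𝕜 E F) I
      (Subtype.val : {p : M // f p = g p} → M) p
  have hker : LinearMap.range (V : EqModel 𝕜 E F →ₗ[𝕜] E) ≤ LinearMap.ker (D : E →ₗ[𝕜] F) := by
    rintro _ ⟨k, rfl⟩
    have h3 : MDifferentiableAt 𝓘(𝕜, EqModel 𝕜 E F) I
      (Subtype.val : {p : M // f p = g p} → M) p := (hv p).mdifferentiableAt (by simp)
    have h6 := mfderiv_comp p ((hf p.1).mdifferentiableAt (by simp)) h3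
    have h7 := mfderiv_comp p ((hg p.1).mdifferentiableAt (by simp)) h3
    have h8 : f ∘ (Subtype.val : {p : M // f p = g p} → M) = g ∘ Subtype.val :=
      funext fun q => q.2
    have h9 : tangentMapAt I J f p.1 (V k) = tangentMapAt I J g p.1 (V k) := by
      have e1 : tangentMapAt 𝓘(𝕜, EqModel 𝕜 E F) J
          (f ∘ (Subtype.val : {p : M // f p = g p} → M)) p k = tangentMapAt I J f p.1 (V k) :=
        congrArg (fun L => L k) h6
      have e2 : tangentMapAt 𝓘(𝕜, EqModel 𝕜 E F) J
          (g ∘ (Subtype.val : {p : M // f p = g p} → M)) p k = tangentMapAt I J g p.1 (V k) :=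
        congrArg (fun L => L k) h7
      rw [← e1, ← e2, h8]
    change D (V k) = 0
    exact sub_eq_zero.2 h9
  have hDs : Function.Surjective (D : E →ₗ[𝕜] F) := ht p.1 p.2
  have hr := LinearMap.finrank_range_add_finrank_ker (D : E →ₗ[𝕜] F)
  rw [LinearMap.range_eq_top.2 hDs, finrank_top] at hr
  have hrV := LinearMap.finrank_range_of_inj (f := (V : EqModel 𝕜 E F →ₗ[𝕜] E)) hinj
  have hfr := ht.finrank_eq p.2
  have heq := Submodule.eq_of_le_of_finrank_eq hker (by omega)
  intro v hw
  have : v ∈ LinearMap.ker (D : E →ₗ[𝕜] F) := by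
    change D v = 0
    exact sub_eq_zero.2 hw
  rw [← heq] at this
  exact this
end Slice

/-- A smooth `𝕜`-manifold (holomorphic if `𝕜 = ℂ`): Hausdorff, second countable, of pure
finite dimension and without boundary. -/
structure Mfd (𝕜 : Type v) [RCLike 𝕜] : Type (max (u + 1) v) where
  carrier : Type u
  dim : ℕ
  [topologicalSpace : TopologicalSpace carrier]
  [chartedSpace : ChartedSpace (EuclideanSpace 𝕜 (Fin dim)) carrier]
  [isManifold : IsManifold 𝓘(𝕜, EuclideanSpace 𝕜 (Fin dim)) ∞ carrier]
  [t2Space : T2Space carrier]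
  [secondCountable : SecondCountableTopology carrier]

attribute [instance] Mfd.topologicalSpace Mfd.chartedSpace Mfd.isManifold Mfd.t2Space
  Mfd.secondCountable

section

variable {𝕜 : Type v} [RCLike 𝕜]

instance : CoeSort (Mfd.{u} 𝕜) (Type u) := ⟨Mfd.carrier⟩

/-- The model vector space. It is also the tangent space of `M` at each point `x`: Mathlib's
`TangentSpace` is by definition the model space, `T_x M` being identified with it through the
preferred chart at `x`. In particular, equal points have the same tangent space. -/
abbrev Mfd.Model (M : Mfd.{u} 𝕜) : Type v := EuclideanSpace 𝕜 (Fin M.dim)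

noncomputable abbrev Mfd.I (M : Mfd.{u} 𝕜) : ModelWithCorners 𝕜 M.Model M.Model := 𝓘(𝕜, M.Model)

/-- Smooth maps. -/
abbrev Smooth {M N : Mfd.{u} 𝕜} (f : M → N) : Prop := ContMDiff M.I N.I ∞ f

/-- The differential `f_* : T_x M → T_{f x} N`. -/
noncomputable abbrev diff {M N : Mfd.{u} 𝕜} (f : M → N) (x : M) : M.Model →L[𝕜] N.Model :=
  tangentMapAt M.I N.I f x

/-- Submersions: maps whose differentials are onto. -/
def Submersive {M N : Mfd.{u} 𝕜} (f : M → N) : Prop :=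
  ∀ x, Function.Surjective (diff f x)

/-- The submanifold `{f = g}` of a manifold `M`, for smooth `f, g : M → Y` that are transverse
along it. -/
noncomputable def eqMfd
    {E : Type*} [NormedAddCommGroup E] [NormedSpace 𝕜 E] [FiniteDimensional 𝕜 E]
    {H : Type*} [TopologicalSpace H] {I : ModelWithCorners 𝕜 E H} [I.Boundaryless]
    {M : Type u} [TopologicalSpace M] [ChartedSpace H M] [IsManifold I ∞ M]
    [T2Space M] [SecondCountableTopology M]
    {F : Type*} [NormedAddCommGroup F] [NormedSpace 𝕜 F] [FiniteDimensional 𝕜 F]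
    {G : Type*} [TopologicalSpace G] {J : ModelWithCorners 𝕜 F G}
    {Y : Type*} [TopologicalSpace Y] [ChartedSpace G Y] [IsManifold J ∞ Y]
    {f g : M → Y} (hf : ContMDiff I J ∞ f) (hg : ContMDiff I J ∞ g)
    (ht : EqTransverse I J f g) : Mfd.{u} 𝕜 where
  carrier := {p : M // f p = g p}
  dim := Module.finrank 𝕜 E - Module.finrank 𝕜 F
  topologicalSpace := instTopologicalSpaceSubtype
  chartedSpace := eqChartedSpace hf hg ht
  isManifold := eqIsManifold hf hg ht
  t2Space := inferInstance
  secondCountable := TopologicalSpace.Subtype.secondCountableTopology {p : M | f p = g p}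

theorem diff_comp {M N P : Mfd.{u} 𝕜} {g : N → P} {f : M → N} (hg : Smooth g) (hf : Smooth f)
    (x : M) (v : M.Model) : diff (fun y => g (f y)) x v = diff g (f x) (diff f x v) :=
  congrArg (fun L => L v) (mfderiv_comp x ((hg (f x)).mdifferentiableAt (by simp))
    ((hf x).mdifferentiableAt (by simp)))

/-! ### Differential forms -/

/-- Not necessarily smooth differential forms of degree `k`: the value at `x` is an alternating
form on `T_x M`. -/
abbrev Form (M : Mfd.{u} 𝕜) (k : ℕ) : Type _ := M → M.Model [⋀^Fin k]→L[𝕜] 𝕜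

/-- The pullback `f^* α`. -/
noncomputable def pullback {M N : Mfd.{u} 𝕜} {k : ℕ} (f : M → N) (α : Form N k) : Form M k :=
  fun x => (α (f x)).compContinuousLinearMap (diff f x)

/-- The expression of a form in the preferred chart at `x`, i.e. its pullback by the inverse of
that chart. -/
noncomputable def formInChart {M : Mfd.{u} 𝕜} {k : ℕ} (α : Form M k) (x : M) :
    M.Model → M.Model [⋀^Fin k]→L[𝕜] 𝕜 :=
  fun e => (α ((extChartAt M.I x).symm e)).compContinuousLinearMap
    (tangentMapAt 𝓘(𝕜, M.Model) M.I (extChartAt M.I x).symm e)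

def SmoothForm {M : Mfd.{u} 𝕜} {k : ℕ} (α : Form M k) : Prop :=
  ∀ x, ContDiffOn 𝕜 ∞ (formInChart α x) (extChartAt M.I x).target

/-- The exterior derivative. At `x` it is computed in the preferred chart at `x`, the one that
identifies `T_x M` with the model space. -/
noncomputable def extD {M : Mfd.{u} 𝕜} {k : ℕ} (α : Form M k) : Form M (k + 1) :=
  fun x => extDeriv (formInChart α x) (extChartAt M.I x x)

/-! ### Lie groupoids -/

/-- Lie groupoids. The product `mul g h` is meaningful only if `src g = tgt h`; the values of `mul`
on other pairs play no role. As `{(g, h) | src g = tgt h}` is an embedded submanifold of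
`Arr × Arr`, smoothness of `mul` on this set, in the sense of `ContMDiffOn`, is the same as
smoothness on the submanifold. -/
structure LieGroupoid (𝕜 : Type v) [RCLike 𝕜] : Type (max (u + 1) v) where
  Obj : Mfd.{u} 𝕜
  Arr : Mfd.{u} 𝕜
  src : Arr → Obj
  tgt : Arr → Obj
  one : Obj → Arr
  inv : Arr → Arr
  mul : Arr → Arr → Arr
  smooth_src : Smooth src
  smooth_tgt : Smooth tgt
  smooth_one : Smooth one
  smooth_inv : Smooth inv
  submersive_src : Submersive src
  smooth_mul : ContMDiffOn (Arr.I.prod Arr.I) Arr.I ∞ (fun p : Arr × Arr => mul p.1 p.2)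
    {p | src p.1 = tgt p.2}
  src_one : ∀ x, src (one x) = x
  tgt_one : ∀ x, tgt (one x) = x
  src_inv : ∀ g, src (inv g) = tgt g
  tgt_inv : ∀ g, tgt (inv g) = src g
  src_mul : ∀ g h, src g = tgt h → src (mul g h) = src h
  tgt_mul : ∀ g h, src g = tgt h → tgt (mul g h) = tgt g
  one_mul : ∀ g, mul (one (tgt g)) g = g
  mul_one : ∀ g, mul g (one (src g)) = g
  inv_mul : ∀ g, mul (inv g) g = one (src g)
  mul_inv : ∀ g, mul g (inv g) = one (tgt g)
  mul_assoc : ∀ g h k, src g = tgt h → src h = tgt k → mul (mul g h) k = mul g (mul h k)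

namespace LieGroupoid

theorem inv_inv (G : LieGroupoid.{u} 𝕜) (g : G.Arr) : G.inv (G.inv g) = g := by
  have h1 := G.mul_assoc (G.inv (G.inv g)) (G.inv g) g
    (by rw [G.src_inv]) (by rw [G.src_inv])
  rw [G.inv_mul, G.inv_mul, G.src_inv, G.one_mul] at h1
  have h2 := G.mul_one (G.inv (G.inv g))
  rw [G.src_inv, G.tgt_inv] at h2
  exact (h1.trans h2).symm

theorem submersive_tgt (G : LieGroupoid.{u} 𝕜) : Submersive G.tgt := by
  intro g w
  obtain ⟨v, hv⟩ := G.submersive_src (G.inv g) w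
  have hi := diff_comp G.smooth_inv G.smooth_inv (G.inv g)
  have h1 : (fun y => G.inv (G.inv y)) = id := funext G.inv_inv
  have ht : (fun y => G.src (G.inv y)) = G.tgt := funext G.src_inv
  refine ⟨diff G.inv (G.inv g) v, ?_⟩
  have h2 := diff_comp G.smooth_src G.smooth_inv g (diff G.inv (G.inv g) v)
  rw [ht] at h2
  rw [h2]
  have h3 : diff G.inv g (diff G.inv (G.inv g) v) = v := by
    have h4 := hi v
    rw [h1, G.inv_inv] at h4
    rw [← h4]
    exact congrArg (fun L => L v) (mfderiv_id (I := G.Arr.I) (x := G.inv g))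
  rw [h3, hv]

end LieGroupoid

/-! ### Fibre products over the arrows of a Lie groupoid -/

/-- For `μ : X → G.Obj` and `ν : Y → G.Obj`, transversality of `μ × ν : X × Y → G.Obj × G.Obj` and
`(src, tgt) : G.Arr → G.Obj × G.Obj`. -/
def ArrTransverse (G : LieGroupoid.{u} 𝕜) {X Y : Mfd.{u} 𝕜} (μ : X → G.Obj) (ν : Y → G.Obj) :
    Prop :=
  ∀ (x : X) (g : G.Arr) (y : Y), μ x = G.src g → ν y = G.tgt g →
    ∀ a b : G.Obj.Model, ∃ (u : X.Model) (w : G.Arr.Model) (v : Y.Model),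
      diff μ x u + diff G.src g w = a ∧ diff ν y v + diff G.tgt g w = b

section ArrFibre

variable {G : LieGroupoid.{u} 𝕜} {X Y : Mfd.{u} 𝕜} {μ : X → G.Obj} {ν : Y → G.Obj}

theorem smooth_legs (hμ : Smooth μ) (hν : Smooth ν) :
    ContMDiff (X.I.prod (G.Arr.I.prod Y.I)) (G.Obj.I.prod G.Obj.I) ∞
      (fun q : X × (G.Arr × Y) => (μ q.1, ν q.2.2)) :=
  (hμ.comp contMDiff_fst).prodMk (hν.comp (contMDiff_snd.comp contMDiff_snd))

theorem smooth_ends (G : LieGroupoid.{u} 𝕜) (X Y : Mfd.{u} 𝕜) :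
    ContMDiff (X.I.prod (G.Arr.I.prod Y.I)) (G.Obj.I.prod G.Obj.I) ∞
      (fun q : X × (G.Arr × Y) => (G.src q.2.1, G.tgt q.2.1)) :=
  (G.smooth_src.comp (contMDiff_fst.comp contMDiff_snd)).prodMk
    (G.smooth_tgt.comp (contMDiff_fst.comp contMDiff_snd))

theorem diff_legs (hμ : Smooth μ) (hν : Smooth ν) (q : X × (G.Arr × Y))
    (v : X.Model × (G.Arr.Model × Y.Model)) :
    tangentMapAt (X.I.prod (G.Arr.I.prod Y.I)) (G.Obj.I.prod G.Obj.I)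
      (fun q : X × (G.Arr × Y) => (μ q.1, ν q.2.2)) q v =
      (diff μ q.1 v.1, diff ν q.2.2 v.2.2) := by
  have h1 : HasMFDerivAt (X.I.prod (G.Arr.I.prod Y.I)) G.Obj.I
      (fun q : X × (G.Arr × Y) => μ q.1) q _ :=
    ((hμ q.1).mdifferentiableAt (by simp)).hasMFDerivAt.comp q (hasMFDerivAt_fst q)
  have h2 : HasMFDerivAt (X.I.prod (G.Arr.I.prod Y.I)) G.Obj.I
      (fun q : X × (G.Arr × Y) => ν q.2.2) q _ :=
    ((hν q.2.2).mdifferentiableAt (by simp)).hasMFDerivAt.comp q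
      ((hasMFDerivAt_snd q.2).comp q (hasMFDerivAt_snd q))
  exact congrArg (fun L => L v) (h1.prodMk h2).mfderiv

theorem diff_ends (q : X × (G.Arr × Y)) (v : X.Model × (G.Arr.Model × Y.Model)) :
    tangentMapAt (X.I.prod (G.Arr.I.prod Y.I)) (G.Obj.I.prod G.Obj.I)
      (fun q : X × (G.Arr × Y) => (G.src q.2.1, G.tgt q.2.1)) q v =
      (diff G.src q.2.1 v.2.1, diff G.tgt q.2.1 v.2.1) := by
  have h0 : HasMFDerivAt (X.I.prod (G.Arr.I.prod Y.I)) G.Arr.I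
      (fun q : X × (G.Arr × Y) => q.2.1) q _ :=
    (hasMFDerivAt_fst q.2).comp q (hasMFDerivAt_snd q)
  have h1 : HasMFDerivAt (X.I.prod (G.Arr.I.prod Y.I)) G.Obj.I
      (fun q : X × (G.Arr × Y) => G.src q.2.1) q _ :=
    ((G.smooth_src q.2.1).mdifferentiableAt (by simp)).hasMFDerivAt.comp q h0
  have h2 : HasMFDerivAt (X.I.prod (G.Arr.I.prod Y.I)) G.Obj.I
      (fun q : X × (G.Arr × Y) => G.tgt q.2.1) q _ :=
    ((G.smooth_tgt q.2.1).mdifferentiableAt (by simp)).hasMFDerivAt.comp q h0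
  exact congrArg (fun L => L v) (h1.prodMk h2).mfderiv

theorem ArrTransverse.eqTransverse (ht : ArrTransverse G μ ν) (hμ : Smooth μ) (hν : Smooth ν) :
    EqTransverse (X.I.prod (G.Arr.I.prod Y.I)) (G.Obj.I.prod G.Obj.I)
      (fun q : X × (G.Arr × Y) => (μ q.1, ν q.2.2))
      (fun q : X × (G.Arr × Y) => (G.src q.2.1, G.tgt q.2.1)) := by
  rintro ⟨x, g, y⟩ hp ⟨a, b⟩
  obtain ⟨u, w, v, h1, h2⟩ := ht x g y (congrArg Prod.fst hp) (congrArg Prod.snd hp) a b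
  refine ⟨(u, -w, v), ?_⟩
  rw [diff_legs hμ hν, diff_ends]
  simp only [map_neg, Prod.mk_sub_mk, sub_neg_eq_add, h1, h2]

/-- The manifold `X ×_{μ, src} G.Arr ×_{tgt, ν} Y`. -/
noncomputable def arrFibre (hμ : Smooth μ) (hν : Smooth ν) (ht : ArrTransverse G μ ν) :
    Mfd.{u} 𝕜 :=
  eqMfd (smooth_legs hμ hν) (smooth_ends G X Y) (ht.eqTransverse hμ hν)

variable (hμ : Smooth μ) (hν : Smooth ν) (ht : ArrTransverse G μ ν)

/-- The element `(x, g, y)` of `X ×_{μ, src} G.Arr ×_{tgt, ν} Y`. -/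
def arrFibreMk (x : X) (g : G.Arr) (y : Y) (h1 : μ x = G.src g) (h2 : ν y = G.tgt g) :
    arrFibre hμ hν ht := ⟨(x, g, y), Prod.ext h1 h2⟩

variable {hμ hν ht}

def fLeft (q : arrFibre hμ hν ht) : X := q.1.1
def fMid (q : arrFibre hμ hν ht) : G.Arr := q.1.2.1
def fRight (q : arrFibre hμ hν ht) : Y := q.1.2.2

theorem fLeft_eq (q : arrFibre hμ hν ht) : μ (fLeft q) = G.src (fMid q) :=
  congrArg Prod.fst q.2
theorem fRight_eq (q : arrFibre hμ hν ht) : ν (fRight q) = G.tgt (fMid q) :=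
  congrArg Prod.snd q.2

theorem arrFibre_ext {q r : arrFibre hμ hν ht} (h1 : (fLeft q) = (fLeft r)) (h2 : (fMid q) = (fMid r))
    (h3 : (fRight q) = (fRight r)) : q = r :=
  Subtype.ext (Prod.ext h1 (Prod.ext h2 h3))

theorem smooth_val : ContMDiff (arrFibre hμ hν ht).I (X.I.prod (G.Arr.I.prod Y.I)) ∞
    (fun q : arrFibre hμ hν ht => q.1) :=
  contMDiff_eq_val (smooth_legs hμ hν) (smooth_ends G X Y) (ht.eqTransverse hμ hν)

theorem smooth_left : Smooth (fLeft (hμ := hμ) (hν := hν) (ht := ht)) := contMDiff_fst.comp smooth_val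
theorem smooth_mid : Smooth (fMid (hμ := hμ) (hν := hν) (ht := ht)) :=
  contMDiff_fst.comp (contMDiff_snd.comp smooth_val)
theorem smooth_right : Smooth (fRight (hμ := hμ) (hν := hν) (ht := ht)) :=
  contMDiff_snd.comp (contMDiff_snd.comp smooth_val)

/-- A map into the fibre product is smooth if its three components are. -/
theorem arrFibre_lift {E' : Type*} [NormedAddCommGroup E'] [NormedSpace 𝕜 E']
    {H' : Type*} [TopologicalSpace H'] {I' : ModelWithCorners 𝕜 E' H'}
    {N : Type*} [TopologicalSpace N] [ChartedSpace H' N]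
    {h : N → arrFibre hμ hν ht} {s : Set N}
    (h1 : ContMDiffOn I' X.I ∞ (fun z => fLeft (h z)) s)
    (h2 : ContMDiffOn I' G.Arr.I ∞ (fun z => fMid (h z)) s)
    (h3 : ContMDiffOn I' Y.I ∞ (fun z => fRight (h z)) s) :
    ContMDiffOn I' (arrFibre hμ hν ht).I ∞ h s := fun z hz =>
  contMDiffWithinAt_eq_lift (smooth_legs hμ hν) (smooth_ends G X Y) (ht.eqTransverse hμ hν)
    ((h1 z hz).prodMk ((h2 z hz).prodMk (h3 z hz)))

theorem diff_val (q : arrFibre hμ hν ht) (k : (arrFibre hμ hν ht).Model) :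
    tangentMapAt (arrFibre hμ hν ht).I (X.I.prod (G.Arr.I.prod Y.I))
      (fun q : arrFibre hμ hν ht => q.1) q k =
    (diff (fLeft (hμ := hμ) (hν := hν) (ht := ht)) q k, diff (fMid (hμ := hμ) (hν := hν) (ht := ht)) q k,
      diff (fRight (hμ := hμ) (hν := hν) (ht := ht)) q k) := by
  have h1 := ((smooth_left (ht := ht) q).mdifferentiableAt (by simp)).hasMFDerivAt
  have h2 := ((smooth_mid (ht := ht) q).mdifferentiableAt (by simp)).hasMFDerivAt
  have h3 := ((smooth_right (ht := ht) q).mdifferentiableAt (by simp)).hasMFDerivAt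
  exact congrArg (fun L => L k) (h1.prodMk (h2.prodMk h3)).mfderiv

theorem arrFibre_tangent_ext (q : arrFibre hμ hν ht) {k k' : (arrFibre hμ hν ht).Model}
    (h1 : diff (fLeft (hμ := hμ) (hν := hν) (ht := ht)) q k = diff (fLeft (hμ := hμ) (hν := hν) (ht := ht)) q k')
    (h2 : diff (fMid (hμ := hμ) (hν := hν) (ht := ht)) q k = diff (fMid (hμ := hμ) (hν := hν) (ht := ht)) q k')
    (h3 : diff (fRight (hμ := hμ) (hν := hν) (ht := ht)) q k = diff (fRight (hμ := hμ) (hν := hν) (ht := ht)) q k') : k = k' := by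
  refine (eq_tangent (smooth_legs hμ hν) (smooth_ends G X Y) (ht.eqTransverse hμ hν) q).1 ?_
  exact (diff_val q k).trans (Eq.trans (by rw [h1, h2, h3]) (diff_val q k').symm)

theorem arrFibre_tangent_exists (q : arrFibre hμ hν ht) (u : X.Model) (w : G.Arr.Model)
    (v : Y.Model) (h1 : diff μ (fLeft q) u = diff G.src (fMid q) w)
    (h2 : diff ν (fRight q) v = diff G.tgt (fMid q) w) :
    ∃ k, diff (fLeft (hμ := hμ) (hν := hν) (ht := ht)) q k = u ∧ diff (fMid (hμ := hμ) (hν := hν) (ht := ht)) q k = w ∧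
      diff (fRight (hμ := hμ) (hν := hν) (ht := ht)) q k = v := by
  obtain ⟨k, hk⟩ := (eq_tangent (smooth_legs hμ hν) (smooth_ends G X Y)
    (ht.eqTransverse hμ hν) q).2 (u, w, v) (by
      rw [diff_legs hμ hν, diff_ends]; exact Prod.ext h1 h2)
  have h := (diff_val q k).symm.trans hk
  exact ⟨k, congrArg Prod.fst h, congrArg (fun z => z.2.1) h, congrArg (fun z => z.2.2) h⟩

end ArrFibre

/-! ### Morphisms -/

/-- Morphisms of Lie groupoids. -/
structure LieGroupoid.Hom (H G : LieGroupoid.{u} 𝕜) where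
  obj : H.Obj → G.Obj
  arr : H.Arr → G.Arr
  smooth_obj : Smooth obj
  smooth_arr : Smooth arr
  src_arr : ∀ h, G.src (arr h) = obj (H.src h)
  tgt_arr : ∀ h, G.tgt (arr h) = obj (H.tgt h)
  arr_mul : ∀ g h, H.src g = H.tgt h → arr (H.mul g h) = G.mul (arr g) (arr h)

def LieGroupoid.Hom.comp {K H G : LieGroupoid.{u} 𝕜} (F : H.Hom G) (F' : K.Hom H) : K.Hom G where
  obj x := F.obj (F'.obj x)
  arr k := F.arr (F'.arr k)
  smooth_obj := F.smooth_obj.comp F'.smooth_obj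
  smooth_arr := F.smooth_arr.comp F'.smooth_arr
  src_arr k := by rw [F.src_arr, F'.src_arr]
  tgt_arr k := by rw [F.tgt_arr, F'.tgt_arr]
  arr_mul g h e := by rw [F'.arr_mul g h e, F.arr_mul _ _ (by rw [F'.src_arr, F'.tgt_arr, e])]

/-- Smooth natural transformations `F ⇒ F'`. -/
structure NatTransf {H G : LieGroupoid.{u} 𝕜} (F F' : H.Hom G) where
  app : H.Obj → G.Arr
  smooth_app : Smooth app
  src_app : ∀ x, G.src (app x) = F.obj x
  tgt_app : ∀ x, G.tgt (app x) = F'.obj x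
  naturality : ∀ h, G.mul (app (H.tgt h)) (F.arr h) = G.mul (F'.arr h) (app (H.src h))

theorem Submersive.arrTransverse {G : LieGroupoid.{u} 𝕜} {X Y : Mfd.{u} 𝕜} {μ : X → G.Obj}
    {ν : Y → G.Obj} (hμ : Submersive μ) (hν : Submersive ν) : ArrTransverse G μ ν := by
  intro x g y _ _ a b
  obtain ⟨u, hu⟩ := hμ x a
  obtain ⟨v, hv⟩ := hν y b
  exact ⟨u, 0, v, by simp [hu], by simp [hv]⟩

/-- The canonical morphism `H → (F.obj)^* G`, on arrows. -/
noncomputable def LieGroupoid.Hom.toPullback {H G : LieGroupoid.{u} 𝕜} (F : H.Hom G)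
    (hF : Submersive F.obj) (h : H.Arr) :
    arrFibre (G := G) F.smooth_obj F.smooth_obj (hF.arrTransverse hF) :=
  arrFibreMk _ _ _ (H.src h) (F.arr h) (H.tgt h) (F.src_arr h).symm (F.tgt_arr h).symm

/-- Morita morphisms: `F.obj` is a surjective submersion, and the canonical morphism
`H → (F.obj)^* G`, which is the identity on objects, is an isomorphism of Lie groupoids, i.e. a
diffeomorphism on arrows. -/
def LieGroupoid.Hom.IsMorita {H G : LieGroupoid.{u} 𝕜} (F : H.Hom G) : Prop :=
  Function.Surjective F.obj ∧ ∃ hF : Submersive F.obj,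
    ∃ k : arrFibre (G := G) F.smooth_obj F.smooth_obj (hF.arrTransverse hF) → H.Arr, Smooth k ∧
      Function.LeftInverse k (F.toPullback hF) ∧ Function.RightInverse k (F.toPullback hF)

/-! ### Homotopy fibre products -/

section HFibre

variable {L₁ L₂ G : LieGroupoid.{u} 𝕜} (μ : L₁.Hom G) (ν : L₂.Hom G)

theorem ArrTransverse.arr {μ : L₁.Hom G} {ν : L₂.Hom G} (ht : ArrTransverse G μ.obj ν.obj) :
    ArrTransverse G (fun l => μ.obj (L₁.src l)) (fun l => ν.obj (L₂.src l)) := by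
  intro l g m h1 h2 a b
  obtain ⟨u, w, v, hu, hv⟩ := ht _ g _ h1 h2 a b
  obtain ⟨u', rfl⟩ := L₁.submersive_src l u
  obtain ⟨v', rfl⟩ := L₂.submersive_src m v
  refine ⟨u', w, v', ?_, ?_⟩
  · rw [diff_comp μ.smooth_obj L₁.smooth_src, hu]
  · rw [diff_comp ν.smooth_obj L₂.smooth_src, hv]

variable (ht : ArrTransverse G μ.obj ν.obj)

/-- Objects `(x, g, y)` with `g : μ x → ν y`. -/
noncomputable abbrev hfObj : Mfd.{u} 𝕜 := arrFibre μ.smooth_obj ν.smooth_obj ht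

/-- Arrows `(l, g, m)`, with source `(src l, g, src m)`. -/
noncomputable abbrev hfArr : Mfd.{u} 𝕜 :=
  arrFibre (μ.smooth_obj.comp L₁.smooth_src) (ν.smooth_obj.comp L₂.smooth_src) ht.arr

end HFibre
namespace LieGroupoid

theorem cancel_left (G : LieGroupoid.{u} 𝕜) (g h : G.Arr) (e : G.src g = G.tgt h) :
    G.mul (G.inv g) (G.mul g h) = h := by
  rw [← G.mul_assoc _ _ _ (G.src_inv g) e, G.inv_mul, e, G.one_mul]

theorem Hom.arr_one {H G : LieGroupoid.{u} 𝕜} (F : H.Hom G) (x : H.Obj) :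
    F.arr (H.one x) = G.one (F.obj x) := by
  have hs : G.src (F.arr (H.one x)) = F.obj x := by rw [F.src_arr, H.src_one]
  have htt : G.tgt (F.arr (H.one x)) = F.obj x := by rw [F.tgt_arr, H.tgt_one]
  have h1 : F.arr (H.one x) = G.mul (F.arr (H.one x)) (F.arr (H.one x)) := by
    rw [← F.arr_mul _ _ (by rw [H.src_one, H.tgt_one])]
    have := H.mul_one (H.one x)
    rw [H.src_one] at this
    rw [this]
  have h2 := G.cancel_left (F.arr (H.one x)) (F.arr (H.one x)) (by rw [hs, htt])
  rw [← h1, G.inv_mul, hs] at h2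
  exact h2.symm

theorem Hom.arr_inv {H G : LieGroupoid.{u} 𝕜} (F : H.Hom G) (h : H.Arr) :
    F.arr (H.inv h) = G.inv (F.arr h) := by
  have h1 := G.cancel_left (F.arr h) (F.arr (H.inv h)) (by rw [F.src_arr, F.tgt_arr, H.tgt_inv])
  rw [← F.arr_mul _ _ (H.tgt_inv h).symm, H.mul_inv, F.arr_one] at h1
  rw [← h1]
  have h2 := G.mul_one (G.inv (F.arr h))
  rw [G.src_inv, F.tgt_arr] at h2
  exact h2

end LieGroupoid

section HFibre

variable {L₁ L₂ G : LieGroupoid.{u} 𝕜} {μ : L₁.Hom G} {ν : L₂.Hom G}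
  {ht : ArrTransverse G μ.obj ν.obj}

theorem hf_left (q : hfArr μ ν ht) : μ.obj (L₁.src (fLeft q)) = G.src (fMid q) := fLeft_eq q
theorem hf_right (q : hfArr μ ν ht) : ν.obj (L₂.src (fRight q)) = G.tgt (fMid q) := fRight_eq q

/-- `(l, g, m) ↦ ν m · g · (μ l)⁻¹`. -/
def hfTgtMid (q : hfArr μ ν ht) : G.Arr :=
  G.mul (G.mul (ν.arr (fRight q)) (fMid q)) (G.inv (μ.arr (fLeft q)))

theorem hf_comp1 (q : hfArr μ ν ht) : G.src (ν.arr (fRight q)) = G.tgt (fMid q) := by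
  rw [ν.src_arr, hf_right]

theorem hf_comp2 (q : hfArr μ ν ht) :
    G.src (G.mul (ν.arr (fRight q)) (fMid q)) = G.tgt (G.inv (μ.arr (fLeft q))) := by
  rw [G.src_mul _ _ (hf_comp1 q), G.tgt_inv, μ.src_arr, hf_left]

theorem hf_src_tgtMid (q : hfArr μ ν ht) :
    μ.obj (L₁.tgt (fLeft q)) = G.src (hfTgtMid q) := by
  rw [hfTgtMid, G.src_mul _ _ (hf_comp2 q), G.src_inv, μ.tgt_arr]

theorem hf_tgt_tgtMid (q : hfArr μ ν ht) :
    ν.obj (L₂.tgt (fRight q)) = G.tgt (hfTgtMid q) := by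
  rw [hfTgtMid, G.tgt_mul _ _ (hf_comp2 q), G.tgt_mul _ _ (hf_comp1 q), ν.tgt_arr]

/-- The source of `(l, g, m)` is `(src l, g, src m)`. -/
noncomputable def hfSrc (q : hfArr μ ν ht) : hfObj μ ν ht :=
  arrFibreMk _ _ _ (L₁.src (fLeft q)) (fMid q) (L₂.src (fRight q)) (hf_left q) (hf_right q)

/-- The target of `(l, g, m)` is `(tgt l, ν m · g · (μ l)⁻¹, tgt m)`. -/
noncomputable def hfTgt (q : hfArr μ ν ht) : hfObj μ ν ht :=
  arrFibreMk _ _ _ (L₁.tgt (fLeft q)) (hfTgtMid q) (L₂.tgt (fRight q)) (hf_src_tgtMid q)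
    (hf_tgt_tgtMid q)

/-- The identity of `(x, g, y)` is `(1, g, 1)`. -/
noncomputable def hfOne (q : hfObj μ ν ht) : hfArr μ ν ht :=
  arrFibreMk _ _ _ (L₁.one (fLeft q)) (fMid q) (L₂.one (fRight q))
    ((congrArg μ.obj (L₁.src_one _)).trans (fLeft_eq q))
    ((congrArg ν.obj (L₂.src_one _)).trans (fRight_eq q))

/-- The inverse of `(l, g, m)` is `(l⁻¹, ν m · g · (μ l)⁻¹, m⁻¹)`. -/
noncomputable def hfInv (q : hfArr μ ν ht) : hfArr μ ν ht :=
  arrFibreMk _ _ _ (L₁.inv (fLeft q)) (hfTgtMid q) (L₂.inv (fRight q))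
    ((congrArg μ.obj (L₁.src_inv _)).trans (hf_src_tgtMid q))
    ((congrArg ν.obj (L₂.src_inv _)).trans (hf_tgt_tgtMid q))

theorem hf_composable {q r : hfArr μ ν ht} (h : hfSrc q = hfTgt r) :
    L₁.src (fLeft q) = L₁.tgt (fLeft r) ∧ fMid q = hfTgtMid r ∧
      L₂.src (fRight q) = L₂.tgt (fRight r) :=
  ⟨congrArg fLeft h, congrArg fMid h, congrArg fRight h⟩

open Classical in
/-- The product of `(l, g, m)` and `(l', g', m')` is `(l l', g', m m')`. -/
noncomputable def hfMul (q r : hfArr μ ν ht) : hfArr μ ν ht :=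
  if h : hfSrc q = hfTgt r then
    arrFibreMk _ _ _ (L₁.mul (fLeft q) (fLeft r)) (fMid r) (L₂.mul (fRight q) (fRight r))
      ((congrArg μ.obj (L₁.src_mul _ _ (hf_composable h).1)).trans (hf_left r))
      ((congrArg ν.obj (L₂.src_mul _ _ (hf_composable h).2.2)).trans (hf_right r))
  else q

theorem hfMul_left {q r : hfArr μ ν ht} (h : hfSrc q = hfTgt r) :
    fLeft (hfMul q r) = L₁.mul (fLeft q) (fLeft r) := by rw [hfMul, dif_pos h]; rfl
theorem hfMul_mid {q r : hfArr μ ν ht} (h : hfSrc q = hfTgt r) :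
    fMid (hfMul q r) = fMid r := by rw [hfMul, dif_pos h]; rfl
theorem hfMul_right {q r : hfArr μ ν ht} (h : hfSrc q = hfTgt r) :
    fRight (hfMul q r) = L₂.mul (fRight q) (fRight r) := by rw [hfMul, dif_pos h]; rfl

theorem hf_comp0 (q : hfArr μ ν ht) : G.src (fMid q) = G.src (μ.arr (fLeft q)) := by
  rw [μ.src_arr, hf_left]

/-- The naturality square of an arrow of the homotopy fibre product. -/
theorem hf_square (q : hfArr μ ν ht) :
    G.mul (hfTgtMid q) (μ.arr (fLeft q)) = G.mul (ν.arr (fRight q)) (fMid q) := by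
  have h := hf_comp0 q
  rw [hfTgtMid, G.mul_assoc _ _ _ (hf_comp2 q) (G.src_inv _), G.inv_mul, ← h,
    ← G.src_mul _ _ (hf_comp1 q), G.mul_one]

theorem hf_unique (q : hfArr μ ν ht) (k : G.Arr) (hk : G.src k = G.tgt (μ.arr (fLeft q)))
    (h : G.mul k (μ.arr (fLeft q)) = G.mul (ν.arr (fRight q)) (fMid q)) : hfTgtMid q = k := by
  rw [hfTgtMid, ← h, G.mul_assoc _ _ _ hk (G.tgt_inv _).symm, G.mul_inv, ← hk, G.mul_one]

theorem hfTgtMid_one (q : hfObj μ ν ht) : hfTgtMid (hfOne q) = fMid q := by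
  have e1 : μ.arr (fLeft (hfOne q)) = G.one (G.src (fMid q)) :=
    (μ.arr_one _).trans (congrArg G.one (fLeft_eq q))
  have e2 : ν.arr (fRight (hfOne q)) = G.one (G.tgt (fMid q)) :=
    (ν.arr_one _).trans (congrArg G.one (fRight_eq q))
  apply hf_unique
  · rw [e1, G.tgt_one]
  · rw [e1, e2]
    exact (G.mul_one _).trans (G.one_mul _).symm

theorem hfTgtMid_inv (q : hfArr μ ν ht) : hfTgtMid (hfInv q) = fMid q := by
  have e1 : μ.arr (fLeft (hfInv q)) = G.inv (μ.arr (fLeft q)) := μ.arr_inv _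
  have e2 : ν.arr (fRight (hfInv q)) = G.inv (ν.arr (fRight q)) := ν.arr_inv _
  have e3 : G.src (hfTgtMid q) = G.tgt (μ.arr (fLeft q)) := by
    rw [← hf_src_tgtMid, μ.tgt_arr]
  apply hf_unique
  · rw [e1, G.tgt_inv, hf_comp0]
  · rw [e1, e2]
    change _ = G.mul _ (hfTgtMid q)
    have h1 := G.cancel_left _ _ (hf_comp1 q)
    rw [← hf_square q] at h1
    have h2 := congrArg (fun z => G.mul z (G.inv (μ.arr (fLeft q)))) h1
    have e4 : G.src (G.inv (ν.arr (fRight q))) =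
        G.tgt (G.mul (hfTgtMid q) (μ.arr (fLeft q))) := by
      rw [G.src_inv, G.tgt_mul _ _ e3, ← hf_tgt_tgtMid, ν.tgt_arr]
    have h3 := G.mul_assoc (G.inv (ν.arr (fRight q))) _ (G.inv (μ.arr (fLeft q))) e4
      (by rw [G.src_mul _ _ e3, G.tgt_inv])
    have h4 := G.mul_assoc _ _ (G.inv (μ.arr (fLeft q))) e3 (G.tgt_inv _).symm
    rw [G.mul_inv, ← e3, G.mul_one] at h4
    rw [← h2, h3, h4]

theorem hfTgtMid_mul {q r : hfArr μ ν ht} (h : hfSrc q = hfTgt r) :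
    hfTgtMid (hfMul q r) = hfTgtMid q := by
  obtain ⟨h1, h2, h3⟩ := hf_composable h
  have e3 : G.src (hfTgtMid q) = G.tgt (μ.arr (fLeft q)) := by
    rw [← hf_src_tgtMid, μ.tgt_arr]
  have e1 : G.src (μ.arr (fLeft q)) = G.tgt (μ.arr (fLeft r)) := by
    rw [μ.src_arr, μ.tgt_arr, h1]
  have e2 : G.src (ν.arr (fRight q)) = G.tgt (ν.arr (fRight r)) := by
    rw [ν.src_arr, ν.tgt_arr, h3]
  apply hf_unique
  · rw [hfMul_left h, μ.arr_mul _ _ h1, G.tgt_mul _ _ e1, e3]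
  · rw [hfMul_left h, hfMul_right h, hfMul_mid h, μ.arr_mul _ _ h1, ν.arr_mul _ _ h3,
      ← G.mul_assoc _ _ _ e3 e1, hf_square q,
      G.mul_assoc _ _ _ (hf_comp1 q) ((hf_comp0 q).trans e1), h2, hf_square r,
      ← G.mul_assoc _ _ _ e2 (hf_comp1 r)]

theorem smooth_hfTgtMid : ContMDiff (hfArr μ ν ht).I G.Arr.I ∞
    (fun q : hfArr μ ν ht => hfTgtMid q) := by
  have h1 : ContMDiff (hfArr μ ν ht).I (G.Arr.I.prod G.Arr.I) ∞
      (fun q : hfArr μ ν ht => (ν.arr (fRight q), fMid q)) :=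
    (ν.smooth_arr.comp smooth_right).prodMk smooth_mid
  have h2 : ContMDiff (hfArr μ ν ht).I G.Arr.I ∞
      (fun q : hfArr μ ν ht => G.mul (ν.arr (fRight q)) (fMid q)) := by
    rw [← contMDiffOn_univ] at h1 ⊢
    exact G.smooth_mul.comp h1 fun q _ => hf_comp1 q
  have h3 : ContMDiff (hfArr μ ν ht).I (G.Arr.I.prod G.Arr.I) ∞
      (fun q : hfArr μ ν ht => (G.mul (ν.arr (fRight q)) (fMid q), G.inv (μ.arr (fLeft q)))) :=
    h2.prodMk (G.smooth_inv.comp (μ.smooth_arr.comp smooth_left))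
  rw [← contMDiffOn_univ] at h3 ⊢
  exact G.smooth_mul.comp h3 fun q _ => hf_comp2 q

theorem smooth_hfSrc : Smooth (hfSrc (μ := μ) (ν := ν) (ht := ht)) := by
  rw [Smooth, ← contMDiffOn_univ]
  exact arrFibre_lift (L₁.smooth_src.comp smooth_left).contMDiffOn smooth_mid.contMDiffOn
    (L₂.smooth_src.comp smooth_right).contMDiffOn

theorem smooth_hfTgt : Smooth (hfTgt (μ := μ) (ν := ν) (ht := ht)) := by
  rw [Smooth, ← contMDiffOn_univ]
  exact arrFibre_lift (L₁.smooth_tgt.comp smooth_left).contMDiffOn smooth_hfTgtMid.contMDiffOn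
    (L₂.smooth_tgt.comp smooth_right).contMDiffOn

theorem smooth_hfOne : Smooth (hfOne (μ := μ) (ν := ν) (ht := ht)) := by
  rw [Smooth, ← contMDiffOn_univ]
  exact arrFibre_lift (L₁.smooth_one.comp smooth_left).contMDiffOn smooth_mid.contMDiffOn
    (L₂.smooth_one.comp smooth_right).contMDiffOn

theorem smooth_hfInv : Smooth (hfInv (μ := μ) (ν := ν) (ht := ht)) := by
  rw [Smooth, ← contMDiffOn_univ]
  exact arrFibre_lift (L₁.smooth_inv.comp smooth_left).contMDiffOn smooth_hfTgtMid.contMDiffOn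
    (L₂.smooth_inv.comp smooth_right).contMDiffOn

theorem smooth_hfMul : ContMDiffOn ((hfArr μ ν ht).I.prod (hfArr μ ν ht).I) (hfArr μ ν ht).I ∞
    (fun p : hfArr μ ν ht × hfArr μ ν ht => hfMul p.1 p.2) {p | hfSrc p.1 = hfTgt p.2} := by
  refine arrFibre_lift ?_ ?_ ?_
  · refine ContMDiffOn.congr (f := fun p : hfArr μ ν ht × hfArr μ ν ht =>
      L₁.mul (fLeft p.1) (fLeft p.2)) ?_ fun p hp => hfMul_left hp
    exact L₁.smooth_mul.comp ((smooth_left.comp contMDiff_fst).prodMk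
      (smooth_left.comp contMDiff_snd)).contMDiffOn fun p hp => (hf_composable hp).1
  · exact ContMDiffOn.congr (f := fun p : hfArr μ ν ht × hfArr μ ν ht => fMid p.2)
      (smooth_mid.comp contMDiff_snd).contMDiffOn fun p hp => hfMul_mid hp
  · refine ContMDiffOn.congr (f := fun p : hfArr μ ν ht × hfArr μ ν ht =>
      L₂.mul (fRight p.1) (fRight p.2)) ?_ fun p hp => hfMul_right hp
    exact L₂.smooth_mul.comp ((smooth_right.comp contMDiff_fst).prodMk
      (smooth_right.comp contMDiff_snd)).contMDiffOn fun p hp => (hf_composable hp).2.2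

theorem submersive_hfSrc : Submersive (hfSrc (μ := μ) (ν := ν) (ht := ht)) := by
  intro q k
  have eL : diff μ.obj (L₁.src (fLeft q)) (diff (fLeft (ht := ht)) (hfSrc q) k) =
      diff G.src (fMid q) (diff (fMid (ht := ht)) (hfSrc q) k) := by
    have h1 := diff_comp μ.smooth_obj (smooth_left (ht := ht)) (hfSrc q) k
    have h2 := diff_comp G.smooth_src (smooth_mid (ht := ht)) (hfSrc q) k
    have h3 : (fun y : hfObj μ ν ht => μ.obj (fLeft y)) = fun y => G.src (fMid y) :=
      funext fLeft_eq
    rw [h3] at h1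
    exact h1.symm.trans h2
  have eR : diff ν.obj (L₂.src (fRight q)) (diff (fRight (ht := ht)) (hfSrc q) k) =
      diff G.tgt (fMid q) (diff (fMid (ht := ht)) (hfSrc q) k) := by
    have h1 := diff_comp ν.smooth_obj (smooth_right (ht := ht)) (hfSrc q) k
    have h2 := diff_comp G.smooth_tgt (smooth_mid (ht := ht)) (hfSrc q) k
    have h3 : (fun y : hfObj μ ν ht => ν.obj (fRight y)) = fun y => G.tgt (fMid y) :=
      funext fRight_eq
    rw [h3] at h1
    exact h1.symm.trans h2
  obtain ⟨u, hu⟩ := L₁.submersive_src (fLeft q) (diff (fLeft (ht := ht)) (hfSrc q) k)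
  obtain ⟨v, hv⟩ := L₂.submersive_src (fRight q) (diff (fRight (ht := ht)) (hfSrc q) k)
  obtain ⟨c, c1, c2, c3⟩ := arrFibre_tangent_exists q u
    (diff (fMid (ht := ht)) (hfSrc q) k) v
    (by
      have := diff_comp μ.smooth_obj L₁.smooth_src (fLeft q) u
      rw [hu, eL] at this
      exact this)
    (by
      have := diff_comp ν.smooth_obj L₂.smooth_src (fRight q) v
      rw [hv, eR] at this
      exact this)
  refine ⟨c, arrFibre_tangent_ext (hfSrc q) ?_ ?_ ?_⟩
  · rw [← diff_comp smooth_left smooth_hfSrc, ← hu, ← c1]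
    exact diff_comp L₁.smooth_src smooth_left q c
  · rw [← diff_comp smooth_mid smooth_hfSrc, ← c2]
    rfl
  · rw [← diff_comp smooth_right smooth_hfSrc, ← hv, ← c3]
    exact diff_comp L₂.smooth_src smooth_right q c

/-- The homotopy fibre product `L₁ ×^h_G L₂` of two transverse morphisms to `G`. -/
noncomputable def hfGroupoid (μ : L₁.Hom G) (ν : L₂.Hom G) (ht : ArrTransverse G μ.obj ν.obj) :
    LieGroupoid.{u} 𝕜 where
  Obj := hfObj μ ν ht
  Arr := hfArr μ ν ht
  src := hfSrc
  tgt := hfTgt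
  one := hfOne
  inv := hfInv
  mul := hfMul
  smooth_src := smooth_hfSrc
  smooth_tgt := smooth_hfTgt
  smooth_one := smooth_hfOne
  smooth_inv := smooth_hfInv
  submersive_src := submersive_hfSrc
  smooth_mul := smooth_hfMul
  src_one q := arrFibre_ext (L₁.src_one _) rfl (L₂.src_one _)
  tgt_one q := arrFibre_ext (L₁.tgt_one _) (hfTgtMid_one q) (L₂.tgt_one _)
  src_inv q := arrFibre_ext (L₁.src_inv _) rfl (L₂.src_inv _)
  tgt_inv q := arrFibre_ext (L₁.tgt_inv _) (hfTgtMid_inv q) (L₂.tgt_inv _)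
  src_mul q r h := by
    obtain ⟨h1, h2, h3⟩ := hf_composable h
    refine arrFibre_ext ?_ (hfMul_mid h) ?_
    · exact (congrArg L₁.src (hfMul_left h)).trans (L₁.src_mul _ _ h1)
    · exact (congrArg L₂.src (hfMul_right h)).trans (L₂.src_mul _ _ h3)
  tgt_mul q r h := by
    obtain ⟨h1, h2, h3⟩ := hf_composable h
    refine arrFibre_ext ?_ (hfTgtMid_mul h) ?_
    · exact (congrArg L₁.tgt (hfMul_left h)).trans (L₁.tgt_mul _ _ h1)
    · exact (congrArg L₂.tgt (hfMul_right h)).trans (L₂.tgt_mul _ _ h3)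
  one_mul q := by
    have h : hfSrc (hfOne (hfTgt q)) = hfTgt q :=
      arrFibre_ext (L₁.src_one _) rfl (L₂.src_one _)
    exact arrFibre_ext ((hfMul_left h).trans (L₁.one_mul _)) (hfMul_mid h)
      ((hfMul_right h).trans (L₂.one_mul _))
  mul_one q := by
    have h : hfSrc q = hfTgt (hfOne (hfSrc q)) :=
      Eq.symm (b := hfSrc q) (a := hfTgt (hfOne (hfSrc q)))
        (arrFibre_ext (L₁.tgt_one _) (hfTgtMid_one (hfSrc q)) (L₂.tgt_one _))
    exact arrFibre_ext ((hfMul_left h).trans (L₁.mul_one _)) (hfMul_mid h)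
      ((hfMul_right h).trans (L₂.mul_one _))
  inv_mul q := by
    have h : hfSrc (hfInv q) = hfTgt q :=
      arrFibre_ext (L₁.src_inv _) rfl (L₂.src_inv _)
    exact arrFibre_ext ((hfMul_left h).trans (L₁.inv_mul _)) (hfMul_mid h)
      ((hfMul_right h).trans (L₂.inv_mul _))
  mul_inv q := by
    have h : hfSrc q = hfTgt (hfInv q) :=
      Eq.symm (b := hfSrc q) (a := hfTgt (hfInv q))
        (arrFibre_ext (L₁.tgt_inv _) (hfTgtMid_inv q) (L₂.tgt_inv _))
    exact arrFibre_ext ((hfMul_left h).trans (L₁.mul_inv _)) (hfMul_mid h)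
      ((hfMul_right h).trans (L₂.mul_inv _))
  mul_assoc q r s h k := by
    obtain ⟨h1, h2, h3⟩ := hf_composable h
    obtain ⟨k1, k2, k3⟩ := hf_composable k
    have hqr : hfSrc (hfMul q r) = hfTgt s := by
      rw [← k]
      exact arrFibre_ext ((congrArg L₁.src (hfMul_left h)).trans (L₁.src_mul _ _ h1))
        (hfMul_mid h) ((congrArg L₂.src (hfMul_right h)).trans (L₂.src_mul _ _ h3))
    have hrs : hfSrc q = hfTgt (hfMul r s) := by
      rw [h]
      symm
      exact arrFibre_ext ((congrArg L₁.tgt (hfMul_left k)).trans (L₁.tgt_mul _ _ k1))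
        (hfTgtMid_mul k) ((congrArg L₂.tgt (hfMul_right k)).trans (L₂.tgt_mul _ _ k3))
    refine arrFibre_ext ?_ ?_ ?_
    · rw [hfMul_left hqr, hfMul_left h, hfMul_left hrs, hfMul_left k,
        L₁.mul_assoc _ _ _ h1 k1]
    · rw [hfMul_mid hqr, hfMul_mid hrs, hfMul_mid k]
    · rw [hfMul_right hqr, hfMul_right h, hfMul_right hrs, hfMul_right k,
        L₂.mul_assoc _ _ _ h3 k3]

variable (μ ν ht) in
/-- The projection to `L₁`. -/
noncomputable def hfFst : (hfGroupoid μ ν ht).Hom L₁ where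
  obj := fun q : hfObj μ ν ht => fLeft q
  arr := fun q : hfArr μ ν ht => fLeft q
  smooth_obj := smooth_left
  smooth_arr := smooth_left
  src_arr _ := rfl
  tgt_arr _ := rfl
  arr_mul _ _ h := hfMul_left h

variable (μ ν ht) in
/-- The projection to `L₂`. -/
noncomputable def hfSnd : (hfGroupoid μ ν ht).Hom L₂ where
  obj := fun q : hfObj μ ν ht => fRight q
  arr := fun q : hfArr μ ν ht => fRight q
  smooth_obj := smooth_right
  smooth_arr := smooth_right
  src_arr _ := rfl
  tgt_arr _ := rfl
  arr_mul _ _ h := hfMul_right h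

variable (μ ν ht) in
/-- The projection `(x, g, y) ↦ g` on objects. -/
def hfMid : (hfGroupoid μ ν ht).Obj → G.Arr := fun q : hfObj μ ν ht => fMid q

end HFibre

/-! ### Quasi-symplectic groupoids and 1-shifted Lagrangian correspondences -/

namespace LieGroupoid

theorem comp_transverse (G : LieGroupoid.{u} 𝕜) :
    EqTransverse (G.Arr.I.prod G.Arr.I) G.Obj.I
      (fun p : G.Arr × G.Arr => G.src p.1) (fun p : G.Arr × G.Arr => G.tgt p.2) := by
  intro p _ w
  obtain ⟨v, hv⟩ := G.submersive_src p.1 w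
  have h1 : HasMFDerivAt (G.Arr.I.prod G.Arr.I) G.Obj.I
      (fun p : G.Arr × G.Arr => G.src p.1) p _ :=
    ((G.smooth_src p.1).mdifferentiableAt (by simp)).hasMFDerivAt.comp p (hasMFDerivAt_fst p)
  have h2 : HasMFDerivAt (G.Arr.I.prod G.Arr.I) G.Obj.I
      (fun p : G.Arr × G.Arr => G.tgt p.2) p _ :=
    ((G.smooth_tgt p.2).mdifferentiableAt (by simp)).hasMFDerivAt.comp p (hasMFDerivAt_snd p)
  refine ⟨(v, 0), ?_⟩
  have e1 : tangentMapAt (G.Arr.I.prod G.Arr.I) G.Obj.I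
      (fun p : G.Arr × G.Arr => G.src p.1) p (v, 0) = diff G.src p.1 v :=
    congrArg (fun L => L ((v, 0) : G.Arr.Model × G.Arr.Model)) h1.mfderiv
  have e2 : tangentMapAt (G.Arr.I.prod G.Arr.I) G.Obj.I
      (fun p : G.Arr × G.Arr => G.tgt p.2) p (v, 0) = diff G.tgt p.2 0 :=
    congrArg (fun L => L ((v, 0) : G.Arr.Model × G.Arr.Model)) h2.mfderiv
  rw [e1, e2, hv, map_zero, sub_zero]

/-- The manifold of composable pairs, `{(g, h) | src g = tgt h}`. -/
noncomputable def Comp (G : LieGroupoid.{u} 𝕜) : Mfd.{u} 𝕜 :=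
  eqMfd (G.smooth_src.comp contMDiff_fst) (G.smooth_tgt.comp contMDiff_snd) G.comp_transverse

def compFst (G : LieGroupoid.{u} 𝕜) (p : G.Comp) : G.Arr := p.1.1
def compSnd (G : LieGroupoid.{u} 𝕜) (p : G.Comp) : G.Arr := p.1.2
def compMul (G : LieGroupoid.{u} 𝕜) (p : G.Comp) : G.Arr := G.mul p.1.1 p.1.2

/-- The fibre at `x` of the Lie algebroid `ker src_*`; it consists of tangent vectors at `1_x`. -/
noncomputable def algebroid (G : LieGroupoid.{u} 𝕜) (x : G.Obj) : Submodule 𝕜 G.Arr.Model :=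
  LinearMap.ker (diff G.src (G.one x) : G.Arr.Model →ₗ[𝕜] G.Obj.Model)

/-- The anchor map `tgt_*` of the Lie algebroid at `x`. -/
noncomputable def anchor (G : LieGroupoid.{u} 𝕜) (x : G.Obj) : G.Arr.Model →L[𝕜] G.Obj.Model :=
  diff G.tgt (G.one x)

end LieGroupoid

/-- Quasi-symplectic groupoids: a multiplicative 2-form `Ω` and a closed 3-form `Φ` such that
`dΩ = src^* Φ - tgt^* Φ`, `dim Arr = 2 dim Obj`, and `ker Ω ∩ ker src_* ∩ ker tgt_* = 0` along the
identities. -/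
structure QuasiSymplecticGroupoid (𝕜 : Type v) [RCLike 𝕜] : Type (max (u + 1) v)
    extends LieGroupoid.{u} 𝕜 where
  Ω : Form Arr 2
  Φ : Form Obj 3
  smooth_Ω : SmoothForm Ω
  smooth_Φ : SmoothForm Φ
  multiplicative : pullback toLieGroupoid.compMul Ω =
    pullback toLieGroupoid.compFst Ω + pullback toLieGroupoid.compSnd Ω
  closed : extD Φ = 0
  extD_Ω : extD Ω = pullback src Φ - pullback tgt Φ
  dim_eq : Arr.dim = 2 * Obj.dim
  nondegenerate : ∀ (x : Obj) (v : Arr.Model), (∀ w, Ω (one x) ![v, w] = 0) →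
    diff src (one x) v = 0 → diff tgt (one x) v = 0 → v = 0

/-- The IM-form `σ(a) = one^* (i_a Ω)`, for `a` in the Lie algebroid at `x`, evaluated at
`w ∈ T_x Obj`. -/
noncomputable def QuasiSymplecticGroupoid.imForm (G : QuasiSymplecticGroupoid.{u} 𝕜) (x : G.Obj)
    (a : G.Arr.Model) (w : G.Obj.Model) : 𝕜 :=
  G.Ω (G.one x) ![a, diff G.one x w]

/-- A span `G₁ ← L → G₂` of Lie groupoids with a (not necessarily smooth) 2-form on the objects of
`L`. -/
structure FormSpan (G₁ G₂ : QuasiSymplecticGroupoid.{u} 𝕜) where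
  L : LieGroupoid.{u} 𝕜
  fst : L.Hom G₁.toLieGroupoid
  snd : L.Hom G₂.toLieGroupoid
  γ : Form L.Obj 2

/-- The span is a 1-shifted Lagrangian correspondence from `G₁` to `G₂`, i.e. `L → G₁ × G₂⁻` is a
1-shifted Lagrangian. Here `G₁ × G₂⁻` carries the forms `Ω₁ - Ω₂` and `Φ₁ - Φ₂`, its algebroid is
`A_{G₁} × A_{G₂}`, and its IM-form is `(a₁, a₂) ↦ (σ₁ a₁, - σ₂ a₂)`. -/
structure FormSpan.IsLagrangian {G₁ G₂ : QuasiSymplecticGroupoid.{u} 𝕜} (S : FormSpan G₁ G₂) :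
    Prop where
  smooth_γ : SmoothForm S.γ
  pullback_Ω : pullback S.fst.arr G₁.Ω - pullback S.snd.arr G₂.Ω =
    pullback S.L.tgt S.γ - pullback S.L.src S.γ
  pullback_Φ : pullback S.fst.obj G₁.Φ - pullback S.snd.obj G₂.Φ = -extD S.γ
  nondegenerate : ∀ x : S.L.Obj, Set.BijOn
    (fun b : S.L.Arr.Model => (S.L.anchor x b, diff S.fst.arr (S.L.one x) b,
      diff S.snd.arr (S.L.one x) b))
    {b | b ∈ S.L.algebroid x}
    {p : S.L.Obj.Model × G₁.Arr.Model × G₂.Arr.Model |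
      p.2.1 ∈ G₁.algebroid (S.fst.obj x) ∧ p.2.2 ∈ G₂.algebroid (S.snd.obj x) ∧
      diff S.fst.obj x p.1 = G₁.anchor (S.fst.obj x) p.2.1 ∧
      diff S.snd.obj x p.1 = G₂.anchor (S.snd.obj x) p.2.2 ∧
      ∀ w, S.γ x ![p.1, w] = G₁.imForm (S.fst.obj x) p.2.1 (diff S.fst.obj x w) -
        G₂.imForm (S.snd.obj x) p.2.2 (diff S.snd.obj x w)}

/-- Transversality of `G₁ ← L₁ → G₂` and `G₂ ← L₂ → G₃`. -/
def FormSpan.Transverse {G₁ G₂ G₃ : QuasiSymplecticGroupoid.{u} 𝕜} (S₁ : FormSpan G₁ G₂)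
    (S₂ : FormSpan G₂ G₃) : Prop :=
  ArrTransverse G₂.toLieGroupoid S₁.snd.obj S₂.fst.obj

/-- The composition of transverse spans: the homotopy fibre product `L₁ ×^h_{G₂} L₂` with the
2-form `pr₁^* γ₁ + pr₂^* γ₂ - pr^* Ω₂`. -/
noncomputable def FormSpan.comp {G₁ G₂ G₃ : QuasiSymplecticGroupoid.{u} 𝕜} (S₁ : FormSpan G₁ G₂)
    (S₂ : FormSpan G₂ G₃) (h : S₁.Transverse S₂) : FormSpan G₁ G₃ where
  L := hfGroupoid S₁.snd S₂.fst h
  fst := S₁.fst.comp (hfFst S₁.snd S₂.fst h)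
  snd := S₂.snd.comp (hfSnd S₁.snd S₂.fst h)
  γ := pullback (hfFst S₁.snd S₂.fst h).obj S₁.γ + pullback (hfSnd S₁.snd S₂.fst h).obj S₂.γ -
    pullback (hfMid S₁.snd S₂.fst h) G₂.Ω

/-! ### Morita equivalence -/

/-- Symplectic Morita equivalences `G ← H → G'`: Morita equivalences that are also 1-shifted
Lagrangian correspondences. -/
structure SymplecticMoritaEquiv (G G' : QuasiSymplecticGroupoid.{u} 𝕜) extends FormSpan G G' where
  isLagrangian : toFormSpan.IsLagrangian
  isMorita_fst : fst.IsMorita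
  isMorita_snd : snd.IsMorita

/-- Lagrangian Morita equivalences between `G₁ ← L → G₂` and `G₁' ← L' → G₂'` over symplectic
Morita equivalences `G₁ ← H₁ → G₁'` and `G₂ ← H₂ → G₂'`: a 2-commutative diagram
```
  G₁  ←  L  →  G₂
  ↑      ↑      ↑
  H₁  ←  M  →  H₂
  ↓      ↓      ↓
  G₁' ←  L' →  G₂'
```
whose vertical arrows are Morita morphisms, with compatible 2-forms. This is a Lagrangian Morita
equivalence between the Lagrangians `L → G₁ × G₂⁻` and `L' → G₁' × G₂'⁻` over `H₁ × H₂`. -/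
structure LagrangianMoritaEquiv {G₁ G₂ G₁' G₂' : QuasiSymplecticGroupoid.{u} 𝕜}
    (E₁ : SymplecticMoritaEquiv G₁ G₁') (E₂ : SymplecticMoritaEquiv G₂ G₂')
    (S : FormSpan G₁ G₂) (S' : FormSpan G₁' G₂') where
  M : LieGroupoid.{u} 𝕜
  ψ : M.Hom S.L
  ψ' : M.Hom S'.L
  isMorita_ψ : ψ.IsMorita
  isMorita_ψ' : ψ'.IsMorita
  ν₁ : M.Hom E₁.L
  ν₂ : M.Hom E₂.L
  θ₁ : NatTransf (S.fst.comp ψ) (E₁.fst.comp ν₁)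
  θ₂ : NatTransf (S.snd.comp ψ) (E₂.fst.comp ν₂)
  θ₁' : NatTransf (S'.fst.comp ψ') (E₁.snd.comp ν₁)
  θ₂' : NatTransf (S'.snd.comp ψ') (E₂.snd.comp ν₂)
  form_eq : pullback ψ.obj S.γ - pullback ψ'.obj S'.γ =
    (pullback ν₁.obj E₁.γ - pullback ν₂.obj E₂.γ)
      - (pullback θ₁.app G₁.Ω - pullback θ₂.app G₂.Ω)
      + (pullback θ₁'.app G₁'.Ω - pullback θ₂'.app G₂'.Ω)

/-- Weak equivalences of 1-shifted Lagrangian correspondences from `G₁` to `G₂`: a Morita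
equivalence `L ← M → L'` with a natural transformation between the two morphisms
`M → G₁ × G₂⁻`, and compatible 2-forms. -/
structure WeakEquiv {G₁ G₂ : QuasiSymplecticGroupoid.{u} 𝕜} (S S' : FormSpan G₁ G₂) where
  M : LieGroupoid.{u} 𝕜
  ψ : M.Hom S.L
  ψ' : M.Hom S'.L
  isMorita_ψ : ψ.IsMorita
  isMorita_ψ' : ψ'.IsMorita
  θ₁ : NatTransf (S.fst.comp ψ) (S'.fst.comp ψ')
  θ₂ : NatTransf (S.snd.comp ψ) (S'.snd.comp ψ')
  form_eq : pullback ψ'.obj S'.γ - pullback ψ.obj S.γ =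
    pullback θ₁.app G₁.Ω - pullback θ₂.app G₂.Ω

end

end ShiftedSymplectic

open ShiftedSymplectic

/-! Everything is compared through the homotopy fibre product over the middle Morita equivalence.
Let `A` and `B` be the two given Lagrangian Morita equivalences, with apices `M₁` and `M₂` mapping
to `H₂` by `ν₁` and `ν₂`. Both `H₂ → G₂` and `H₂ → G₂'` are Morita morphisms, so an arrow or a
tangent vector of `G₂` with lifted endpoints lifts to `H₂`. Conjugating by the natural
transformations, one finds that transversality of the legs over `G₂`, and likewise over `G₂'`, is
equivalent to transversality of `ν₁, ν₂` over `H₂` (`ArrTransverse.lift`, `ArrTransverse.descend`).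
This proves the equivalence of the two transversality conditions.

For the same reason `(x, h, y) ↦ (ψ₁ x, θ₂⁻¹ φ(h) θ₁, ψ₂ y)` is a Morita morphism from `M₁ ×^h_{H₂}
M₂` to each of the two compositions (`hfMap_isMorita`). A multiplicative form is additive on
products and odd under inversion, so the pullback of `Ω₂` along `θ₂⁻¹ φ(h) θ₁` is a sum of three
terms. Those in `θ₁, θ₂` cancel against the compatibility conditions of `A` and `B`. The difference
of the terms in `φ(h)` for `G₂` and `G₂'` is `tgt^* δ₂ - src^* δ₂`, which cancels the contributions
of `δ₂` (`pullback_mid`).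

That a composition is Lagrangian is formal for the two equations on forms. Nondegeneracy is linear
algebra. In a quasi-symplectic groupoid the image of `(ρ, σ)` in `T ⊕ T*` is its own orthogonal, by
isotropy and a dimension count. It follows that a tangent vector at `g` whose contraction with `Ω`
is a difference of covectors pulled back along `tgt` and `src` has the form `b · 0_g · a⁻¹`
(`QuasiSymplecticGroupoid.exists_conj`). The Lagrangian condition on the composition constrains only
vectors tangent to the fibre product. Transversality makes the fibre product the kernel of a
surjective map, so the missing covectors appear as Lagrange multipliers
(`IsLagrangian.exists_conj`). Transversality gives injectivity as well
(`IsLagrangian.eq_zero_of_conj`).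

The statement on weak equivalences is the case where the symplectic Morita equivalences are the
identities `G ← G → G` with zero form. -/

namespace ShiftedSymplectic

/-! ### Pullback and exterior derivative of forms on manifolds -/

section FormCalculus

variable {𝕜 : Type v} [RCLike 𝕜] {M N P : Mfd.{u} 𝕜} {k : ℕ}

theorem pullback_apply (f : M → N) (α : Form N k) (x : M) (v : Fin k → M.Model) :
    pullback f α x v = α (f x) (fun i => diff f x (v i)) := rfl

theorem pullback_pullback {f : M → N} {g : N → P} (hg : Smooth g) (hf : Smooth f) (α : Form P k) :
    pullback f (pullback g α) = pullback (fun x => g (f x)) α := by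
  funext x
  ext v
  rw [pullback_apply, pullback_apply, pullback_apply]
  simp only [diff_comp hg hf]

theorem pullback_add (f : M → N) (α β : Form N k) :
    pullback f (α + β) = pullback f α + pullback f β := rfl

theorem pullback_sub (f : M → N) (α β : Form N k) :
    pullback f (α - β) = pullback f α - pullback f β := rfl

theorem pullback_neg (f : M → N) (α : Form N k) :
    pullback f (-α) = -pullback f α := rfl

theorem pullback_zero (f : M → N) : pullback f (0 : Form N k) = 0 := rfl

theorem SmoothForm.add {α β : Form M k} (hα : SmoothForm α) (hβ : SmoothForm β) :
    SmoothForm (α + β) := fun x => (hα x).add (hβ x)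

theorem SmoothForm.sub {α β : Form M k} (hα : SmoothForm α) (hβ : SmoothForm β) :
    SmoothForm (α - β) := fun x => (hα x).sub (hβ x)

theorem SmoothForm.zero : SmoothForm (0 : Form M k) := fun _ =>
  contDiffOn_const (c := (0 : M.Model [⋀^Fin k]→L[𝕜] 𝕜))

theorem SmoothForm.contDiffAt {α : Form M k} (hα : SmoothForm α) (x : M) {e : M.Model}
    (he : e ∈ (extChartAt M.I x).target) : ContDiffAt 𝕜 ∞ (formInChart α x) e :=
  (hα x).contDiffAt ((isOpen_extChartAt_target x).mem_nhds he)

theorem SmoothForm.differentiableAt {α : Form M k} (hα : SmoothForm α) (x : M) :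
    DifferentiableAt 𝕜 (formInChart α x) (extChartAt M.I x x) :=
  (hα.contDiffAt x (mem_extChartAt_target x)).differentiableAt (by simp)

theorem extD_add {α β : Form M k} (hα : SmoothForm α) (hβ : SmoothForm β) :
    extD (α + β) = extD α + extD β := by
  funext x
  exact extDeriv_add (hα.differentiableAt x) (hβ.differentiableAt x)

theorem extD_sub {α β : Form M k} (hα : SmoothForm α) (hβ : SmoothForm β) :
    extD (α - β) = extD α - extD β := by
  have h := extD_add (hα.sub hβ) hβ
  rw [sub_add_cancel] at h
  rw [h, add_sub_cancel_right]

theorem extD_zero : extD (0 : Form M k) = 0 := by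
  simpa using extD_sub (SmoothForm.zero (M := M) (k := k)) SmoothForm.zero

/-- The expression of a map in the preferred charts at `x` and `y`. -/
noncomputable def inCharts (f : M → N) (x : M) (y : N) : M.Model → N.Model :=
  fun e => extChartAt N.I y (f ((extChartAt M.I x).symm e))

theorem contDiffAt_inCharts {f : M → N} (hf : Smooth f) {x : M} {y : N} {e : M.Model}
    (he : e ∈ (extChartAt M.I x).target)
    (hy : f ((extChartAt M.I x).symm e) ∈ (extChartAt N.I y).source) :
    ContDiffAt 𝕜 ∞ (inCharts f x y) e := by
  rw [← contMDiffAt_iff_contDiffAt]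
  have h1 : ContMDiffAt 𝓘(𝕜, M.Model) M.I ∞ (extChartAt M.I x).symm e :=
    (contMDiffOn_extChartAt_symm x).contMDiffAt ((isOpen_extChartAt_target x).mem_nhds he)
  have h2 : ContMDiffAt N.I 𝓘(𝕜, N.Model) ∞ (extChartAt N.I y)
      (f ((extChartAt M.I x).symm e)) :=
    contMDiffAt_extChartAt' (by rwa [extChartAt_source] at hy)
  exact h2.comp e ((hf _).comp e h1)

theorem eventually_mem_chart {f : M → N} (hf : Smooth f) {x : M} {y : N} {e : M.Model}
    (he : e ∈ (extChartAt M.I x).target)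
    (hy : f ((extChartAt M.I x).symm e) ∈ (extChartAt N.I y).source) :
    ∀ᶠ e' in 𝓝 e, e' ∈ (extChartAt M.I x).target ∧
      f ((extChartAt M.I x).symm e') ∈ (extChartAt N.I y).source := by
  have h0 := (isOpen_extChartAt_target (I := M.I) x).mem_nhds he
  refine Filter.Eventually.and h0 ?_
  have h1 : ContinuousAt (extChartAt M.I x).symm e :=
    (continuousOn_extChartAt_symm x).continuousAt h0
  exact (hf.continuous.continuousAt.comp h1).eventually
    ((isOpen_extChartAt_source y).mem_nhds hy)

/-- Near `e`, the map `f ∘ (chart at x)⁻¹` equals `(chart at y)⁻¹ ∘ inCharts f x y`, and the chain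
rule for the two factorizations identifies both sides. The chart at `y` is arbitrary: the exterior
derivative needs only `y = f x`, but smoothness of a pullback needs a chart around the image of
every point of the chart domain at `x`. -/
theorem formInChart_pullback {f : M → N} (hf : Smooth f) (α : Form N k) {x : M} {y : N}
    {e : M.Model} (he : e ∈ (extChartAt M.I x).target)
    (hy : f ((extChartAt M.I x).symm e) ∈ (extChartAt N.I y).source) :
    formInChart (pullback f α) x e =
      (formInChart α y (inCharts f x y e)).compContinuousLinearMap
        (fderiv 𝕜 (inCharts f x y) e) := by
  have h1 : ContMDiffAt 𝓘(𝕜, M.Model) M.I ∞ (extChartAt M.I x).symm e :=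
    (contMDiffOn_extChartAt_symm x).contMDiffAt ((isOpen_extChartAt_target x).mem_nhds he)
  have hm := (extChartAt N.I y).map_source hy
  have h2 : ContMDiffAt 𝓘(𝕜, N.Model) N.I ∞ (extChartAt N.I y).symm (inCharts f x y e) :=
    (contMDiffOn_extChartAt_symm y).contMDiffAt ((isOpen_extChartAt_target y).mem_nhds hm)
  have h3 := mfderiv_comp e ((hf _).mdifferentiableAt (by simp)) (h1.mdifferentiableAt (by simp))
  have h4 := mfderiv_comp e (h2.mdifferentiableAt (by simp))
    ((contDiffAt_inCharts hf he hy).contMDiffAt.mdifferentiableAt (by simp))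
  have h5 : (f ∘ (extChartAt M.I x).symm) =ᶠ[𝓝 e]
      ((extChartAt N.I y).symm ∘ inCharts f x y) := by
    filter_upwards [eventually_mem_chart hf he hy] with e' he'
    exact ((extChartAt N.I y).left_inv he'.2).symm
  have h6 := h5.mfderiv_eq (I := 𝓘(𝕜, M.Model)) (I' := N.I)
  have h7 : (extChartAt N.I y).symm (inCharts f x y e) = f ((extChartAt M.I x).symm e) :=
    (extChartAt N.I y).left_inv hy
  ext v
  change α (f ((extChartAt M.I x).symm e)) _ = α ((extChartAt N.I y).symm (inCharts f x y e)) _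
  rw [h7]
  congr 1
  funext i
  have e1 := congrArg (fun L => L (v i)) (h3.symm.trans (h6.trans h4))
  rw [mfderiv_eq_fderiv] at e1
  exact e1

theorem diff_eq_fderiv {f : M → N} (hf : Smooth f) (x : M) :
    fderiv 𝕜 (inCharts f x (f x)) (extChartAt M.I x x) = diff f x := by
  have h2 : diff f x = fderivWithin 𝕜 (writtenInExtChartAt M.I N.I x f) (Set.range M.I)
      (extChartAt M.I x x) := if_pos ((hf.mdifferentiable (by simp)) x)
  rw [h2, M.I.range_eq_univ, fderivWithin_univ]
  rfl

/-- In the preferred charts at `x` and `f x` this is naturality of the exterior derivative on normed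
spaces. These are the charts in which `extD` and `diff` are computed, so no further change of
coordinates occurs. -/
theorem extD_pullback {f : M → N} (hf : Smooth f) {α : Form N k} (hα : SmoothForm α) :
    extD (pullback f α) = pullback f (extD α) := by
  funext x
  have he := mem_extChartAt_target (I := M.I) x
  have hx : (extChartAt M.I x).symm (extChartAt M.I x x) = x := extChartAt_to_inv x
  have hy : f ((extChartAt M.I x).symm (extChartAt M.I x x)) ∈ (extChartAt N.I (f x)).source := by
    rw [hx]; exact mem_extChartAt_source _
  have h1 : formInChart (pullback f α) x =ᶠ[𝓝 (extChartAt M.I x x)] fun e =>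
      (formInChart α (f x) (inCharts f x (f x) e)).compContinuousLinearMap
        (fderiv 𝕜 (inCharts f x (f x)) e) := by
    filter_upwards [eventually_mem_chart hf he hy] with e' he'
    exact formInChart_pullback hf α he'.1 he'.2
  have h3 : inCharts f x (f x) (extChartAt M.I x x) = extChartAt N.I (f x) (f x) := by
    rw [inCharts, hx]
  have h4 : DifferentiableAt 𝕜 (formInChart α (f x))
      (inCharts f x (f x) (extChartAt M.I x x)) := by
    rw [h3]; exact hα.differentiableAt (f x)
  have h2 := extDeriv_pullback h4 (contDiffAt_inCharts hf he hy)
    -- Symmetry of the second derivative is what is needed here; over `ℝ` or `ℂ` class `C²`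
    -- suffices.
    (by rw [minSmoothness_of_isRCLikeNormedField]; exact WithTop.coe_le_coe.2 (le_top : (2 : ℕ∞) ≤ ⊤))
  rw [diff_eq_fderiv hf, h3] at h2
  exact h1.extDeriv_eq.trans h2

end FormCalculus

/-! ### Smoothness of pullbacks -/

section AlternatingSmooth

variable {𝕜 : Type*} [RCLike 𝕜] {E F G : Type*} [NormedAddCommGroup E] [NormedSpace 𝕜 E]
  [NormedAddCommGroup F] [NormedSpace 𝕜 F] [NormedAddCommGroup G] [NormedSpace 𝕜 G] {k : ℕ}

/-- Antisymmetrization, as a left inverse of the inclusion of alternating maps. -/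
theorem exists_leftInverse_toContinuousMultilinearMap :
    ∃ P : (ContinuousMultilinearMap 𝕜 (fun _ : Fin k => E) 𝕜) →L[𝕜] (E [⋀^Fin k]→L[𝕜] 𝕜),
      ∀ α : E [⋀^Fin k]→L[𝕜] 𝕜, P α.toContinuousMultilinearMap = α := by
  let A : (ContinuousMultilinearMap 𝕜 (fun _ : Fin k => E) 𝕜) →ₗ[𝕜] (E [⋀^Fin k]→L[𝕜] 𝕜) :=
    { toFun := fun f => f.alternatization
      map_add' := fun f g => map_add _ f g
      map_smul' := fun c f => by
        ext v
        simp [ContinuousMultilinearMap.alternatization_apply_apply, Finset.mul_sum,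
          mul_smul_comm] }
  have hb : ∀ f, ‖A f‖ ≤ (k.factorial : ℝ) * ‖f‖ := by
    intro f
    refine ContinuousAlternatingMap.opNorm_le_bound _ (by positivity) fun v => ?_
    change ‖f.alternatization v‖ ≤ _
    rw [ContinuousMultilinearMap.alternatization_apply_apply]
    refine (norm_sum_le _ _).trans ?_
    have : ∀ σ ∈ (Finset.univ : Finset (Equiv.Perm (Fin k))),
        ‖Equiv.Perm.sign σ • f (v ∘ σ)‖ ≤ ‖f‖ * ∏ i, ‖v i‖ := by
      intro σ _
      have h1 : ‖Equiv.Perm.sign σ • f (v ∘ σ)‖ = ‖f (v ∘ σ)‖ := by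
        rcases Int.units_eq_one_or (Equiv.Perm.sign σ) with h | h <;> simp [h]
      rw [h1]
      refine (f.le_opNorm _).trans_eq ?_
      congr 1
      exact Equiv.prod_comp σ (fun i => ‖v i‖)
    refine (Finset.sum_le_sum this).trans_eq ?_
    rw [Finset.sum_const, Finset.card_univ, Fintype.card_perm, Fintype.card_fin, nsmul_eq_mul,
      mul_assoc]
  -- On an alternating map the `k!` summands of the alternatization coincide, whence the
  -- normalization.
  refine ⟨((k.factorial : 𝕜)⁻¹) • A.mkContinuous _ hb, fun α => ?_⟩
  ext v
  have h0 : (k.factorial : 𝕜) ≠ 0 := by exact_mod_cast k.factorial_ne_zero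
  change ((k.factorial : 𝕜)⁻¹) * (α.toContinuousMultilinearMap.alternatization v) = α v
  rw [ContinuousMultilinearMap.alternatization_apply_apply]
  have : ∀ σ ∈ (Finset.univ : Finset (Equiv.Perm (Fin k))),
      Equiv.Perm.sign σ • α.toContinuousMultilinearMap (v ∘ σ) = α v := by
    intro σ _
    have := α.toAlternatingMap.map_perm v σ
    change Equiv.Perm.sign σ • α.toAlternatingMap (v ∘ σ) = α v
    rw [this, smul_smul, Int.units_mul_self, one_smul]
    rfl
  rw [Finset.sum_congr rfl this, Finset.sum_const, Finset.card_univ, Fintype.card_perm,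
    Fintype.card_fin, nsmul_eq_mul, inv_mul_cancel_left₀ h0]

/-- For multilinear maps, composition with `L` in every slot is continuous multilinear in the slots
and linear in the map, hence smooth. The antisymmetrization `P` carries this smoothness back to
alternating maps. -/
theorem ContDiffAt.compContinuousLinearMap {α : G → E [⋀^Fin k]→L[𝕜] 𝕜} {L : G → F →L[𝕜] E}
    {x : G} (hα : ContDiffAt 𝕜 ∞ α x) (hL : ContDiffAt 𝕜 ∞ L x) :
    ContDiffAt 𝕜 ∞ (fun e => (α e).compContinuousLinearMap (L e)) x := by
  obtain ⟨P, hP⟩ := exists_leftInverse_toContinuousMultilinearMap (𝕜 := 𝕜) (E := F) (k := k)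
  have h1 : ContDiffAt 𝕜 ∞ (fun e =>
      ContinuousMultilinearMap.compContinuousLinearMapContinuousMultilinear 𝕜
        (fun _ : Fin k => F) (fun _ : Fin k => E) 𝕜 (fun _ => L e)
        (ContinuousAlternatingMap.toContinuousMultilinearMapCLM 𝕜 (α e))) x := by
    refine ContDiffAt.clm_apply ?_ ?_
    · exact (ContinuousMultilinearMap.contDiff _).contDiffAt.comp x (contDiffAt_pi.2 fun _ => hL)
    · exact (ContinuousLinearMap.contDiff _).contDiffAt.comp x hα
  refine (P.contDiff.contDiffAt.comp x h1).congr_of_eventuallyEq (Filter.Eventually.of_forall ?_)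
  intro e
  exact (hP _).symm

end AlternatingSmooth

section SmoothPullback

variable {𝕜 : Type v} [RCLike 𝕜] {M N : Mfd.{u} 𝕜} {k : ℕ}

theorem SmoothForm.pullback {f : M → N} (hf : Smooth f) {α : Form N k} (hα : SmoothForm α) :
    SmoothForm (pullback f α) := by
  intro x e he
  -- The chart of `N` is centred at the image of the point under consideration, since one chart of
  -- `N` need not contain the image of the whole chart domain at `x`.
  have hy := mem_extChartAt_source (I := N.I) (f ((extChartAt M.I x).symm e))
  have h1 := contDiffAt_inCharts hf he hy
  have h2 := (hα.contDiffAt _ ((extChartAt N.I _).map_source hy)).comp e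
    (g := formInChart α (f ((extChartAt M.I x).symm e)))
    (f := inCharts f x (f ((extChartAt M.I x).symm e))) h1
  have h3 := h2.compContinuousLinearMap (h1.fderiv_right (m := ∞) (by simp))
  refine (h3.congr_of_eventuallyEq ?_).contDiffWithinAt
  filter_upwards [eventually_mem_chart hf he hy] with e' he'
  exact formInChart_pullback hf α he'.1 he'.2

end SmoothPullback

end ShiftedSymplectic

namespace ShiftedSymplectic

variable {𝕜 : Type v} [RCLike 𝕜]

theorem diff_id {M : Mfd.{u} 𝕜} (x : M) (v : M.Model) : diff (fun y : M => y) x v = v :=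
  congrArg (fun L => L v) (mfderiv_id (I := M.I) (x := x))

namespace LieGroupoid

variable (G : LieGroupoid.{u} 𝕜) {N : Mfd.{u} 𝕜}

/-! ### The tangent groupoid -/

theorem smooth_compVal : ContMDiff G.Comp.I (G.Arr.I.prod G.Arr.I) ∞ (fun p : G.Comp => p.1) :=
  contMDiff_eq_val (G.smooth_src.comp contMDiff_fst) (G.smooth_tgt.comp contMDiff_snd)
    G.comp_transverse

theorem smooth_compFst : Smooth G.compFst := contMDiff_fst.comp G.smooth_compVal

theorem smooth_compSnd : Smooth G.compSnd := contMDiff_snd.comp G.smooth_compVal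

theorem smooth_compMul : Smooth G.compMul := by
  have h := G.smooth_compVal
  rw [Smooth, ← contMDiffOn_univ]
  rw [← contMDiffOn_univ] at h
  exact G.smooth_mul.comp h fun q _ => q.2

def compMk (g h : G.Arr) (e : G.src g = G.tgt h) : G.Comp := ⟨(g, h), e⟩

variable {G}

theorem smooth_compMk {a b : N → G.Arr} (ha : Smooth a) (hb : Smooth b)
    (e : ∀ z, G.src (a z) = G.tgt (b z)) : Smooth (fun z => G.compMk (a z) (b z) (e z)) := by
  rw [Smooth, ← contMDiffOn_univ]
  exact fun z _ => contMDiffWithinAt_eq_lift (G.smooth_src.comp contMDiff_fst)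
    (G.smooth_tgt.comp contMDiff_snd) G.comp_transverse
    ((ha z).contMDiffWithinAt.prodMk (hb z).contMDiffWithinAt)

theorem smooth_mul_of {a b : N → G.Arr} (ha : Smooth a) (hb : Smooth b)
    (e : ∀ z, G.src (a z) = G.tgt (b z)) : Smooth (fun z => G.mul (a z) (b z)) :=
  G.smooth_compMul.comp (smooth_compMk ha hb e)

variable (G)

theorem diff_compVal (p : G.Comp) (k : G.Comp.Model) :
    tangentMapAt G.Comp.I (G.Arr.I.prod G.Arr.I) (fun p : G.Comp => p.1) p k =
      (diff G.compFst p k, diff G.compSnd p k) := by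
  have h1 := ((G.smooth_compFst p).mdifferentiableAt (by simp)).hasMFDerivAt
  have h2 := ((G.smooth_compSnd p).mdifferentiableAt (by simp)).hasMFDerivAt
  exact congrArg (fun L => L k) (h1.prodMk h2).mfderiv

theorem diff_comp_legs (p : G.Arr × G.Arr) (v : G.Arr.Model × G.Arr.Model) :
    tangentMapAt (G.Arr.I.prod G.Arr.I) G.Obj.I (fun p : G.Arr × G.Arr => G.src p.1) p v =
      diff G.src p.1 v.1 ∧
    tangentMapAt (G.Arr.I.prod G.Arr.I) G.Obj.I (fun p : G.Arr × G.Arr => G.tgt p.2) p v =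
      diff G.tgt p.2 v.2 := by
  have h1 : HasMFDerivAt (G.Arr.I.prod G.Arr.I) G.Obj.I
      (fun p : G.Arr × G.Arr => G.src p.1) p _ :=
    ((G.smooth_src p.1).mdifferentiableAt (by simp)).hasMFDerivAt.comp p (hasMFDerivAt_fst p)
  have h2 : HasMFDerivAt (G.Arr.I.prod G.Arr.I) G.Obj.I
      (fun p : G.Arr × G.Arr => G.tgt p.2) p _ :=
    ((G.smooth_tgt p.2).mdifferentiableAt (by simp)).hasMFDerivAt.comp p (hasMFDerivAt_snd p)
  exact ⟨congrArg (fun L => L v) h1.mfderiv, congrArg (fun L => L v) h2.mfderiv⟩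

theorem comp_tangent_ext (p : G.Comp) {k k' : G.Comp.Model}
    (h : (diff G.compFst p k, diff G.compSnd p k) = (diff G.compFst p k', diff G.compSnd p k')) :
    k = k' := by
  refine (eq_tangent (G.smooth_src.comp contMDiff_fst) (G.smooth_tgt.comp contMDiff_snd)
    G.comp_transverse p).1 ?_
  exact (G.diff_compVal p k).trans (h.trans (G.diff_compVal p k').symm)

theorem comp_tangent_exists (p : G.Comp) {v w : G.Arr.Model}
    (h : diff G.src (G.compFst p) v = diff G.tgt (G.compSnd p) w) :
    ∃ k, diff G.compFst p k = v ∧ diff G.compSnd p k = w := by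
  obtain ⟨k, hk⟩ := (eq_tangent (G.smooth_src.comp contMDiff_fst)
    (G.smooth_tgt.comp contMDiff_snd) G.comp_transverse p).2 (v, w)
    ((G.diff_comp_legs p.1 (v, w)).1.trans (h.trans (G.diff_comp_legs p.1 (v, w)).2.symm))
  have h' := (G.diff_compVal p k).symm.trans hk
  exact ⟨k, congrArg Prod.fst h', congrArg Prod.snd h'⟩

/-- A tangent vector of the manifold of composable pairs is determined by its two projections, so
the differential of the multiplication factors through them. The proof of composability is
quantified after `T`, so that `T` depends on the arrows alone and can be rewritten along equalities
of arrows. -/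
theorem exists_tmul (g h : G.Arr) : ∃ T : (G.Arr.Model × G.Arr.Model) →ₗ[𝕜] G.Arr.Model,
    ∀ e : G.src g = G.tgt h, ∀ k, T (diff G.compFst (G.compMk g h e) k,
      diff G.compSnd (G.compMk g h e) k) = diff G.compMul (G.compMk g h e) k := by
  by_cases e : G.src g = G.tgt h
  · let D : G.Comp.Model →ₗ[𝕜] G.Arr.Model × G.Arr.Model :=
      LinearMap.prod (diff G.compFst (G.compMk g h e) : G.Comp.Model →ₗ[𝕜] G.Arr.Model)
        (diff G.compSnd (G.compMk g h e) : G.Comp.Model →ₗ[𝕜] G.Arr.Model)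
    have hD : LinearMap.ker D = ⊥ :=
      LinearMap.ker_eq_bot.2 fun k k' hk => G.comp_tangent_ext _ hk
    obtain ⟨R, hR⟩ := D.exists_leftInverse_of_injective hD
    refine ⟨(diff G.compMul (G.compMk g h e) : G.Comp.Model →ₗ[𝕜] G.Arr.Model) ∘ₗ R,
      fun _ k => ?_⟩
    exact congrArg (diff G.compMul (G.compMk g h e)) (congrArg (fun L => L k) hR)
  · exact ⟨0, fun e' => absurd e' e⟩

/-- The multiplication of the tangent groupoid over `(g, h)`, extended linearly to pairs of
vectors that are not composable. -/
noncomputable def tmul (g h : G.Arr) (v w : G.Arr.Model) : G.Arr.Model :=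
  Classical.choose (G.exists_tmul g h) (v, w)

theorem tmul_diff (p : G.Comp) (k : G.Comp.Model) :
    G.tmul (G.compFst p) (G.compSnd p) (diff G.compFst p k) (diff G.compSnd p k) =
      diff G.compMul p k :=
  Classical.choose_spec (G.exists_tmul (G.compFst p) (G.compSnd p)) p.2 k

theorem tmul_zero (g h : G.Arr) : G.tmul g h 0 0 = 0 :=
  map_zero (Classical.choose (G.exists_tmul g h))

variable {G}

/-- The chain rule through the manifold of composable pairs. It turns any identity between products
of smooth families of arrows into an identity in the tangent groupoid. -/
theorem diff_mul {a b : N → G.Arr} (ha : Smooth a) (hb : Smooth b)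
    (e : ∀ z, G.src (a z) = G.tgt (b z)) (x : N) (u : N.Model) :
    diff (fun z => G.mul (a z) (b z)) x u = G.tmul (a x) (b x) (diff a x u) (diff b x u) := by
  have hc := smooth_compMk ha hb e
  have h0 := diff_comp G.smooth_compMul hc x u
  have h1 := diff_comp G.smooth_compFst hc x u
  have h2 := diff_comp G.smooth_compSnd hc x u
  refine h0.trans ((G.tmul_diff _ _).symm.trans ?_)
  rw [← h1, ← h2]
  rfl

/-- Composable tangent vectors come from the manifold of composable pairs. -/
theorem exists_comp_tangent {g h : G.Arr} (e : G.src g = G.tgt h) {v w : G.Arr.Model}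
    (d : diff G.src g v = diff G.tgt h w) : ∃ k, diff G.compFst (G.compMk g h e) k = v ∧
      diff G.compSnd (G.compMk g h e) k = w ∧
      diff G.compMul (G.compMk g h e) k = G.tmul g h v w := by
  obtain ⟨k, hv, hw⟩ := G.comp_tangent_exists (G.compMk g h e) d
  refine ⟨k, hv, hw, ?_⟩
  rw [← G.tmul_diff, hv, hw]
  rfl

/-- Obtained by differentiating `src (g h) = src h` over the manifold of composable pairs;
`diff_tgt_tmul` is the same for targets. -/
theorem diff_src_tmul {g h : G.Arr} (e : G.src g = G.tgt h) {v w : G.Arr.Model}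
    (d : diff G.src g v = diff G.tgt h w) :
    diff G.src (G.mul g h) (G.tmul g h v w) = diff G.src h w := by
  obtain ⟨k, -, hw, hm⟩ := exists_comp_tangent e d
  have h1 := diff_comp G.smooth_src G.smooth_compMul (G.compMk g h e) k
  have h2 := diff_comp G.smooth_src G.smooth_compSnd (G.compMk g h e) k
  have h3 : (fun p => G.src (G.compMul p)) = fun p => G.src (G.compSnd p) :=
    funext fun p => G.src_mul _ _ p.2
  rw [h3, hm] at h1
  rw [hw] at h2
  exact h1.symm.trans h2

theorem diff_tgt_tmul {g h : G.Arr} (e : G.src g = G.tgt h) {v w : G.Arr.Model}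
    (d : diff G.src g v = diff G.tgt h w) :
    diff G.tgt (G.mul g h) (G.tmul g h v w) = diff G.tgt g v := by
  obtain ⟨k, hv, -, hm⟩ := exists_comp_tangent e d
  have h1 := diff_comp G.smooth_tgt G.smooth_compMul (G.compMk g h e) k
  have h2 := diff_comp G.smooth_tgt G.smooth_compFst (G.compMk g h e) k
  have h3 : (fun p => G.tgt (G.compMul p)) = fun p => G.tgt (G.compFst p) :=
    funext fun p => G.tgt_mul _ _ p.2
  rw [h3, hm] at h1
  rw [hv] at h2
  exact h1.symm.trans h2

variable (G)

theorem diff_src_one (x : G.Obj) (u : G.Obj.Model) :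
    diff G.src (G.one x) (diff G.one x u) = u := by
  rw [← diff_comp G.smooth_src G.smooth_one, funext G.src_one, diff_id]

theorem diff_tgt_one (x : G.Obj) (u : G.Obj.Model) :
    diff G.tgt (G.one x) (diff G.one x u) = u := by
  rw [← diff_comp G.smooth_tgt G.smooth_one, funext G.tgt_one, diff_id]

theorem diff_src_inv (g : G.Arr) (v : G.Arr.Model) :
    diff G.src (G.inv g) (diff G.inv g v) = diff G.tgt g v := by
  rw [← diff_comp G.smooth_src G.smooth_inv, funext G.src_inv]

theorem diff_tgt_inv (g : G.Arr) (v : G.Arr.Model) :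
    diff G.tgt (G.inv g) (diff G.inv g v) = diff G.src g v := by
  rw [← diff_comp G.smooth_tgt G.smooth_inv, funext G.tgt_inv]

/-- The unit law, differentiated in the direction `v` with `g` as the variable. The next two lemmas
arise in the same way from the other unit law and from `g g⁻¹ = 1`. -/
theorem one_tmul (g : G.Arr) (v : G.Arr.Model) :
    G.tmul (G.one (G.tgt g)) g (diff G.one (G.tgt g) (diff G.tgt g v)) v = v := by
  have h := diff_mul (N := G.Arr) (a := fun g => G.one (G.tgt g)) (b := fun g => g)
    (G.smooth_one.comp G.smooth_tgt) contMDiff_id (fun g => G.src_one _) g v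
  rw [funext G.one_mul, diff_id, diff_comp G.smooth_one G.smooth_tgt] at h
  exact h.symm

theorem tmul_one (g : G.Arr) (v : G.Arr.Model) :
    G.tmul g (G.one (G.src g)) v (diff G.one (G.src g) (diff G.src g v)) = v := by
  have h := diff_mul (N := G.Arr) (a := fun g => g) (b := fun g => G.one (G.src g))
    contMDiff_id (G.smooth_one.comp G.smooth_src) (fun g => (G.tgt_one _).symm) g v
  rw [funext G.mul_one, diff_id, diff_comp G.smooth_one G.smooth_src] at h
  exact h.symm

theorem tmul_inv (g : G.Arr) (v : G.Arr.Model) :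
    G.tmul g (G.inv g) v (diff G.inv g v) = diff G.one (G.tgt g) (diff G.tgt g v) := by
  have h := diff_mul (N := G.Arr) (a := fun g => g) (b := G.inv)
    contMDiff_id G.smooth_inv (fun g => (G.tgt_inv _).symm) g v
  rw [funext G.mul_inv, diff_id, diff_comp G.smooth_one G.smooth_tgt] at h
  exact h.symm

theorem cancel_right (g h : G.Arr) (e : G.src g = G.tgt h) :
    G.mul (G.mul g h) (G.inv h) = g := by
  rw [G.mul_assoc _ _ _ e (G.tgt_inv h).symm, G.mul_inv, ← e, G.mul_one]

theorem inv_cancel_right (g h : G.Arr) (e : G.src g = G.src h) :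
    G.mul (G.mul g (G.inv h)) h = g := by
  rw [G.mul_assoc _ _ _ (e.trans (G.tgt_inv h).symm) (G.src_inv h), G.inv_mul, ← e, G.mul_one]

theorem cancel_left_inv (g h : G.Arr) (e : G.tgt g = G.tgt h) :
    G.mul g (G.mul (G.inv g) h) = h := by
  rw [← G.mul_assoc _ _ _ (G.tgt_inv g).symm ((G.src_inv g).trans e), G.mul_inv, e, G.one_mul]

theorem inv_one (x : G.Obj) : G.inv (G.one x) = G.one x := by
  have h := G.mul_one (G.inv (G.one x))
  rw [G.src_inv, G.tgt_one] at h
  rw [← h, G.inv_mul, G.src_one]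

theorem diff_inv_one (x : G.Obj) (u : G.Obj.Model) :
    diff G.inv (G.one x) (diff G.one x u) = diff G.one x u := by
  rw [← diff_comp G.smooth_inv G.smooth_one, funext G.inv_one]

variable {G}

/-- The derivative of `(g h) h⁻¹ = g` over composable pairs. -/
theorem tmul_cancel_right {g h : G.Arr} (e : G.src g = G.tgt h) {v w : G.Arr.Model}
    (d : diff G.src g v = diff G.tgt h w) :
    G.tmul (G.mul g h) (G.inv h) (G.tmul g h v w) (diff G.inv h w) = v := by
  obtain ⟨k, hv, hw, hm⟩ := exists_comp_tangent e d
  have h1 := diff_mul G.smooth_compMul (G.smooth_inv.comp G.smooth_compSnd)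
    (fun p => (G.src_mul _ _ p.2).trans (G.tgt_inv _).symm) (G.compMk g h e) k
  have h2 : (fun p => G.mul (G.compMul p) ((G.inv ∘ G.compSnd) p)) = G.compFst :=
    funext fun p => G.cancel_right _ _ p.2
  have h3 : diff (G.inv ∘ G.compSnd) (G.compMk g h e) k = diff G.inv h w := by
    rw [← hw]
    exact diff_comp G.smooth_inv G.smooth_compSnd _ _
  rw [h2, hv, hm, h3] at h1
  exact h1.symm

end LieGroupoid

end ShiftedSymplectic

/-! ### Linear algebra of 2-forms and of self-orthogonal subspaces -/

namespace ShiftedSymplectic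

variable {𝕜 : Type v} [RCLike 𝕜]

theorem update_vec₂_zero {E : Type*} (v w x : E) : Function.update ![v, w] 0 x = ![x, w] := by
  funext i; fin_cases i <;> simp

section TwoForms

variable {E : Type*} [NormedAddCommGroup E] [NormedSpace 𝕜 E] (α : E [⋀^Fin 2]→L[𝕜] 𝕜)

theorem form₂_add_left (v v' w : E) : α ![v + v', w] = α ![v, w] + α ![v', w] := by
  have h := α.map_update_add ![v, w] 0 v v'
  rwa [update_vec₂_zero, update_vec₂_zero, update_vec₂_zero] at h

theorem form₂_smul_left (c : 𝕜) (v w : E) : α ![c • v, w] = c * α ![v, w] := by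
  have h := α.map_update_smul ![v, w] 0 c v
  rwa [update_vec₂_zero, update_vec₂_zero] at h

theorem form₂_swap (v w : E) : α ![v, w] = -α ![w, v] := by
  have h := α.toAlternatingMap.map_swap ![w, v] (i := 0) (j := 1) (by decide)
  have h1 : (![w, v] ∘ Equiv.swap (0 : Fin 2) 1) = ![v, w] := by
    funext i; fin_cases i <;> simp
  rw [h1] at h
  exact h

theorem form₂_add_right (v w w' : E) : α ![v, w + w'] = α ![v, w] + α ![v, w'] := by
  rw [form₂_swap, form₂_add_left, form₂_swap α v w, form₂_swap α v w']
  ring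

theorem form₂_smul_right (c : 𝕜) (v w : E) : α ![v, c • w] = c * α ![v, w] := by
  rw [form₂_swap, form₂_smul_left, form₂_swap α v w]
  ring

/-- The bilinear form of a 2-form. -/
noncomputable def bilin₂ : E →ₗ[𝕜] E →ₗ[𝕜] 𝕜 :=
  LinearMap.mk₂ 𝕜 (fun v w => α ![v, w]) (form₂_add_left α) (form₂_smul_left α)
    (form₂_add_right α) (form₂_smul_right α)

theorem bilin₂_apply (v w : E) : bilin₂ α v w = α ![v, w] := rfl

theorem form₂_zero_left (w : E) : α ![0, w] = 0 := by
  rw [← bilin₂_apply, map_zero, LinearMap.zero_apply]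

theorem form₂_zero_right (v : E) : α ![v, 0] = 0 := by
  rw [← bilin₂_apply, map_zero]

theorem form₂_neg_left (v w : E) : α ![-v, w] = -α ![v, w] := by
  rw [← bilin₂_apply, map_neg, LinearMap.neg_apply, bilin₂_apply]

theorem form₂_sub_left (v v' w : E) : α ![v - v', w] = α ![v, w] - α ![v', w] := by
  rw [← bilin₂_apply, map_sub, LinearMap.sub_apply, bilin₂_apply, bilin₂_apply]

end TwoForms

theorem pullback_apply₂ {M N : Mfd.{u} 𝕜} (f : M → N) (α : Form N 2) (x : M) (v w : M.Model) :
    pullback f α x ![v, w] = α (f x) ![diff f x v, diff f x w] := by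
  rw [pullback_apply]
  congr 1
  funext i
  fin_cases i <;> rfl

/-- A linear map with a given value on a surjective image. -/
theorem exists_descent {K : Type*} [Field K] {V W : Type*} [AddCommGroup V] [Module K V]
    [AddCommGroup W] [Module K W] (f : V →ₗ[K] W) (hf : Function.Surjective f) (l : V →ₗ[K] K)
    (h : ∀ v, f v = 0 → l v = 0) : ∃ m : W →ₗ[K] K, ∀ v, m (f v) = l v := by
  obtain ⟨s, hs⟩ := f.exists_rightInverse_of_surjective (LinearMap.range_eq_top.2 hf)
  refine ⟨l ∘ₗ s, fun v => ?_⟩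
  have h1 : f (s (f v) - v) = 0 := by
    rw [map_sub, sub_eq_zero]
    exact congrArg (fun L => L (f v)) hs
  have := h _ h1
  rw [map_sub, sub_eq_zero] at this
  exact this

/-- If `ρ : A → V` and `σ : A → V*` are jointly injective, `(ρ, σ)` is isotropic and
`dim A = dim V`, then the image of `(ρ, σ)` is its own orthogonal. -/
theorem exists_of_orthogonal {K : Type*} [Field K] {A V : Type*} [AddCommGroup A] [Module K A]
    [FiniteDimensional K A] [AddCommGroup V] [Module K V] [FiniteDimensional K V]
    (ρ : A →ₗ[K] V) (σ : A →ₗ[K] V →ₗ[K] K)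
    (hd : Module.finrank K A = Module.finrank K V)
    (hinj : ∀ a, ρ a = 0 → σ a = 0 → a = 0)
    (hiso : ∀ a c, σ a (ρ c) + σ c (ρ a) = 0) (v : V) (η : V →ₗ[K] K)
    (h : ∀ c, η (ρ c) + σ c v = 0) : ∃ a, ρ a = v ∧ σ a = η := by
  let τ : A →ₗ[K] V × Module.Dual K V := ρ.prod σ
  have hτ : LinearMap.ker τ = ⊥ := by
    rw [LinearMap.ker_eq_bot']
    intro a ha
    exact hinj a (congrArg Prod.fst ha) (congrArg Prod.snd ha)
  -- `B p` is the pairing of `p` with the image of `τ`, so the kernel of `B` is the orthogonal of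
  -- that image.
  let B : V × Module.Dual K V →ₗ[K] Module.Dual K A :=
    (σ.flip).coprod (Module.Dual.transpose ρ)
  have hB : ∀ p c, B p c = σ c p.1 + p.2 (ρ c) := fun p c => rfl
  -- As `τ` is injective, a functional on `A` extends to `V × V*`; as `V` is reflexive, the
  -- extension is the pairing with some `(w, ξ)`.
  have hsurj : Function.Surjective B := by
    intro l
    obtain ⟨r, hr⟩ := τ.exists_leftInverse_of_injective hτ
    let l' : V × Module.Dual K V →ₗ[K] K := l ∘ₗ r
    have hl : ∀ a, l' (τ a) = l a := fun a => congrArg l (congrArg (fun L => L a) hr)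
    obtain ⟨w, hw⟩ := (Module.evalEquiv K V).surjective (l' ∘ₗ LinearMap.inr K V (Module.Dual K V))
    refine ⟨(w, l' ∘ₗ LinearMap.inl K V (Module.Dual K V)), ?_⟩
    ext c
    rw [hB, ← hl c]
    have h1 : (σ c) w = l' (0, σ c) := congrArg (fun L => L (σ c)) hw
    have h2 : τ c = (ρ c, 0) + (0, σ c) := by simp [τ]
    rw [h2, map_add, ← h1, add_comm]
    rfl
  have hker : LinearMap.range τ ≤ LinearMap.ker B := by
    rintro _ ⟨a, rfl⟩
    rw [LinearMap.mem_ker]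
    ext c
    rw [hB]
    exact (add_comm _ _).trans (hiso a c)
  have hr1 := LinearMap.finrank_range_add_finrank_ker B
  rw [LinearMap.range_eq_top.2 hsurj, finrank_top, Module.finrank_prod, Subspace.dual_finrank_eq,
    Subspace.dual_finrank_eq] at hr1
  have hr2 := LinearMap.finrank_range_of_inj (LinearMap.ker_eq_bot.1 hτ)
  -- The kernel of `B` has dimension `2 dim V - dim A = dim A`, which is the dimension of the image
  -- of `τ`.
  have heq := Submodule.eq_of_le_of_finrank_eq hker (by omega)
  have hm : (v, η) ∈ LinearMap.range τ := by
    rw [heq, LinearMap.mem_ker]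
    ext c
    rw [hB, add_comm]
    exact h c
  obtain ⟨a, ha⟩ := hm
  exact ⟨a, congrArg Prod.fst ha, congrArg Prod.snd ha⟩

/-! ### Multiplicative forms and nondegeneracy along all arrows -/

namespace QuasiSymplecticGroupoid

variable (G : QuasiSymplecticGroupoid.{u} 𝕜) {N : Mfd.{u} 𝕜}

variable {G} in
theorem pullback_mul {a b : N → G.Arr} (ha : Smooth a) (hb : Smooth b)
    (e : ∀ z, G.src (a z) = G.tgt (b z)) :
    pullback (fun z => G.mul (a z) (b z)) G.Ω = pullback a G.Ω + pullback b G.Ω := by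
  have hc := LieGroupoid.smooth_compMk ha hb e
  have h := congrArg (pullback fun z => G.compMk (a z) (b z) (e z)) G.multiplicative
  rw [pullback_add, pullback_pullback G.smooth_compMul hc, pullback_pullback G.smooth_compFst hc,
    pullback_pullback G.smooth_compSnd hc] at h
  exact h

/-- From `1 · 1 = 1` and multiplicativity the pulled back form equals its own double. -/
theorem pullback_one : pullback G.one G.Ω = 0 := by
  have h := pullback_mul (G := G) G.smooth_one G.smooth_one
    (fun x => (G.src_one x).trans (G.tgt_one x).symm)
  have h1 : (fun x => G.mul (G.one x) (G.one x)) = G.one := by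
    funext x
    have := G.mul_one (G.one x)
    rwa [G.src_one] at this
  rw [h1] at h
  exact left_eq_add.1 h

/-- Since `g g⁻¹` is a unit and `Ω` vanishes along the units, the forms `Ω` and `inv^* Ω` add up to
zero. -/
theorem pullback_inv_arr : pullback G.inv G.Ω = -G.Ω := by
  have h := pullback_mul (G := G) (a := fun g => g) (b := G.inv) contMDiff_id G.smooth_inv
    (fun g => (G.tgt_inv g).symm)
  rw [funext G.mul_inv, ← pullback_pullback G.smooth_one G.smooth_tgt, pullback_one,
    pullback_zero] at h
  have h1 : pullback (fun g : G.Arr => g) G.Ω = G.Ω := by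
    funext g
    ext v
    rw [pullback_apply]
    simp only [diff_id]
  rw [h1] at h
  exact eq_neg_of_add_eq_zero_right h.symm

variable {G} in
theorem pullback_inv {a : N → G.Arr} (ha : Smooth a) :
    pullback (fun z => G.inv (a z)) G.Ω = -pullback a G.Ω := by
  rw [← pullback_pullback G.smooth_inv ha, pullback_inv_arr, pullback_neg]

variable {G} in
theorem Ω_tmul {g h : G.Arr} (e : G.src g = G.tgt h) {v w v' w' : G.Arr.Model}
    (d : diff G.src g v = diff G.tgt h w) (d' : diff G.src g v' = diff G.tgt h w') :
    G.Ω (G.mul g h) ![G.tmul g h v w, G.tmul g h v' w'] = G.Ω g ![v, v'] + G.Ω h ![w, w'] := by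
  obtain ⟨k, hv, hw, hm⟩ := LieGroupoid.exists_comp_tangent e d
  obtain ⟨k', hv', hw', hm'⟩ := LieGroupoid.exists_comp_tangent e d'
  have h : pullback G.compMul G.Ω (G.compMk g h e) ![k, k'] =
      pullback G.compFst G.Ω (G.compMk g h e) ![k, k'] +
        pullback G.compSnd G.Ω (G.compMk g h e) ![k, k'] :=
    congrArg (fun α => α (G.compMk g h e) ![k, k']) G.multiplicative
  simp only [pullback_apply₂, hv, hw, hm, hv', hw', hm'] at h
  exact h

theorem Ω_inv (g : G.Arr) (v w : G.Arr.Model) :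
    G.Ω (G.inv g) ![diff G.inv g v, diff G.inv g w] = -G.Ω g ![v, w] := by
  rw [← pullback_apply₂, pullback_inv_arr]
  rfl

theorem mem_algebroid {x : G.Obj} {a : G.Arr.Model} :
    a ∈ G.algebroid x ↔ diff G.src (G.one x) a = 0 := LinearMap.mem_ker

/-- The IM-form as a bilinear map. -/
noncomputable def imBilin (x : G.Obj) : G.Arr.Model →ₗ[𝕜] G.Obj.Model →ₗ[𝕜] 𝕜 :=
  (bilin₂ (G.Ω (G.one x))).compl₂ (diff G.one x : G.Obj.Model →ₗ[𝕜] G.Arr.Model)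

theorem imBilin_apply (x : G.Obj) (a : G.Arr.Model) (w : G.Obj.Model) :
    G.imBilin x a w = G.imForm x a w := rfl

/-- The product `c · 0_g` is the right translate of `c` to `g`. This lemma and the next two give its
source, its target and its contraction with `Ω`. -/
theorem diff_src_tmul_zero (g : G.Arr) {c : G.Arr.Model} (hc : c ∈ G.algebroid (G.tgt g)) :
    diff G.src g (G.tmul (G.one (G.tgt g)) g c 0) = 0 := by
  have h := LieGroupoid.diff_src_tmul (G.src_one (G.tgt g))
    (show diff G.src (G.one (G.tgt g)) c = diff G.tgt g 0 by rw [map_zero]; exact hc)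
  rwa [G.one_mul, map_zero] at h

theorem diff_tgt_tmul_zero (g : G.Arr) {c : G.Arr.Model} (hc : c ∈ G.algebroid (G.tgt g)) :
    diff G.tgt g (G.tmul (G.one (G.tgt g)) g c 0) = G.anchor (G.tgt g) c := by
  have h := LieGroupoid.diff_tgt_tmul (G.src_one (G.tgt g))
    (show diff G.src (G.one (G.tgt g)) c = diff G.tgt g 0 by rw [map_zero]; exact hc)
  rwa [G.one_mul] at h

/-- Writing `z` as `one_*(tgt_* z) · z`, multiplicativity splits the value into `Ω(c, one_* tgt_*
z)`, which is the IM-form, and `Ω(0, z) = 0`. -/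
theorem Ω_tmul_zero (g : G.Arr) {c : G.Arr.Model} (hc : c ∈ G.algebroid (G.tgt g))
    (z : G.Arr.Model) : G.Ω g ![G.tmul (G.one (G.tgt g)) g c 0, z] =
      G.imForm (G.tgt g) c (diff G.tgt g z) := by
  have h := Ω_tmul (G.src_one (G.tgt g))
    (show diff G.src (G.one (G.tgt g)) c = diff G.tgt g 0 by rw [map_zero]; exact hc)
    (show diff G.src (G.one (G.tgt g)) (diff G.one (G.tgt g) (diff G.tgt g z)) = diff G.tgt g z
      from G.diff_src_one _ _)
  rwa [G.one_mul, G.one_tmul, form₂_zero_left, add_zero] at h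

/-- The tangent vector `b · 0_g · a⁻¹` at `g`, for `a` and `b` in the Lie algebroid at the source
and the target of `g`. -/
noncomputable def conj (g : G.Arr) (a b : G.Arr.Model) : G.Arr.Model :=
  G.tmul g (G.one (G.src g)) (G.tmul (G.one (G.tgt g)) g b 0) (diff G.inv (G.one (G.src g)) a)

section Conj

variable {G} {g : G.Arr} {a b : G.Arr.Model}

theorem diff_tgt_inv_algebroid (ha : a ∈ G.algebroid (G.src g)) :
    diff G.tgt (G.one (G.src g)) (diff G.inv (G.one (G.src g)) a) = 0 := by
  have h1 := G.diff_tgt_inv (G.one (G.src g)) a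
  rw [G.inv_one] at h1
  exact h1.trans ha

theorem diff_src_inv_algebroid :
    diff G.src (G.one (G.src g)) (diff G.inv (G.one (G.src g)) a) = G.anchor (G.src g) a := by
  have h1 := G.diff_src_inv (G.one (G.src g)) a
  rwa [G.inv_one] at h1

theorem diff_src_conj (ha : a ∈ G.algebroid (G.src g)) (hb : b ∈ G.algebroid (G.tgt g)) :
    diff G.src g (G.conj g a b) = G.anchor (G.src g) a := by
  have h := LieGroupoid.diff_src_tmul (G.tgt_one (G.src g)).symm
    ((G.diff_src_tmul_zero g hb).trans (diff_tgt_inv_algebroid ha).symm)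
  rw [G.mul_one] at h
  exact h.trans diff_src_inv_algebroid

theorem diff_tgt_conj (ha : a ∈ G.algebroid (G.src g)) (hb : b ∈ G.algebroid (G.tgt g)) :
    diff G.tgt g (G.conj g a b) = G.anchor (G.tgt g) b := by
  have h := LieGroupoid.diff_tgt_tmul (G.tgt_one (G.src g)).symm
    ((G.diff_src_tmul_zero g hb).trans (diff_tgt_inv_algebroid ha).symm)
  rw [G.mul_one] at h
  exact h.trans (G.diff_tgt_tmul_zero g hb)

/-- Multiplicativity applied to `z = z · one_*(src_* z)` separates `b · 0_g` from `a⁻¹`. The minus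
sign comes from `inv^* Ω = -Ω`, the inversion fixing vectors tangent to the units. -/
theorem Ω_conj (ha : a ∈ G.algebroid (G.src g)) (hb : b ∈ G.algebroid (G.tgt g))
    (z : G.Arr.Model) : G.Ω g ![G.conj g a b, z] =
    G.imForm (G.tgt g) b (diff G.tgt g z) - G.imForm (G.src g) a (diff G.src g z) := by
  have h := Ω_tmul (G.tgt_one (G.src g)).symm
    ((G.diff_src_tmul_zero g hb).trans (diff_tgt_inv_algebroid ha).symm)
    (show diff G.src g z = diff G.tgt (G.one (G.src g)) (diff G.one (G.src g) (diff G.src g z))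
      from (G.diff_tgt_one _ _).symm)
  rw [G.mul_one, G.tmul_one, Ω_tmul_zero G g hb] at h
  have h2 := G.Ω_inv (G.one (G.src g)) a (diff G.one (G.src g) (diff G.src g z))
  rw [G.inv_one, G.diff_inv_one] at h2
  rw [h2, ← sub_eq_add_neg] at h
  exact h

end Conj

/-- The case `g = 1_x` of `Ω_tmul_zero`, because the right translate of `a` by a unit is `a` itself.
The vector `b` is any tangent vector at the unit, not only an element of the Lie algebroid. -/
theorem Ω_algebroid {x : G.Obj} {a : G.Arr.Model} (ha : a ∈ G.algebroid x) (b : G.Arr.Model) :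
    G.imForm x a (G.anchor x b) = G.Ω (G.one x) ![a, b] := by
  have hx := G.tgt_one x
  have h := G.Ω_tmul_zero (G.one x) (c := a) (by rwa [hx]) b
  rw [hx] at h
  -- Since `src_* a = 0`, the unit law reads `a · 0 = a`.
  have h2 := G.tmul_one (G.one x) a
  rw [G.src_one, (G.mem_algebroid).1 ha, map_zero] at h2
  rw [h2] at h
  exact h.symm

/-- The two terms are `Ω(a, b)` and `Ω(b, a)`. This is isotropy of the image of `(ρ, σ)` in `T ⊕
T*`. -/
theorem imForm_anchor {x : G.Obj} {a b : G.Arr.Model} (ha : a ∈ G.algebroid x)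
    (hb : b ∈ G.algebroid x) :
    G.imForm x a (G.anchor x b) + G.imForm x b (G.anchor x a) = 0 := by
  rw [Ω_algebroid G ha, Ω_algebroid G hb, form₂_swap, neg_add_cancel]

/-- The hypotheses place `a` in `ker Ω ∩ ker src_* ∩ ker tgt_*`: any `w` is the sum of a vector
tangent to the source fibre and a vector tangent to the units, and `Ω(a, ·)` on either is a value of
`σ(a)`. This is injectivity of `(ρ, σ)`. -/
theorem eq_zero_of_imForm {x : G.Obj} {a : G.Arr.Model} (ha : a ∈ G.algebroid x)
    (h0 : G.anchor x a = 0) (hσ : ∀ w, G.imForm x a w = 0) : a = 0 := by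
  refine G.nondegenerate x a (fun w => ?_) ha h0
  have h1 := G.Ω_algebroid ha (w - diff G.one x (diff G.src (G.one x) w))
  rw [hσ] at h1
  have h2 := hσ (diff G.src (G.one x) w)
  have h3 := form₂_add_right (G.Ω (G.one x)) a (w - diff G.one x (diff G.src (G.one x) w))
    (diff G.one x (diff G.src (G.one x) w))
  rw [sub_add_cancel, ← h1, zero_add] at h3
  exact h3.trans h2

/-- Here `dim Arr = 2 dim Obj` enters; it makes the isotropic image of `(ρ, σ)` of maximal
dimension. -/
theorem finrank_algebroid (x : G.Obj) :
    Module.finrank 𝕜 (G.algebroid x) = Module.finrank 𝕜 G.Obj.Model := by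
  have hr := LinearMap.finrank_range_add_finrank_ker
    (diff G.src (G.one x) : G.Arr.Model →ₗ[𝕜] G.Obj.Model)
  rw [LinearMap.range_eq_top.2 (G.submersive_src (G.one x)), finrank_top] at hr
  have h1 : Module.finrank 𝕜 G.Arr.Model = 2 * G.Obj.dim :=
    finrank_euclideanSpace_fin.trans G.dim_eq
  have h2 : Module.finrank 𝕜 G.Obj.Model = G.Obj.dim := finrank_euclideanSpace_fin
  rw [LieGroupoid.algebroid]
  omega

/-- The image of `(ρ, σ)` is its own orthogonal in `T ⊕ T*`, and the hypothesis says that `(v, η)`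
is orthogonal to it. -/
theorem exists_algebroid (x : G.Obj) (v : G.Obj.Model) (η : G.Obj.Model →ₗ[𝕜] 𝕜)
    (h : ∀ c ∈ G.algebroid x, η (G.anchor x c) + G.imForm x c v = 0) :
    ∃ a ∈ G.algebroid x, G.anchor x a = v ∧ ∀ w, G.imForm x a w = η w := by
  obtain ⟨a, h1, h2⟩ := exists_of_orthogonal
    ((G.anchor x : G.Arr.Model →ₗ[𝕜] G.Obj.Model) ∘ₗ (G.algebroid x).subtype)
    (G.imBilin x ∘ₗ (G.algebroid x).subtype) (G.finrank_algebroid x)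
    (fun a ha hσ => Subtype.ext (G.eq_zero_of_imForm a.2 ha fun w => congrArg (fun L => L w) hσ))
    (fun a c => G.imForm_anchor a.2 c.2) v η (fun c => h c c.2)
  exact ⟨a, a.2, h1, fun w => congrArg (fun L => L w) h2⟩

/-- Nondegeneracy spreads from the units to all arrows by right translation. The vector `κ · 0` at
`g g⁻¹` lies in the Lie algebroid, its anchor is `tgt_* κ = 0`, and its IM-form vanishes because
`Ω(κ · 0, z · z⁻¹) = Ω(κ, z)`. Hence it is zero, and translating back gives `κ = 0`. -/
theorem eq_zero_of_Ω {g : G.Arr} {κ : G.Arr.Model} (hs : diff G.src g κ = 0)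
    (ht : diff G.tgt g κ = 0) (hΩ : ∀ z, G.Ω g ![κ, z] = 0) : κ = 0 := by
  have e : G.src g = G.tgt (G.inv g) := (G.tgt_inv g).symm
  have d : diff G.src g κ = diff G.tgt (G.inv g) 0 := by rw [hs, map_zero]
  have h1 := LieGroupoid.diff_src_tmul e d
  have h2 := LieGroupoid.diff_tgt_tmul e d
  rw [G.mul_inv, map_zero] at h1
  rw [G.mul_inv, ht] at h2
  have hc : G.tmul g (G.inv g) κ 0 = 0 := by
    refine G.eq_zero_of_imForm (x := G.tgt g) h1 h2 fun w => ?_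
    obtain ⟨z, rfl⟩ := G.submersive_tgt g w
    have h3 := Ω_tmul e d (G.diff_tgt_inv g z).symm
    rw [G.mul_inv, G.tmul_inv, hΩ, form₂_zero_left, add_zero] at h3
    exact h3
  have h4 := LieGroupoid.tmul_cancel_right e d
  rwa [hc, map_zero, G.tmul_zero, eq_comm] at h4

/-- A tangent vector at `g` whose contraction with `Ω` factors through source and target has the
form `b · 0_g · a⁻¹`. -/
theorem exists_conj (g : G.Arr) (w : G.Arr.Model) (ξ η : G.Obj.Model →ₗ[𝕜] 𝕜)
    (h : ∀ z, ξ (diff G.src g z) - η (diff G.tgt g z) = -G.Ω g ![w, z]) :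
    ∃ a ∈ G.algebroid (G.src g), ∃ b ∈ G.algebroid (G.tgt g), G.conj g a b = w ∧
      (∀ u, G.imForm (G.src g) a u = ξ u) ∧ ∀ u, G.imForm (G.tgt g) b u = η u := by
  -- Testing the hypothesis on the right translates `c · 0_g` shows that `(tgt_* w, η)` is
  -- orthogonal to the image of `(ρ, σ)` at the target.
  obtain ⟨b, hb, hb1, hb2⟩ := G.exists_algebroid (G.tgt g) (diff G.tgt g w) η (by
    intro c hc
    have h1 := h (G.conj g 0 c)
    rw [diff_src_conj (Submodule.zero_mem _) hc, diff_tgt_conj (Submodule.zero_mem _) hc,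
      form₂_swap, Ω_conj (Submodule.zero_mem _) hc, map_zero, map_zero, ← G.imBilin_apply _ 0,
      map_zero, LinearMap.zero_apply] at h1
    linear_combination -h1)
  -- At the source the test vectors are `0_g · c⁻¹`.
  obtain ⟨a, ha, ha1, ha2⟩ := G.exists_algebroid (G.src g) (diff G.src g w) ξ (by
    intro c hc
    have h1 := h (G.conj g c 0)
    rw [diff_src_conj hc (Submodule.zero_mem _), diff_tgt_conj hc (Submodule.zero_mem _),
      form₂_swap, Ω_conj hc (Submodule.zero_mem _), map_zero, map_zero, ← G.imBilin_apply _ 0,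
      map_zero, LinearMap.zero_apply] at h1
    linear_combination h1)
  refine ⟨a, ha, b, hb, ?_, ha2, hb2⟩
  -- The vectors `b · 0_g · a⁻¹` and `w` have the same source, target and contraction with `Ω`, so
  -- their difference vanishes by `eq_zero_of_Ω`.
  rw [← sub_eq_zero]
  refine G.eq_zero_of_Ω (g := g) ?_ ?_ fun z => ?_
  · rw [map_sub, diff_src_conj ha hb, ha1, sub_self]
  · rw [map_sub, diff_tgt_conj ha hb, hb1, sub_self]
  · rw [form₂_sub_left, Ω_conj ha hb, ha2, hb2]
    linear_combination -(h z)

end QuasiSymplecticGroupoid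

end ShiftedSymplectic

/-! ### The Lie algebroid of a homotopy fibre product -/

namespace ShiftedSymplectic

variable {𝕜 : Type v} [RCLike 𝕜]

section HFibreTangent

variable {L₁ L₂ G : LieGroupoid.{u} 𝕜} {μ : L₁.Hom G} {ν : L₂.Hom G}
  {ht : ArrTransverse G μ.obj ν.obj}

theorem diff_fLeft_eq {X Y : Mfd.{u} 𝕜} {μ : X → G.Obj} {ν : Y → G.Obj} {hμ : Smooth μ}
    {hν : Smooth ν} {ht : ArrTransverse G μ ν} (q : arrFibre hμ hν ht)
    (k : (arrFibre hμ hν ht).Model) :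
    diff μ (fLeft q) (diff (fLeft (ht := ht)) q k) =
      diff G.src (fMid q) (diff (fMid (ht := ht)) q k) := by
  have h1 := diff_comp hμ (smooth_left (ht := ht)) q k
  rw [show (fun y : arrFibre hμ hν ht => μ (fLeft y)) = fun y => G.src (fMid y) from
    funext fLeft_eq] at h1
  exact h1.symm.trans (diff_comp G.smooth_src (smooth_mid (ht := ht)) q k)

theorem diff_fRight_eq {X Y : Mfd.{u} 𝕜} {μ : X → G.Obj} {ν : Y → G.Obj} {hμ : Smooth μ}
    {hν : Smooth ν} {ht : ArrTransverse G μ ν} (q : arrFibre hμ hν ht)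
    (k : (arrFibre hμ hν ht).Model) :
    diff ν (fRight q) (diff (fRight (ht := ht)) q k) =
      diff G.tgt (fMid q) (diff (fMid (ht := ht)) q k) := by
  have h1 := diff_comp hν (smooth_right (ht := ht)) q k
  rw [show (fun y : arrFibre hμ hν ht => ν (fRight y)) = fun y => G.tgt (fMid y) from
    funext fRight_eq] at h1
  exact h1.symm.trans (diff_comp G.smooth_tgt (smooth_mid (ht := ht)) q k)

/-- The source of `(l, g, m)` is `(src l, g, src m)`, so killing it forces the middle component to
vanish. With `exists_hf_algebroid`, the Lie algebroid at `(x, g, y)` becomes the direct sum of those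
of `L₁` at `x` and `L₂` at `y`. -/
theorem mem_hf_algebroid (q : hfObj μ ν ht) (b : (hfArr μ ν ht).Model) :
    b ∈ (hfGroupoid μ ν ht).algebroid q ↔
      diff (fLeft (ht := ht.arr)) (hfOne q) b ∈ L₁.algebroid (fLeft q) ∧
      diff (fMid (ht := ht.arr)) (hfOne q) b = 0 ∧
      diff (fRight (ht := ht.arr)) (hfOne q) b ∈ L₂.algebroid (fRight q) := by
  have e1 := (diff_comp smooth_left smooth_hfSrc (hfOne q) b).symm.trans
    (diff_comp L₁.smooth_src (smooth_left (ht := ht.arr)) (hfOne q) b)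
  have e2 := (diff_comp smooth_mid smooth_hfSrc (hfOne q) b).symm.trans
    (show _ = diff (fMid (ht := ht.arr)) (hfOne q) b from rfl)
  have e3 := (diff_comp smooth_right smooth_hfSrc (hfOne q) b).symm.trans
    (diff_comp L₂.smooth_src (smooth_right (ht := ht.arr)) (hfOne q) b)
  constructor
  · intro hb
    have hb' : diff (hfSrc (ht := ht)) (hfOne q) b = 0 := hb
    rw [hb', map_zero] at e1 e2 e3
    exact ⟨e1.symm, e2.symm, e3.symm⟩
  · rintro ⟨h1, h2, h3⟩
    refine arrFibre_tangent_ext (hfSrc (hfOne q)) ?_ ?_ ?_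
    · exact (e1.trans h1).trans (map_zero _).symm
    · exact (e2.trans h2).trans (map_zero _).symm
    · exact (e3.trans h3).trans (map_zero _).symm

theorem exists_hf_algebroid (q : hfObj μ ν ht) {b₁ : L₁.Arr.Model} {b₂ : L₂.Arr.Model}
    (h₁ : b₁ ∈ L₁.algebroid (fLeft q)) (h₂ : b₂ ∈ L₂.algebroid (fRight q)) :
    ∃ b ∈ (hfGroupoid μ ν ht).algebroid q, diff (fLeft (ht := ht.arr)) (hfOne q) b = b₁ ∧
      diff (fRight (ht := ht.arr)) (hfOne q) b = b₂ := by
  obtain ⟨b, e1, e2, e3⟩ := arrFibre_tangent_exists (ht := ht.arr) (hfOne q) b₁ 0 b₂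
    (by
      have h := diff_comp μ.smooth_obj L₁.smooth_src (L₁.one (fLeft q)) b₁
      rw [show diff L₁.src (L₁.one (fLeft q)) b₁ = 0 from h₁, map_zero] at h
      exact h.trans (map_zero _).symm)
    (by
      have h := diff_comp ν.smooth_obj L₂.smooth_src (L₂.one (fRight q)) b₂
      rw [show diff L₂.src (L₂.one (fRight q)) b₂ = 0 from h₂, map_zero] at h
      exact h.trans (map_zero _).symm)
  refine ⟨b, (mem_hf_algebroid q b).2 ⟨?_, e2, ?_⟩, e1, e3⟩
  · rwa [e1]
  · rwa [e3]

theorem hf_anchor_left (q : hfObj μ ν ht) (b : (hfArr μ ν ht).Model) :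
    diff (fLeft (ht := ht)) q ((hfGroupoid μ ν ht).anchor q b) =
      L₁.anchor (fLeft q) (diff (fLeft (ht := ht.arr)) (hfOne q) b) := by
  have e := (diff_comp smooth_left smooth_hfTgt (hfOne q) b).symm.trans
    (diff_comp L₁.smooth_tgt (smooth_left (ht := ht.arr)) (hfOne q) b)
  rw [show hfTgt (hfOne q) = q from (hfGroupoid μ ν ht).tgt_one q] at e
  exact e

theorem hf_anchor_right (q : hfObj μ ν ht) (b : (hfArr μ ν ht).Model) :
    diff (fRight (ht := ht)) q ((hfGroupoid μ ν ht).anchor q b) =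
      L₂.anchor (fRight q) (diff (fRight (ht := ht.arr)) (hfOne q) b) := by
  have e := (diff_comp smooth_right smooth_hfTgt (hfOne q) b).symm.trans
    (diff_comp L₂.smooth_tgt (smooth_right (ht := ht.arr)) (hfOne q) b)
  rw [show hfTgt (hfOne q) = q from (hfGroupoid μ ν ht).tgt_one q] at e
  exact e

end HFibreTangent

/-! ### Anchor and forms of a composition -/

namespace FormSpan

variable {G₁ G₂ G₃ : QuasiSymplecticGroupoid.{u} 𝕜}

/-- The middle component of the target is `ν m · g · (μ l)⁻¹`. Its derivative at an identity arrow,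
in a direction whose middle component is zero, is `ν_* b₂ · 0_g · (μ_* b₁)⁻¹`. -/
theorem hf_anchor_mid {L₁ L₂ : LieGroupoid.{u} 𝕜} {μ : L₁.Hom G₂.toLieGroupoid}
    {ν : L₂.Hom G₂.toLieGroupoid} {ht : ArrTransverse G₂.toLieGroupoid μ.obj ν.obj}
    (q : hfObj μ ν ht) {b : (hfArr μ ν ht).Model}
    (hb : b ∈ (hfGroupoid μ ν ht).algebroid q) :
    diff (fMid (ht := ht)) q ((hfGroupoid μ ν ht).anchor q b) =
      G₂.conj (fMid q)
        (diff μ.arr (L₁.one (fLeft q)) (diff (fLeft (ht := ht.arr)) (hfOne q) b))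
        (diff ν.arr (L₂.one (fRight q)) (diff (fRight (ht := ht.arr)) (hfOne q) b)) := by
  have e := diff_comp smooth_mid smooth_hfTgt (hfOne q) b
  rw [show hfTgt (hfOne q) = q from (hfGroupoid μ ν ht).tgt_one q] at e
  refine e.symm.trans ?_
  have hν : Smooth (fun r : hfArr μ ν ht => ν.arr (fRight r)) :=
    ν.smooth_arr.comp smooth_right
  have hμ : Smooth (fun r : hfArr μ ν ht => μ.arr (fLeft r)) :=
    μ.smooth_arr.comp smooth_left
  have e1 := LieGroupoid.diff_mul hν (smooth_mid (ht := ht.arr)) hf_comp1 (hfOne q) b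
  have e2 := LieGroupoid.diff_mul (LieGroupoid.smooth_mul_of hν (smooth_mid (ht := ht.arr)) hf_comp1)
    (G₂.smooth_inv.comp hμ) hf_comp2 (hfOne q) b
  refine e2.trans ?_
  rw [e1, ((mem_hf_algebroid q b).1 hb).2.1]
  have e3 := diff_comp ν.smooth_arr (smooth_right (ht := ht.arr)) (hfOne q) b
  have e4 := diff_comp G₂.smooth_inv hμ (hfOne q) b
  have e5 := diff_comp μ.smooth_arr (smooth_left (ht := ht.arr)) (hfOne q) b
  rw [e5] at e4
  have e6 : ν.arr (fRight (hfOne q)) = G₂.one (G₂.tgt (fMid q)) :=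
    (ν.arr_one _).trans (congrArg G₂.one (fRight_eq q))
  have e7 : μ.arr (fLeft (hfOne q)) = G₂.one (G₂.src (fMid q)) :=
    (μ.arr_one _).trans (congrArg G₂.one (fLeft_eq q))
  rw [QuasiSymplecticGroupoid.conj]
  have e8 : fMid (hfOne q) = fMid q := rfl
  have e9 : (G₂.inv ∘ fun r : hfArr μ ν ht => μ.arr (fLeft r)) (hfOne q) =
      G₂.one (G₂.src (fMid q)) := by
    change G₂.inv (μ.arr (fLeft (hfOne q))) = _
    rw [e7, G₂.inv_one]
  rw [e9, e3, e6, e8, G₂.one_mul]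
  congr 1
  rw [← e7]
  exact e4

namespace IsLagrangian

variable {S₁ : FormSpan G₁ G₂} {S₂ : FormSpan G₂ G₃}

theorem eq_zero {S : FormSpan G₁ G₂} (h : S.IsLagrangian) (x : S.L.Obj) {b : S.L.Arr.Model}
    (hb : b ∈ S.L.algebroid x) (h0 : S.L.anchor x b = 0) (h1 : diff S.fst.arr (S.L.one x) b = 0)
    (h2 : diff S.snd.arr (S.L.one x) b = 0) : b = 0 := by
  refine (h.nondegenerate x).injOn hb (S.L.algebroid x).zero_mem ?_
  simp only [h0, h1, h2, map_zero]

theorem comp_smooth_γ (h₁ : S₁.IsLagrangian) (h₂ : S₂.IsLagrangian) (h : S₁.Transverse S₂) :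
    SmoothForm (S₁.comp S₂ h).γ :=
  ((h₁.smooth_γ.pullback smooth_left).add (h₂.smooth_γ.pullback smooth_right)).sub
    (G₂.smooth_Ω.pullback smooth_mid)

/-- By multiplicativity the pullback of `Ω₂` changes by `ν^* Ω₂ - μ^* Ω₂` from the source to the
target of `(l, g, m)`. This cancels the terms in `Ω₂` in the sum of the two given equations. -/
theorem comp_pullback_Ω (h₁ : S₁.IsLagrangian) (h₂ : S₂.IsLagrangian) (h : S₁.Transverse S₂) :
    pullback (S₁.comp S₂ h).fst.arr G₁.Ω - pullback (S₁.comp S₂ h).snd.arr G₃.Ω =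
      pullback (S₁.comp S₂ h).L.tgt (S₁.comp S₂ h).γ -
        pullback (S₁.comp S₂ h).L.src (S₁.comp S₂ h).γ := by
  have sl : Smooth (fun r : hfArr S₁.snd S₂.fst h => fLeft r) := smooth_left
  have sm : Smooth (fun r : hfArr S₁.snd S₂.fst h => fMid r) := smooth_mid
  have sr : Smooth (fun r : hfArr S₁.snd S₂.fst h => fRight r) := smooth_right
  have hν : Smooth (fun r : hfArr S₁.snd S₂.fst h => S₂.fst.arr (fRight r)) :=
    S₂.fst.smooth_arr.comp sr
  have hμ : Smooth (fun r : hfArr S₁.snd S₂.fst h => S₁.snd.arr (fLeft r)) :=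
    S₁.snd.smooth_arr.comp sl
  have A := congrArg (pullback (fun r : hfArr S₁.snd S₂.fst h => fLeft r)) h₁.pullback_Ω
  have B := congrArg (pullback (fun r : hfArr S₁.snd S₂.fst h => fRight r)) h₂.pullback_Ω
  rw [pullback_sub, pullback_sub, pullback_pullback S₁.fst.smooth_arr sl,
    pullback_pullback S₁.snd.smooth_arr sl, pullback_pullback S₁.L.smooth_tgt sl,
    pullback_pullback S₁.L.smooth_src sl] at A
  rw [pullback_sub, pullback_sub, pullback_pullback S₂.fst.smooth_arr sr,
    pullback_pullback S₂.snd.smooth_arr sr, pullback_pullback S₂.L.smooth_tgt sr,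
    pullback_pullback S₂.L.smooth_src sr] at B
  have C : pullback (fun r : hfArr S₁.snd S₂.fst h => hfTgtMid r) G₂.Ω = _ :=
    QuasiSymplecticGroupoid.pullback_mul
      (LieGroupoid.smooth_mul_of hν sm hf_comp1) (G₂.smooth_inv.comp hμ) hf_comp2
  have C1 := QuasiSymplecticGroupoid.pullback_mul hν sm hf_comp1
  have C2 := QuasiSymplecticGroupoid.pullback_inv hμ
  have T : pullback (fun r : hfArr S₁.snd S₂.fst h => hfTgt r) (S₁.comp S₂ h).γ =
      pullback (fun r : hfArr S₁.snd S₂.fst h => S₁.L.tgt (fLeft r)) S₁.γ +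
      pullback (fun r : hfArr S₁.snd S₂.fst h => S₂.L.tgt (fRight r)) S₂.γ -
      pullback (fun r : hfArr S₁.snd S₂.fst h => hfTgtMid r) G₂.Ω := by
    have t1 := pullback_pullback (smooth_left (ht := h)) smooth_hfTgt S₁.γ
    have t2 := pullback_pullback (smooth_right (ht := h)) smooth_hfTgt S₂.γ
    have t3 := pullback_pullback (smooth_mid (ht := h)) smooth_hfTgt G₂.Ω
    exact congrArg₂ (· - ·) (congrArg₂ (· + ·) t1 t2) t3
  have T' : pullback (fun r : hfArr S₁.snd S₂.fst h => hfSrc r) (S₁.comp S₂ h).γ =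
      pullback (fun r : hfArr S₁.snd S₂.fst h => S₁.L.src (fLeft r)) S₁.γ +
      pullback (fun r : hfArr S₁.snd S₂.fst h => S₂.L.src (fRight r)) S₂.γ -
      pullback (fun r : hfArr S₁.snd S₂.fst h => fMid r) G₂.Ω := by
    have t1 := pullback_pullback (smooth_left (ht := h)) smooth_hfSrc S₁.γ
    have t2 := pullback_pullback (smooth_right (ht := h)) smooth_hfSrc S₂.γ
    have t3 := pullback_pullback (smooth_mid (ht := h)) smooth_hfSrc G₂.Ω
    exact congrArg₂ (· - ·) (congrArg₂ (· + ·) t1 t2) t3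
  change pullback (fun r : hfArr S₁.snd S₂.fst h => S₁.fst.arr (fLeft r)) G₁.Ω -
    pullback (fun r : hfArr S₁.snd S₂.fst h => S₂.snd.arr (fRight r)) G₃.Ω =
    pullback (fun r : hfArr S₁.snd S₂.fst h => hfTgt r) (S₁.comp S₂ h).γ - pullback (fun r : hfArr S₁.snd S₂.fst h => hfSrc r) (S₁.comp S₂ h).γ
  rw [T, T', C, C1, C2]
  linear_combination (norm := module) A + B

/-- The two terms in `Φ₂` are pulled back along the source and the target of the middle arrow, and
their difference is the pullback of `dΩ₂`, which is what the term `-Ω₂` of the composed form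
absorbs. -/
theorem comp_pullback_Φ (h₁ : S₁.IsLagrangian) (h₂ : S₂.IsLagrangian) (h : S₁.Transverse S₂) :
    pullback (S₁.comp S₂ h).fst.obj G₁.Φ - pullback (S₁.comp S₂ h).snd.obj G₃.Φ =
      -extD (S₁.comp S₂ h).γ := by
  have sl : Smooth (fun q : hfObj S₁.snd S₂.fst h => fLeft q) := smooth_left
  have sm : Smooth (fun q : hfObj S₁.snd S₂.fst h => fMid q) := smooth_mid
  have sr : Smooth (fun q : hfObj S₁.snd S₂.fst h => fRight q) := smooth_right
  have A := congrArg (pullback (fun q : hfObj S₁.snd S₂.fst h => fLeft q)) h₁.pullback_Φ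
  have B := congrArg (pullback (fun q : hfObj S₁.snd S₂.fst h => fRight q)) h₂.pullback_Φ
  have C := congrArg (pullback (fun q : hfObj S₁.snd S₂.fst h => fMid q)) G₂.extD_Ω
  rw [pullback_sub, pullback_neg, pullback_pullback S₁.fst.smooth_obj sl,
    pullback_pullback S₁.snd.smooth_obj sl, ← extD_pullback sl h₁.smooth_γ] at A
  rw [pullback_sub, pullback_neg, pullback_pullback S₂.fst.smooth_obj sr,
    pullback_pullback S₂.snd.smooth_obj sr, ← extD_pullback sr h₂.smooth_γ] at B
  rw [pullback_sub, pullback_pullback G₂.smooth_src sm, pullback_pullback G₂.smooth_tgt sm,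
    ← extD_pullback sm G₂.smooth_Ω] at C
  have s1 := h₁.smooth_γ.pullback sl
  have s2 := h₂.smooth_γ.pullback sr
  have D : extD (S₁.comp S₂ h).γ = extD (pullback (fun q : hfObj S₁.snd S₂.fst h => fLeft q) S₁.γ) +
      extD (pullback (fun q : hfObj S₁.snd S₂.fst h => fRight q) S₂.γ) - extD (pullback (fun q : hfObj S₁.snd S₂.fst h => fMid q) G₂.Ω) := by
    have := extD_sub (s1.add s2) (G₂.smooth_Ω.pullback sm)
    rw [extD_add s1 s2] at this
    exact this
  have e1 : (fun q : hfObj S₁.snd S₂.fst h => S₁.snd.obj (fLeft q)) = fun q => G₂.src (fMid q) :=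
    funext fLeft_eq
  have e2 : (fun q : hfObj S₁.snd S₂.fst h => S₂.fst.obj (fRight q)) = fun q => G₂.tgt (fMid q) :=
    funext fRight_eq
  rw [e1] at A
  rw [e2] at B
  have key : pullback (fun q : hfObj S₁.snd S₂.fst h => S₁.fst.obj (fLeft q)) G₁.Φ -
      pullback (fun q : hfObj S₁.snd S₂.fst h => S₂.snd.obj (fRight q)) G₃.Φ =
      -(extD (pullback (fun q : hfObj S₁.snd S₂.fst h => fLeft q) S₁.γ) +
      extD (pullback (fun q : hfObj S₁.snd S₂.fst h => fRight q) S₂.γ) -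
      extD (pullback (fun q : hfObj S₁.snd S₂.fst h => fMid q) G₂.Ω)) := by
    rw [C]
    linear_combination (norm := module) A + B
  exact key.trans (congrArg Neg.neg D).symm

end IsLagrangian

end FormSpan

end ShiftedSymplectic

/-! ### Nondegeneracy of a composition -/

namespace ShiftedSymplectic

variable {𝕜 : Type v} [RCLike 𝕜]

namespace FormSpan

variable {G₁ G₂ G₃ : QuasiSymplecticGroupoid.{u} 𝕜}
  {S₁ : FormSpan G₁ G₂} {S₂ : FormSpan G₂ G₃}

/-- The Lagrangian condition on a vector and a pair of elements of the Lie algebroids. -/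
def lagrangianFibre (S : FormSpan G₁ G₂) (x : S.L.Obj) :
    Set (S.L.Obj.Model × G₁.Arr.Model × G₂.Arr.Model) :=
  {p | p.2.1 ∈ G₁.algebroid (S.fst.obj x) ∧ p.2.2 ∈ G₂.algebroid (S.snd.obj x) ∧
      diff S.fst.obj x p.1 = G₁.anchor (S.fst.obj x) p.2.1 ∧
      diff S.snd.obj x p.1 = G₂.anchor (S.snd.obj x) p.2.2 ∧
      ∀ w, S.γ x ![p.1, w] = G₁.imForm (S.fst.obj x) p.2.1 (diff S.fst.obj x w) -
        G₂.imForm (S.snd.obj x) p.2.2 (diff S.snd.obj x w)}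

namespace IsLagrangian

theorem mem_fibre {S : FormSpan G₁ G₂} (h : S.IsLagrangian) (x : S.L.Obj) {b : S.L.Arr.Model}
    (hb : b ∈ S.L.algebroid x) : (S.L.anchor x b, diff S.fst.arr (S.L.one x) b,
      diff S.snd.arr (S.L.one x) b) ∈ S.lagrangianFibre x :=
  (h.nondegenerate x).mapsTo hb

theorem exists_of_fibre {S : FormSpan G₁ G₂} (h : S.IsLagrangian) (x : S.L.Obj)
    {v : S.L.Obj.Model} {a₁ : G₁.Arr.Model} {a₂ : G₂.Arr.Model}
    (hv : (v, a₁, a₂) ∈ S.lagrangianFibre x) : ∃ b ∈ S.L.algebroid x, S.L.anchor x b = v ∧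
      diff S.fst.arr (S.L.one x) b = a₁ ∧ diff S.snd.arr (S.L.one x) b = a₂ := by
  obtain ⟨b, hb, e⟩ := (h.nondegenerate x).surjOn hv
  exact ⟨b, hb, congrArg (fun p => p.1) e, congrArg (fun p => p.2.1) e,
    congrArg (fun p => p.2.2) e⟩

variable {x : S₁.L.Obj} {g : G₂.Arr} {y : S₂.L.Obj}

/-- The Lagrangian conditions for `b₁` and `b₂` express `γ₁` and `γ₂` by IM-forms. On vectors
tangent to the fibre product the contributions of `G₂` are those of `Ω_conj` and drop out. -/
theorem γ_conj (h₁ : S₁.IsLagrangian) (h₂ : S₂.IsLagrangian) (el : S₁.snd.obj x = G₂.src g)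
    (er : S₂.fst.obj y = G₂.tgt g) {b₁ : S₁.L.Arr.Model} {b₂ : S₂.L.Arr.Model}
    (hb₁ : b₁ ∈ S₁.L.algebroid x) (hb₂ : b₂ ∈ S₂.L.algebroid y) {u : S₁.L.Obj.Model}
    {z : G₂.Arr.Model} {u' : S₂.L.Obj.Model} (d1 : diff S₁.snd.obj x u = diff G₂.src g z)
    (d2 : diff S₂.fst.obj y u' = diff G₂.tgt g z) :
    S₁.γ x ![S₁.L.anchor x b₁, u] + S₂.γ y ![S₂.L.anchor y b₂, u'] -
      G₂.Ω g ![G₂.conj g (diff S₁.snd.arr (S₁.L.one x) b₁)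
        (diff S₂.fst.arr (S₂.L.one y) b₂), z] =
      G₁.imForm (S₁.fst.obj x) (diff S₁.fst.arr (S₁.L.one x) b₁) (diff S₁.fst.obj x u) -
      G₃.imForm (S₂.snd.obj y) (diff S₂.snd.arr (S₂.L.one y) b₂) (diff S₂.snd.obj y u') := by
  obtain ⟨-, m2, -, -, m5⟩ := h₁.mem_fibre _ hb₁
  obtain ⟨n1, -, -, -, n5⟩ := h₂.mem_fibre _ hb₂
  simp only at m2 m5 n1 n5
  rw [el] at m2 m5
  rw [er] at n1 n5
  rw [m5, n5, QuasiSymplecticGroupoid.Ω_conj m2 n1, d1, d2]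
  ring

/-- Let `a` and `b` be the images of `b₁` and `b₂` in the Lie algebroid of `G₂`. The covector `σ(a)`
kills the image of the leg of `L₁`, `σ(b)` kills that of the leg of `L₂`, and `σ(a) ∘ src_* = σ(b) ∘
tgt_*` because `b · 0_g · a⁻¹ = 0`. Transversality then forces both covectors to vanish; the anchors
vanish too, so `a = b = 0`. -/
theorem eq_zero_of_conj (h₁ : S₁.IsLagrangian) (h₂ : S₂.IsLagrangian)
    (h : S₁.Transverse S₂) (el : S₁.snd.obj x = G₂.src g)
    (er : S₂.fst.obj y = G₂.tgt g) {b₁ : S₁.L.Arr.Model} {b₂ : S₂.L.Arr.Model}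
    (hb₁ : b₁ ∈ S₁.L.algebroid x) (hb₂ : b₂ ∈ S₂.L.algebroid y) (e1 : S₁.L.anchor x b₁ = 0)
    (e2 : S₂.L.anchor y b₂ = 0) (e3 : G₂.conj g (diff S₁.snd.arr (S₁.L.one x) b₁)
        (diff S₂.fst.arr (S₂.L.one y) b₂) = 0) (hf : diff S₁.fst.arr (S₁.L.one x) b₁ = 0)
    (hs : diff S₂.snd.arr (S₂.L.one y) b₂ = 0) : b₁ = 0 ∧ b₂ = 0 := by
  obtain ⟨-, m2, -, m4, m5⟩ := h₁.mem_fibre _ hb₁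
  obtain ⟨n1, -, n3, -, n5⟩ := h₂.mem_fibre _ hb₂
  simp only [e1, e2, hf, hs, map_zero, form₂_zero_left] at m2 m4 m5 n1 n3 n5
  rw [el] at m2 m4 m5
  rw [er] at n1 n3 n5
  obtain ⟨a, ha⟩ : ∃ a, diff S₁.snd.arr (S₁.L.one x) b₁ = a := ⟨_, rfl⟩
  obtain ⟨b, hb⟩ : ∃ b, diff S₂.fst.arr (S₂.L.one y) b₂ = b := ⟨_, rfl⟩
  rw [ha, hb] at e3
  rw [ha] at m2 m4 m5
  rw [hb] at n1 n3 n5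
  have hm : ∀ w, G₂.imBilin (G₂.src g) a (diff S₁.snd.obj x w) = 0 := fun w => by
    have := m5 w
    rwa [← G₁.imBilin_apply, map_zero, LinearMap.zero_apply, zero_sub, eq_comm, neg_eq_zero] at this
  have hn : ∀ w, G₂.imBilin (G₂.tgt g) b (diff S₂.fst.obj y w) = 0 := fun w => by
    have := n5 w
    rwa [← G₃.imBilin_apply, map_zero, LinearMap.zero_apply, sub_zero, eq_comm] at this
  have hz : ∀ z, G₂.imBilin (G₂.tgt g) b (diff G₂.tgt g z) =
      G₂.imBilin (G₂.src g) a (diff G₂.src g z) := fun z => by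
    have := QuasiSymplecticGroupoid.Ω_conj m2 n1 z
    rw [e3, form₂_zero_left] at this
    exact sub_eq_zero.1 this.symm
  -- The variables `α` and `β` are independent, so putting either of them equal to zero makes the
  -- other side vanish.
  have key : ∀ α β, G₂.imBilin (G₂.src g) a α = G₂.imBilin (G₂.tgt g) b β := fun α β => by
    obtain ⟨u, z, v, rfl, rfl⟩ := h x g y el er α β
    rw [map_add, map_add, hm, hn, hz]
  have ha0 := G₂.eq_zero_of_imForm m2 m4.symm fun w => (key w 0).trans (map_zero _)
  have hb0 := G₂.eq_zero_of_imForm n1 n3.symm fun w => (key 0 w).symm.trans (map_zero _)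
  exact ⟨h₁.eq_zero _ hb₁ e1 hf (ha.trans ha0), h₂.eq_zero _ hb₂ e2 (hb.trans hb0) hs⟩

/-- A Lagrange multiplier argument. The equation `c5` holds on the vectors tangent to the fibre
product, which is cut out by two equations in the tangent spaces of the objects of `G₂`. The
multipliers of these equations are the covectors `σ(a)` and `σ(b)` of the sought elements of the Lie
algebroid of `G₂`. -/
theorem exists_conj (h₁ : S₁.IsLagrangian) (h₂ : S₂.IsLagrangian)
    (h : S₁.Transverse S₂) (el : S₁.snd.obj x = G₂.src g)
    (er : S₂.fst.obj y = G₂.tgt g) {v₁ : S₁.L.Obj.Model} {w : G₂.Arr.Model}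
    {v₂ : S₂.L.Obj.Model} {a₁ : G₁.Arr.Model} {a₃ : G₃.Arr.Model}
    (d1 : diff S₁.snd.obj x v₁ = diff G₂.src g w) (d2 : diff S₂.fst.obj y v₂ = diff G₂.tgt g w)
    (c1 : a₁ ∈ G₁.algebroid (S₁.fst.obj x)) (c2 : a₃ ∈ G₃.algebroid (S₂.snd.obj y))
    (c3 : diff S₁.fst.obj x v₁ = G₁.anchor (S₁.fst.obj x) a₁)
    (c4 : diff S₂.snd.obj y v₂ = G₃.anchor (S₂.snd.obj y) a₃)
    (c5 : ∀ u z u', diff S₁.snd.obj x u = diff G₂.src g z → diff S₂.fst.obj y u' = diff G₂.tgt g z →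
      S₁.γ x ![v₁, u] + S₂.γ y ![v₂, u'] - G₂.Ω g ![w, z] =
        G₁.imForm (S₁.fst.obj x) a₁ (diff S₁.fst.obj x u) -
        G₃.imForm (S₂.snd.obj y) a₃ (diff S₂.snd.obj y u')) :
    ∃ b₁ ∈ S₁.L.algebroid x, ∃ b₂ ∈ S₂.L.algebroid y, S₁.L.anchor x b₁ = v₁ ∧
      S₂.L.anchor y b₂ = v₂ ∧ G₂.conj g (diff S₁.snd.arr (S₁.L.one x) b₁)
        (diff S₂.fst.arr (S₂.L.one y) b₂) = w ∧
      diff S₁.fst.arr (S₁.L.one x) b₁ = a₁ ∧ diff S₂.snd.arr (S₂.L.one y) b₂ = a₃ := by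
  let X := S₁.L.Obj.Model
  let Z := G₂.Arr.Model
  let Y := S₂.L.Obj.Model
  let pX : (X × Z × Y) →ₗ[𝕜] X := LinearMap.fst 𝕜 X (Z × Y)
  let pZ : (X × Z × Y) →ₗ[𝕜] Z := LinearMap.fst 𝕜 Z Y ∘ₗ LinearMap.snd 𝕜 X (Z × Y)
  let pY : (X × Z × Y) →ₗ[𝕜] Y := LinearMap.snd 𝕜 Z Y ∘ₗ LinearMap.snd 𝕜 X (Z × Y)
  -- Up to the sign of the middle component, the kernel of `F` is the tangent space of the fibre
  -- product; transversality says that `F` is onto.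
  let F : (X × Z × Y) →ₗ[𝕜] G₂.Obj.Model × G₂.Obj.Model :=
    ((diff S₁.snd.obj x).toLinearMap ∘ₗ pX +
      (diff G₂.src g).toLinearMap ∘ₗ pZ).prod
    ((diff S₂.fst.obj y).toLinearMap ∘ₗ pY +
      (diff G₂.tgt g).toLinearMap ∘ₗ pZ)
  have hF : Function.Surjective F := by
    rintro ⟨α, β⟩
    obtain ⟨u, z, u', e1, e2⟩ := h x g y el er α β
    exact ⟨(u, z, u'), Prod.ext e1 e2⟩
  -- The failure of `c5`, extended to all triples, with the sign of the term in `Ω₂` matching the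
  -- sign convention of `F`.
  let l : (X × Z × Y) →ₗ[𝕜] 𝕜 :=
    (G₁.imBilin (S₁.fst.obj x) a₁ ∘ₗ (diff S₁.fst.obj x).toLinearMap -
      bilin₂ (S₁.γ x) v₁) ∘ₗ pX -
    (G₃.imBilin (S₂.snd.obj y) a₃ ∘ₗ (diff S₂.snd.obj y).toLinearMap +
      bilin₂ (S₂.γ y) v₂) ∘ₗ pY - bilin₂ (G₂.Ω g) w ∘ₗ pZ
  have hl : ∀ u z u', l (u, z, u') =
      (G₁.imForm (S₁.fst.obj x) a₁ (diff S₁.fst.obj x u) -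
        S₁.γ x ![v₁, u]) -
      (G₃.imForm (S₂.snd.obj y) a₃ (diff S₂.snd.obj y u') +
        S₂.γ y ![v₂, u']) - G₂.Ω g ![w, z] := fun _ _ _ => rfl
  obtain ⟨m, hm⟩ := exists_descent F hF l (by
    rintro ⟨u, z, u'⟩ hk
    have k1 : diff S₁.snd.obj x u + diff G₂.src g z = 0 := congrArg Prod.fst hk
    have k2 : diff S₂.fst.obj y u' + diff G₂.tgt g z = 0 := congrArg Prod.snd hk
    have c := c5 u (-z) u' (by rw [map_neg]; exact eq_neg_of_add_eq_zero_left k1)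
      (by rw [map_neg]; exact eq_neg_of_add_eq_zero_left k2)
    rw [form₂_swap (G₂.Ω g) w, form₂_neg_left, form₂_swap (G₂.Ω g) z] at c
    rw [hl]
    linear_combination -c)
  have hm' : ∀ u z u', m (diff S₁.snd.obj x u + diff G₂.src g z,
      diff S₂.fst.obj y u' + diff G₂.tgt g z) = l (u, z, u') :=
    fun u z u' => hm (u, z, u')
  have i0 : ∀ (G : QuasiSymplecticGroupoid.{u} 𝕜) (x : G.Obj) a, G.imForm x a 0 = 0 :=
    fun G x a => by rw [← G.imBilin_apply, map_zero]
  have i1 : ∀ α, (m ∘ₗ LinearMap.inl 𝕜 G₂.Obj.Model G₂.Obj.Model) α = m (α, 0) := fun _ => rfl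
  have i2 : ∀ β, (-(m ∘ₗ LinearMap.inr 𝕜 G₂.Obj.Model G₂.Obj.Model)) β = -m (0, β) :=
    fun _ => rfl
  -- On triples `(0, z, 0)` the factorization of `l` through `F` says that the contraction of `w`
  -- with `Ω₂` is a combination of the multipliers, pulled back along source and target.
  obtain ⟨a, ha, b, hb, hab, hξ, hη⟩ := G₂.exists_conj g w
    (m ∘ₗ LinearMap.inl 𝕜 _ _) (-(m ∘ₗ LinearMap.inr 𝕜 _ _)) (by
      intro z
      have e := hm' 0 z 0
      rw [hl] at e
      simp only [map_zero, form₂_zero_right, i0, zero_add, sub_zero, zero_sub, add_zero] at e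
      rw [← e, i1, i2, sub_neg_eq_add, ← map_add, Prod.mk_add_mk, add_zero, zero_add])
  have hρa := QuasiSymplecticGroupoid.diff_src_conj ha hb
  have hρb := QuasiSymplecticGroupoid.diff_tgt_conj ha hb
  rw [hab] at hρa hρb
  -- On triples `(u, 0, 0)` the factorization is the Lagrangian condition for `(v₁, a₁, a)`; below,
  -- triples `(0, 0, u)` give that for `(v₂, b, a₃)`.
  obtain ⟨b₁, hb₁, p1, p2, p3⟩ := h₁.exists_of_fibre x (v := v₁) (a₁ := a₁) (a₂ := a) (by
    refine ⟨c1, by rw [el]; exact ha, c3, by rw [el]; exact d1.trans hρa, fun u => ?_⟩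
    simp only
    rw [el, hξ, i1]
    have e := hm' u 0 0
    rw [hl] at e
    simp only [map_zero, form₂_zero_right, i0, sub_zero, add_zero] at e
    rw [e]
    ring)
  obtain ⟨b₂, hb₂, q1, q2, q3⟩ := h₂.exists_of_fibre y (v := v₂) (a₁ := b) (a₂ := a₃) (by
    refine ⟨by rw [er]; exact hb, c2, by rw [er]; exact d2.trans hρb, c4, fun u => ?_⟩
    simp only
    rw [er, hη, i2]
    have e := hm' 0 0 u
    rw [hl] at e
    simp only [map_zero, form₂_zero_right, i0, sub_zero, zero_sub, add_zero] at e
    rw [e]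
    ring)
  exact ⟨b₁, hb₁, b₂, hb₂, p1, q1, by rw [p3, q2, hab], p2, q3⟩

end IsLagrangian

variable (h : S₁.Transverse S₂) (q : hfObj S₁.snd S₂.fst h)

/-- The chain rule, bringing the condition to the components of tangent vectors at `x`, `g` and `y`,
where `γ_conj` and `exists_conj` apply. -/
theorem mem_comp_fibre {v : (hfObj S₁.snd S₂.fst h).Model} {a₁ : G₁.Arr.Model}
    {a₃ : G₃.Arr.Model} : (v, a₁, a₃) ∈ (S₁.comp S₂ h).lagrangianFibre q ↔
      a₁ ∈ G₁.algebroid (S₁.fst.obj (fLeft q)) ∧ a₃ ∈ G₃.algebroid (S₂.snd.obj (fRight q)) ∧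
      diff S₁.fst.obj (fLeft q) (diff (fun q : hfObj S₁.snd S₂.fst h => fLeft q) q v) =
        G₁.anchor (S₁.fst.obj (fLeft q)) a₁ ∧
      diff S₂.snd.obj (fRight q) (diff (fun q : hfObj S₁.snd S₂.fst h => fRight q) q v) =
        G₃.anchor (S₂.snd.obj (fRight q)) a₃ ∧
      ∀ w, S₁.γ (fLeft q) ![diff (fun q : hfObj S₁.snd S₂.fst h => fLeft q) q v,
          diff (fun q : hfObj S₁.snd S₂.fst h => fLeft q) q w] +
        S₂.γ (fRight q) ![diff (fun q : hfObj S₁.snd S₂.fst h => fRight q) q v,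
          diff (fun q : hfObj S₁.snd S₂.fst h => fRight q) q w] -
        G₂.Ω (fMid q) ![diff (fun q : hfObj S₁.snd S₂.fst h => fMid q) q v,
          diff (fun q : hfObj S₁.snd S₂.fst h => fMid q) q w] =
        G₁.imForm (S₁.fst.obj (fLeft q)) a₁
          (diff S₁.fst.obj (fLeft q) (diff (fun q : hfObj S₁.snd S₂.fst h => fLeft q) q w)) -
        G₃.imForm (S₂.snd.obj (fRight q)) a₃
          (diff S₂.snd.obj (fRight q)
            (diff (fun q : hfObj S₁.snd S₂.fst h => fRight q) q w)) := by
  have e1 := diff_comp S₁.fst.smooth_obj (smooth_left (ht := h)) q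
  have e2 := diff_comp S₂.snd.smooth_obj (smooth_right (ht := h)) q
  have e3 : ∀ w, (S₁.comp S₂ h).γ q ![v, w] = _ := fun w =>
    congrArg₂ (· - ·) (congrArg₂ (· + ·)
      (pullback_apply₂ (fun q : hfObj S₁.snd S₂.fst h => fLeft q) S₁.γ q v w)
      (pullback_apply₂ (fun q : hfObj S₁.snd S₂.fst h => fRight q) S₂.γ q v w))
      (pullback_apply₂ (fun q : hfObj S₁.snd S₂.fst h => fMid q) G₂.Ω q v w)
  constructor
  · rintro ⟨c1, c2, c3, c4, c5⟩
    refine ⟨c1, c2, (e1 v).symm.trans c3, (e2 v).symm.trans c4, fun w => ?_⟩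
    refine ((e3 w).symm.trans (c5 w)).trans ?_
    exact congrArg₂ (fun α β => G₁.imForm (S₁.fst.obj (fLeft q)) a₁ α -
        G₃.imForm (S₂.snd.obj (fRight q)) a₃ β) (e1 w) (e2 w)
  · rintro ⟨c1, c2, c3, c4, c5⟩
    refine ⟨c1, c2, (e1 v).trans c3, (e2 v).trans c4, fun w => ?_⟩
    refine ((e3 w).trans (c5 w)).trans ?_
    exact congrArg₂ (fun α β => G₁.imForm (S₁.fst.obj (fLeft q)) a₁ α -
        G₃.imForm (S₂.snd.obj (fRight q)) a₃ β) (e1 w).symm (e2 w).symm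

theorem comp_fst_arr (b : (hfArr S₁.snd S₂.fst h).Model) :
    diff (S₁.comp S₂ h).fst.arr ((S₁.comp S₂ h).L.one q) b =
      diff S₁.fst.arr (S₁.L.one (fLeft q))
        (diff (fun r : hfArr S₁.snd S₂.fst h => fLeft r) (hfOne q) b) :=
  diff_comp S₁.fst.smooth_arr smooth_left (hfOne q) b

theorem comp_snd_arr (b : (hfArr S₁.snd S₂.fst h).Model) :
    diff (S₁.comp S₂ h).snd.arr ((S₁.comp S₂ h).L.one q) b =
      diff S₂.snd.arr (S₂.L.one (fRight q))
        (diff (fun r : hfArr S₁.snd S₂.fst h => fRight r) (hfOne q) b) :=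
  diff_comp S₂.snd.smooth_arr smooth_right (hfOne q) b

namespace IsLagrangian

theorem comp_mapsTo (h₁ : S₁.IsLagrangian) (h₂ : S₂.IsLagrangian)
    {b : (hfArr S₁.snd S₂.fst h).Model} (hb : b ∈ (hfGroupoid S₁.snd S₂.fst h).algebroid q) :
    ((hfGroupoid S₁.snd S₂.fst h).anchor q b,
      diff S₁.fst.arr (S₁.L.one (fLeft q))
        (diff (fun r : hfArr S₁.snd S₂.fst h => fLeft r) (hfOne q) b),
      diff S₂.snd.arr (S₂.L.one (fRight q))
        (diff (fun r : hfArr S₁.snd S₂.fst h => fRight r) (hfOne q) b)) ∈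
      (S₁.comp S₂ h).lagrangianFibre q := by
  obtain ⟨hb₁, -, hb₂⟩ := (mem_hf_algebroid q b).1 hb
  obtain ⟨m1, -, m3, -, -⟩ := h₁.mem_fibre _ hb₁
  obtain ⟨-, n2, -, n4, -⟩ := h₂.mem_fibre _ hb₂
  have e1 := hf_anchor_left q b
  have e2 := hf_anchor_right q b
  have e3 := FormSpan.hf_anchor_mid q hb
  refine (mem_comp_fibre h q).2 ⟨m1, n2, (congrArg _ e1).trans m3, (congrArg _ e2).trans n4,
    fun w => ?_⟩
  refine Eq.trans ?_ (h₁.γ_conj h₂ (fLeft_eq q) (fRight_eq q) hb₁ hb₂ (diff_fLeft_eq q w)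
    (diff_fRight_eq q w))
  exact congrArg₂ (· - ·) (congrArg₂ (· + ·)
    (congrArg (fun v => S₁.γ (fLeft q)
      ![v, diff (fun q : hfObj S₁.snd S₂.fst h => fLeft q) q w]) e1)
    (congrArg (fun v => S₂.γ (fRight q)
      ![v, diff (fun q : hfObj S₁.snd S₂.fst h => fRight q) q w]) e2))
    (congrArg (fun v => G₂.Ω (fMid q)
      ![v, diff (fun q : hfObj S₁.snd S₂.fst h => fMid q) q w]) e3)

theorem comp_eq_zero (h₁ : S₁.IsLagrangian) (h₂ : S₂.IsLagrangian)
    {b : (hfArr S₁.snd S₂.fst h).Model} (hb : b ∈ (hfGroupoid S₁.snd S₂.fst h).algebroid q)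
    (h0 : (hfGroupoid S₁.snd S₂.fst h).anchor q b = 0)
    (hf : diff S₁.fst.arr (S₁.L.one (fLeft q))
        (diff (fun r : hfArr S₁.snd S₂.fst h => fLeft r) (hfOne q) b) = 0)
    (hs : diff S₂.snd.arr (S₂.L.one (fRight q))
        (diff (fun r : hfArr S₁.snd S₂.fst h => fRight r) (hfOne q) b) = 0) : b = 0 := by
  obtain ⟨hb₁, hb₀, hb₂⟩ := (mem_hf_algebroid q b).1 hb
  obtain ⟨z1, z2⟩ := h₁.eq_zero_of_conj h₂ h (fLeft_eq q) (fRight_eq q) hb₁ hb₂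
    ((hf_anchor_left q b).symm.trans ((congrArg _ h0).trans (map_zero _)))
    ((hf_anchor_right q b).symm.trans ((congrArg _ h0).trans (map_zero _)))
    ((FormSpan.hf_anchor_mid q hb).symm.trans ((congrArg _ h0).trans (map_zero _))) hf hs
  exact arrFibre_tangent_ext (hfOne q) (z1.trans (map_zero _).symm) (hb₀.trans (map_zero _).symm)
    (z2.trans (map_zero _).symm)

theorem comp_exists (h₁ : S₁.IsLagrangian) (h₂ : S₂.IsLagrangian)
    {v : (hfObj S₁.snd S₂.fst h).Model} {a₁ : G₁.Arr.Model}
    {a₃ : G₃.Arr.Model} (hv : (v, a₁, a₃) ∈ (S₁.comp S₂ h).lagrangianFibre q) :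
    ∃ b ∈ (hfGroupoid S₁.snd S₂.fst h).algebroid q,
      (hfGroupoid S₁.snd S₂.fst h).anchor q b = v ∧
      diff S₁.fst.arr (S₁.L.one (fLeft q))
        (diff (fun r : hfArr S₁.snd S₂.fst h => fLeft r) (hfOne q) b) = a₁ ∧
      diff S₂.snd.arr (S₂.L.one (fRight q))
        (diff (fun r : hfArr S₁.snd S₂.fst h => fRight r) (hfOne q) b) = a₃ := by
  obtain ⟨c1, c2, c3, c4, c5⟩ := (mem_comp_fibre h q).1 hv
  obtain ⟨b₁, hb₁, b₂, hb₂, p1, p2, p3, p4, p5⟩ := h₁.exists_conj h₂ h (fLeft_eq q) (fRight_eq q)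
    (diff_fLeft_eq q v) (diff_fRight_eq q v) c1 c2 c3 c4 (by
      intro u z u' d1 d2
      obtain ⟨k, rfl, rfl, rfl⟩ := arrFibre_tangent_exists q u z u' d1 d2
      exact c5 k)
  obtain ⟨k, hk, rfl, rfl⟩ := exists_hf_algebroid q hb₁ hb₂
  exact ⟨k, hk, arrFibre_tangent_ext q ((hf_anchor_left q k).trans p1)
    ((FormSpan.hf_anchor_mid q hk).trans p3) ((hf_anchor_right q k).trans p2), p4, p5⟩

/-- The composition of transverse 1-shifted Lagrangian correspondences is a 1-shifted Lagrangian
correspondence. -/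
theorem comp (h₁ : S₁.IsLagrangian) (h₂ : S₂.IsLagrangian) : (S₁.comp S₂ h).IsLagrangian where
  smooth_γ := h₁.comp_smooth_γ h₂ h
  pullback_Ω := h₁.comp_pullback_Ω h₂ h
  pullback_Φ := h₁.comp_pullback_Φ h₂ h
  nondegenerate q := by
    have hfs : ∀ b, (diff (S₁.comp S₂ h).fst.arr ((S₁.comp S₂ h).L.one q) b,
        diff (S₁.comp S₂ h).snd.arr ((S₁.comp S₂ h).L.one q) b) = _ := fun b =>
      congrArg₂ Prod.mk (comp_fst_arr h q b) (comp_snd_arr h q b)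
    refine ⟨fun b hb => ?_, fun b hb b' hb' e => ?_, ?_⟩
    · exact Set.mem_of_eq_of_mem
        (congrArg (Prod.mk ((S₁.comp S₂ h).L.anchor q b)) (hfs b)) (h₁.comp_mapsTo h q h₂ hb)
    · have e1 := congrArg (fun p => p.1) e
      have e2 := congrArg (fun p => p.2.1) e
      have e3 := congrArg (fun p => p.2.2) e
      simp only at e1 e2 e3
      refine sub_eq_zero.1 (h₁.comp_eq_zero h q h₂ (b := b - b')
        (((S₁.comp S₂ h).L.algebroid q).sub_mem hb hb') ?_ ?_ ?_)
      · exact (map_sub ((S₁.comp S₂ h).L.anchor q) b b').trans (sub_eq_zero.2 e1)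
      · exact (comp_fst_arr h q (b - b')).symm.trans ((map_sub _ b b').trans (sub_eq_zero.2 e2))
      · exact (comp_snd_arr h q (b - b')).symm.trans ((map_sub _ b b').trans (sub_eq_zero.2 e3))
    · rintro ⟨v, a₁, a₃⟩ hv
      obtain ⟨b, hb, e1, e2, e3⟩ := h₁.comp_exists h q h₂ hv
      exact ⟨b, hb, Prod.ext e1 ((hfs b).trans (Prod.ext e2 e3))⟩

end IsLagrangian

end FormSpan

end ShiftedSymplectic

namespace ShiftedSymplectic

variable {𝕜 : Type v} [RCLike 𝕜]

theorem smooth_arrFibreMk {G : LieGroupoid.{u} 𝕜} {X Y N : Mfd.{u} 𝕜} {μ : X → G.Obj}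
    {ν : Y → G.Obj} {hμ : Smooth μ} {hν : Smooth ν} {ht : ArrTransverse G μ ν} {x : N → X}
    {g : N → G.Arr} {y : N → Y} (hx : Smooth x) (hg : Smooth g) (hy : Smooth y)
    (h1 : ∀ z, μ (x z) = G.src (g z)) (h2 : ∀ z, ν (y z) = G.tgt (g z)) :
    Smooth (fun z => arrFibreMk hμ hν ht (x z) (g z) (y z) (h1 z) (h2 z)) := by
  rw [Smooth, ← contMDiffOn_univ]
  exact arrFibre_lift hx.contMDiffOn hg.contMDiffOn hy.contMDiffOn

namespace LieGroupoid

/-! ### Morita morphisms -/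

namespace Hom.IsMorita

variable {H G : LieGroupoid.{u} 𝕜} {F : H.Hom G}

theorem surjective (hF : F.IsMorita) : Function.Surjective F.obj := hF.1

theorem submersive (hF : F.IsMorita) : Submersive F.obj := hF.2.choose

theorem arr_ext (hF : F.IsMorita) {h h' : H.Arr} (hs : H.src h = H.src h')
    (ht : H.tgt h = H.tgt h') (ha : F.arr h = F.arr h') : h = h' := by
  obtain ⟨-, hsub, k, -, hk, -⟩ := hF
  exact hk.injective (arrFibre_ext hs ha ht)

/-- Full faithfulness in smooth families: the triple `(x, g, y)` is a smooth map to the arrows of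
the pullback groupoid, which are those of `H`. -/
theorem exists_smooth_arr (hF : F.IsMorita) {N : Mfd.{u} 𝕜} {x y : N → H.Obj} {g : N → G.Arr}
    (hx : Smooth x) (hy : Smooth y) (hg : Smooth g) (es : ∀ z, G.src (g z) = F.obj (x z))
    (et : ∀ z, G.tgt (g z) = F.obj (y z)) : ∃ h : N → H.Arr, Smooth h ∧
      (∀ z, H.src (h z) = x z) ∧ (∀ z, H.tgt (h z) = y z) ∧ ∀ z, F.arr (h z) = g z := by
  obtain ⟨-, hsub, k, hks, -, hk⟩ := hF
  have e := fun z => hk (arrFibreMk F.smooth_obj F.smooth_obj (hsub.arrTransverse hsub)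
    (x z) (g z) (y z) (es z).symm (et z).symm)
  exact ⟨_, hks.comp (smooth_arrFibreMk hx hg hy (fun z => (es z).symm) fun z => (et z).symm),
    fun z => congrArg fLeft (e z), fun z => congrArg fRight (e z), fun z => congrArg fMid (e z)⟩

theorem exists_arr (hF : F.IsMorita) {x y : H.Obj} {g : G.Arr}
    (es : G.src g = F.obj x) (et : G.tgt g = F.obj y) :
    ∃ h : H.Arr, H.src h = x ∧ H.tgt h = y ∧ F.arr h = g := by
  obtain ⟨-, hsub, k, hks, -, hk⟩ := hF
  have e := hk (arrFibreMk F.smooth_obj F.smooth_obj (hsub.arrTransverse hsub)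
    x g y es.symm et.symm)
  exact ⟨_, congrArg fLeft e, congrArg fRight e, congrArg fMid e⟩

/-- Infinitesimal fullness. The triple `(a, z, b)` is tangent to the arrows of the pullback
groupoid, and the differential of the inverse diffeomorphism carries it to `H`. -/
theorem exists_tangent (hF : F.IsMorita) {h : H.Arr} {a b : H.Obj.Model} {z : G.Arr.Model}
    (ha : diff G.src (F.arr h) z = diff F.obj (H.src h) a)
    (hb : diff G.tgt (F.arr h) z = diff F.obj (H.tgt h) b) :
    ∃ w, diff H.src h w = a ∧ diff H.tgt h w = b := by
  obtain ⟨-, hsub, k, hks, hkl, hk⟩ := hF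
  obtain ⟨κ, k1, -, k3⟩ := arrFibre_tangent_exists (F.toPullback hsub h) a z b ha.symm hb.symm
  have hh : k (F.toPullback hsub h) = h := hkl h
  refine ⟨diff k (F.toPullback hsub h) κ, ?_, ?_⟩
  · have e := diff_comp H.smooth_src hks (F.toPullback hsub h) κ
    rw [hh] at e
    refine e.symm.trans (Eq.trans ?_ k1)
    rw [show (fun y => H.src (k y)) = fLeft from funext fun y => congrArg fLeft (hk y)]
  · have e := diff_comp H.smooth_tgt hks (F.toPullback hsub h) κ
    rw [hh] at e
    refine e.symm.trans (Eq.trans ?_ k3)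
    rw [show (fun y => H.tgt (k y)) = fRight from funext fun y => congrArg fRight (hk y)]

/-- Since an arrow of `H` is determined by its endpoints and its image, a smooth right inverse `k`
of the canonical map is also a left inverse. -/
theorem of_faithful (hs : Function.Surjective F.obj) (hsub : Submersive F.obj)
    (hinj : ∀ h h', H.src h = H.src h' → H.tgt h = H.tgt h' → F.arr h = F.arr h' → h = h')
    (k : arrFibre (G := G) F.smooth_obj F.smooth_obj (hsub.arrTransverse hsub) → H.Arr)
    (hk : Smooth k) (k1 : ∀ p, H.src (k p) = fLeft p) (k2 : ∀ p, H.tgt (k p) = fRight p)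
    (k3 : ∀ p, F.arr (k p) = fMid p) : F.IsMorita :=
  ⟨hs, hsub, k, hk, fun _ => hinj _ _ (k1 _) (k2 _) (k3 _),
    fun p => arrFibre_ext (k1 p) (k3 p) (k2 p)⟩

end Hom.IsMorita

/-! ### Products of three arrows -/

section Triple

variable {G : LieGroupoid.{u} 𝕜} {N : Mfd.{u} 𝕜}

theorem src_mul_mul {p q r : G.Arr} (h1 : G.src p = G.tgt q) (h2 : G.src q = G.tgt r) :
    G.src (G.mul (G.mul p q) r) = G.src r :=
  G.src_mul _ _ ((G.src_mul _ _ h1).trans h2)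

theorem tgt_mul_mul {p q r : G.Arr} (h1 : G.src p = G.tgt q) (h2 : G.src q = G.tgt r) :
    G.tgt (G.mul (G.mul p q) r) = G.tgt p :=
  (G.tgt_mul _ _ ((G.src_mul _ _ h1).trans h2)).trans (G.tgt_mul _ _ h1)

theorem smooth_mul_mul {p q r : N → G.Arr} (hp : Smooth p) (hq : Smooth q) (hr : Smooth r)
    (h1 : ∀ z, G.src (p z) = G.tgt (q z)) (h2 : ∀ z, G.src (q z) = G.tgt (r z)) :
    Smooth (fun z => G.mul (G.mul (p z) (q z)) (r z)) :=
  smooth_mul_of (smooth_mul_of hp hq h1) hr fun z => (G.src_mul _ _ (h1 z)).trans (h2 z)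

/-- The witness is the product `a · b · c` in the tangent groupoid. Only its two ends matter for
transversality. -/
theorem exists_tangent_mul_mul {p q r : G.Arr} (h1 : G.src p = G.tgt q) (h2 : G.src q = G.tgt r)
    {a b c : G.Arr.Model} (d1 : diff G.src p a = diff G.tgt q b)
    (d2 : diff G.src q b = diff G.tgt r c) :
    ∃ z, diff G.src (G.mul (G.mul p q) r) z = diff G.src r c ∧
      diff G.tgt (G.mul (G.mul p q) r) z = diff G.tgt p a := by
  have e := (G.src_mul _ _ h1).trans h2
  have d := (diff_src_tmul h1 d1).trans d2
  exact ⟨G.tmul (G.mul p q) r (G.tmul p q a b) c, diff_src_tmul e d,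
    (diff_tgt_tmul e d).trans (diff_tgt_tmul h1 d1)⟩

theorem conj_inv_conj {p q r : G.Arr} (h1 : G.src p = G.tgt q) (h2 : G.src q = G.src r) :
    G.mul (G.mul (G.inv p) (G.mul (G.mul p q) (G.inv r))) r = q := by
  have h3 : G.src (G.mul p q) = G.tgt (G.inv r) := (G.src_mul _ _ h1).trans
    (h2.trans (G.tgt_inv r).symm)
  have h4 : G.src (G.inv p) = G.tgt (G.mul p q) := (G.src_inv p).trans (G.tgt_mul _ _ h1).symm
  rw [← G.mul_assoc _ _ _ h4 h3, G.cancel_left _ _ h1, G.inv_cancel_right _ _ h2]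

theorem conj_conj_inv {p q r : G.Arr} (h1 : G.tgt p = G.tgt q) (h2 : G.src q = G.tgt r) :
    G.mul (G.mul p (G.mul (G.mul (G.inv p) q) r)) (G.inv r) = q := by
  have h0 : G.src (G.inv p) = G.tgt q := (G.src_inv p).trans h1
  have h3 : G.src (G.mul (G.inv p) q) = G.tgt r := (G.src_mul _ _ h0).trans h2
  have h4 : G.src p = G.tgt (G.mul (G.inv p) q) := by
    rw [G.tgt_mul _ _ h0, G.tgt_inv]
  rw [← G.mul_assoc _ _ _ h4 h3, G.cancel_left_inv _ _ h1, G.cancel_right _ _ h2]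

end Triple

end LieGroupoid

open LieGroupoid

/-! ### Homotopy fibre products and Morita morphisms -/

section HFibreMap

variable {M₁ M₂ L₁ L₂ H G : LieGroupoid.{u} 𝕜} {φ : H.Hom G} {μ₁ : L₁.Hom G} {μ₂ : L₂.Hom G}
  {ψ₁ : M₁.Hom L₁} {ψ₂ : M₂.Hom L₂} {ν₁ : M₁.Hom H} {ν₂ : M₂.Hom H}

theorem NatTransf.diff_src_app {F F' : H.Hom G} (θ : NatTransf F F') (x : H.Obj)
    (u : H.Obj.Model) : diff G.src (θ.app x) (diff θ.app x u) = diff F.obj x u := by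
  rw [← diff_comp G.smooth_src θ.smooth_app, funext θ.src_app]

theorem NatTransf.diff_tgt_app {F F' : H.Hom G} (θ : NatTransf F F') (x : H.Obj)
    (u : H.Obj.Model) : diff G.tgt (θ.app x) (diff θ.app x u) = diff F'.obj x u := by
  rw [← diff_comp G.smooth_tgt θ.smooth_app, funext θ.tgt_app]

theorem Hom.diff_comp_obj (F : L₁.Hom G) (F' : M₁.Hom L₁) (x : M₁.Obj) (u : M₁.Obj.Model) :
    diff (F.comp F').obj x u = diff F.obj (F'.obj x) (diff F'.obj x u) :=
  diff_comp F.smooth_obj F'.smooth_obj x u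

/-- Transversality over `G` passes to any `H` with a Morita morphism to `G`. -/
theorem ArrTransverse.lift (θ₁ : NatTransf (μ₁.comp ψ₁) (φ.comp ν₁))
    (θ₂ : NatTransf (μ₂.comp ψ₂) (φ.comp ν₂)) (hφ : φ.IsMorita) (hψ₁ : ψ₁.IsMorita) (hψ₂ : ψ₂.IsMorita)
    (ht : ArrTransverse G μ₁.obj μ₂.obj) : ArrTransverse H ν₁.obj ν₂.obj := by
  intro x h y hx hy a b
  have s1 : G.src (G.inv (θ₂.app y)) = G.tgt (φ.arr h) := by
    rw [G.src_inv, θ₂.tgt_app, φ.tgt_arr, ← hy]; rfl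
  have s2 : G.src (φ.arr h) = G.tgt (θ₁.app x) := by
    rw [θ₁.tgt_app, φ.src_arr, ← hx]; rfl
  -- The arrow of `G` to which transversality is applied is `g = θ₂⁻¹ φ(h) θ₁`; `hg` records `θ₂ g
  -- θ₁⁻¹ = φ(h)`.
  have hg := conj_conj_inv (p := θ₂.app y) (by rw [← s1, G.src_inv]) s2
  have gs := src_mul_mul s1 s2
  have gt := tgt_mul_mul s1 s2
  rw [G.tgt_inv] at gt
  generalize G.mul (G.mul (G.inv (θ₂.app y)) (φ.arr h)) (θ₁.app x) = g at hg gs gt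
  -- Vectors at the arrows `θ₁` and `θ₂` carry `φ_* a` and `φ_* b` from their targets to their
  -- sources, the endpoints of `g`.
  obtain ⟨α, hα⟩ := G.submersive_tgt (θ₁.app x) (diff φ.obj (ν₁.obj x) a)
  obtain ⟨β, hβ⟩ := G.submersive_tgt (θ₂.app y) (diff φ.obj (ν₂.obj y) b)
  obtain ⟨u₀, z, v₀, e1, e2⟩ := ht (ψ₁.obj x) g (ψ₂.obj y) ((θ₁.src_app x).symm.trans gs.symm)
    ((θ₂.src_app y).symm.trans gt.symm) (diff G.src (θ₁.app x) α) (diff G.src (θ₂.app y) β)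
  obtain ⟨u, rfl⟩ := hψ₁.submersive x u₀
  obtain ⟨v, rfl⟩ := hψ₂.submersive y v₀
  rw [← Hom.diff_comp_obj, ← θ₁.diff_src_app] at e1
  rw [← Hom.diff_comp_obj, ← θ₂.diff_src_app] at e2
  have f1 := θ₁.diff_tgt_app x u
  have f2 := θ₂.diff_tgt_app y v
  rw [Hom.diff_comp_obj] at f1 f2
  -- The vector `(β - θ₂_* v) · z · (α - θ₁_* u)⁻¹` at `φ(h)` has source `φ_*(a - ν₁_* u)` and
  -- target `φ_*(b - ν₂_* v)`, so these two ends are joined by a tangent vector of `H` at `h`.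
  obtain ⟨ζ, z1, z2⟩ := exists_tangent_mul_mul (p := θ₂.app y) (q := g) (r := G.inv (θ₁.app x))
    gt.symm (gs.trans (G.tgt_inv _).symm) (a := β - diff θ₂.app y v) (b := z)
    (c := diff G.inv (θ₁.app x) (α - diff θ₁.app x u))
    (by rw [map_sub, ← e2, add_sub_cancel_left])
    (by rw [G.diff_tgt_inv, map_sub, ← e1, add_sub_cancel_left])
  rw [hg, G.diff_src_inv, map_sub, hα, f1, ← map_sub, hx] at z1
  rw [hg, map_sub, hβ, f2, ← map_sub, hy] at z2
  obtain ⟨w, w1, w2⟩ := hφ.exists_tangent z1 z2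
  exact ⟨u, w, v, by rw [w1, add_sub_cancel], by rw [w2, add_sub_cancel]⟩

/-- Transversality over `H` passes to `G` along a Morita morphism `H → G`. -/
theorem ArrTransverse.descend (θ₁ : NatTransf (μ₁.comp ψ₁) (φ.comp ν₁))
    (θ₂ : NatTransf (μ₂.comp ψ₂) (φ.comp ν₂)) (hφ : φ.IsMorita) (hψ₁ : ψ₁.IsMorita) (hψ₂ : ψ₂.IsMorita)
    (ht : ArrTransverse H ν₁.obj ν₂.obj) : ArrTransverse G μ₁.obj μ₂.obj := by
  intro x₀ g y₀ hx hy a₀ b₀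
  obtain ⟨x, rfl⟩ := hψ₁.surjective x₀
  obtain ⟨y, rfl⟩ := hψ₂.surjective y₀
  have s1 : G.src (θ₂.app y) = G.tgt g := (θ₂.src_app y).trans hy
  have s2 : G.src g = G.src (θ₁.app x) := hx.symm.trans (θ₁.src_app x).symm
  have s3 : G.src g = G.tgt (G.inv (θ₁.app x)) := s2.trans (G.tgt_inv _).symm
  have hg := conj_inv_conj s1 s2
  -- The arrow `θ₂ g θ₁⁻¹` has both ends in the image of `φ`, so it lifts to an arrow `h` of `H`.
  obtain ⟨h, h1, h2, h3⟩ := hφ.exists_arr (x := ν₁.obj x) (y := ν₂.obj y)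
    ((src_mul_mul s1 s3).trans ((G.src_inv _).trans (θ₁.tgt_app x)))
    ((tgt_mul_mul s1 s3).trans (θ₂.tgt_app y))
  rw [← h3] at hg
  obtain ⟨α, hα⟩ := G.submersive_src (θ₁.app x) a₀
  obtain ⟨β, hβ⟩ := G.submersive_src (θ₂.app y) b₀
  obtain ⟨a, ha⟩ := hφ.submersive (ν₁.obj x) (diff G.tgt (θ₁.app x) α)
  obtain ⟨b, hb⟩ := hφ.submersive (ν₂.obj y) (diff G.tgt (θ₂.app y) β)
  obtain ⟨u, w, v, e1, e2⟩ := ht x h y h1.symm h2.symm a b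
  have f1 := θ₁.diff_tgt_app x u
  have f2 := θ₂.diff_tgt_app y v
  rw [Hom.diff_comp_obj] at f1 f2
  have k1 : diff G.tgt (θ₁.app x) (α - diff θ₁.app x u) = diff G.src (φ.arr h) (diff φ.arr h w) := by
    rw [map_sub, f1, ← ha, ← map_sub, ← e1, add_sub_cancel_left, ← diff_comp G.smooth_src
      φ.smooth_arr, funext φ.src_arr, diff_comp φ.smooth_obj H.smooth_src, h1]
  have k2 : diff G.tgt (θ₂.app y) (β - diff θ₂.app y v) = diff G.tgt (φ.arr h) (diff φ.arr h w) := by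
    rw [map_sub, f2, ← hb, ← map_sub, ← e2, add_sub_cancel_left, ← diff_comp G.smooth_tgt
      φ.smooth_arr, funext φ.tgt_arr, diff_comp φ.smooth_obj H.smooth_tgt, h2]
  -- The required vector at `g` is `(β - θ₂_* v)⁻¹ · φ_* w · (α - θ₁_* u)`.
  obtain ⟨z, z1, z2⟩ := exists_tangent_mul_mul (p := G.inv (θ₂.app y)) (q := φ.arr h)
    (r := θ₁.app x) (by rw [G.src_inv, θ₂.tgt_app, φ.tgt_arr, h2]; rfl)
    (by rw [θ₁.tgt_app, φ.src_arr, h1]; rfl)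
    (a := diff G.inv (θ₂.app y) (β - diff θ₂.app y v)) (b := diff φ.arr h w)
    (c := α - diff θ₁.app x u) (by rw [G.diff_src_inv, k2]) k1.symm
  rw [hg, map_sub, hα, θ₁.diff_src_app, Hom.diff_comp_obj] at z1
  rw [hg, G.diff_tgt_inv, map_sub, hβ, θ₂.diff_src_app, Hom.diff_comp_obj] at z2
  exact ⟨diff ψ₁.obj x u, z, diff ψ₂.obj y v, by rw [z1, add_sub_cancel],
    by rw [z2, add_sub_cancel]⟩

end HFibreMap

end ShiftedSymplectic

namespace ShiftedSymplectic

variable {𝕜 : Type v} [RCLike 𝕜]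

open LieGroupoid

/-! ### Twisting arrows by natural transformations -/

section Twist

variable {M₁ M₂ G : LieGroupoid.{u} 𝕜} {F₁ F₁' : M₁.Hom G} {F₂ F₂' : M₂.Hom G}
  (θ₁ : NatTransf F₁ F₁') (θ₂ : NatTransf F₂ F₂')

/-- For `g : F₁' x → F₂' y`, the arrow `θ₂⁻¹ g θ₁ : F₁ x → F₂ y`. -/
def twist (x : M₁.Obj) (g : G.Arr) (y : M₂.Obj) : G.Arr :=
  G.mul (G.mul (G.inv (θ₂.app y)) g) (θ₁.app x)

/-- For `g : F₁ x → F₂ y`, the arrow `θ₂ g θ₁⁻¹ : F₁' x → F₂' y`. -/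
def untwist (x : M₁.Obj) (g : G.Arr) (y : M₂.Obj) : G.Arr :=
  G.mul (G.mul (θ₂.app y) g) (G.inv (θ₁.app x))

variable {θ₁ θ₂} {x : M₁.Obj} {g g' : G.Arr} {y : M₂.Obj} {N : Mfd.{u} 𝕜}

theorem twist_left (h : F₂'.obj y = G.tgt g) : G.src (G.inv (θ₂.app y)) = G.tgt g :=
  (G.src_inv _).trans ((θ₂.tgt_app y).trans h)

theorem twist_right (h : F₁'.obj x = G.src g) : G.src g = G.tgt (θ₁.app x) :=
  h.symm.trans (θ₁.tgt_app x).symm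

theorem untwist_left (h : F₂.obj y = G.tgt g) : G.src (θ₂.app y) = G.tgt g :=
  (θ₂.src_app y).trans h

theorem untwist_right (h : F₁.obj x = G.src g) : G.src g = G.tgt (G.inv (θ₁.app x)) :=
  h.symm.trans ((θ₁.src_app x).symm.trans (G.tgt_inv _).symm)

theorem src_twist (h₁ : F₁'.obj x = G.src g) (h₂ : F₂'.obj y = G.tgt g) :
    F₁.obj x = G.src (twist θ₁ θ₂ x g y) :=
  ((src_mul_mul (twist_left h₂) (twist_right h₁)).trans (θ₁.src_app x)).symm

theorem tgt_twist (h₁ : F₁'.obj x = G.src g) (h₂ : F₂'.obj y = G.tgt g) :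
    F₂.obj y = G.tgt (twist θ₁ θ₂ x g y) :=
  ((tgt_mul_mul (twist_left h₂) (twist_right h₁)).trans
    ((G.tgt_inv _).trans (θ₂.src_app y))).symm

theorem src_untwist (h₁ : F₁.obj x = G.src g) (h₂ : F₂.obj y = G.tgt g) :
    G.src (untwist θ₁ θ₂ x g y) = F₁'.obj x :=
  (src_mul_mul (untwist_left h₂) (untwist_right h₁)).trans ((G.src_inv _).trans (θ₁.tgt_app x))

theorem tgt_untwist (h₁ : F₁.obj x = G.src g) (h₂ : F₂.obj y = G.tgt g) :
    G.tgt (untwist θ₁ θ₂ x g y) = F₂'.obj y :=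
  (tgt_mul_mul (untwist_left h₂) (untwist_right h₁)).trans (θ₂.tgt_app y)

theorem twist_untwist (h₁ : F₁.obj x = G.src g) (h₂ : F₂.obj y = G.tgt g) :
    twist θ₁ θ₂ x (untwist θ₁ θ₂ x g y) y = g :=
  conj_inv_conj (untwist_left h₂) (h₁.symm.trans (θ₁.src_app x).symm)

theorem untwist_twist (h₁ : F₁'.obj x = G.src g) (h₂ : F₂'.obj y = G.tgt g) :
    untwist θ₁ θ₂ x (twist θ₁ θ₂ x g y) y = g :=
  conj_conj_inv ((θ₂.tgt_app y).trans h₂) (twist_right h₁)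

theorem twist_injective (h₁ : F₁'.obj x = G.src g) (h₂ : F₂'.obj y = G.tgt g)
    (h₁' : F₁'.obj x = G.src g') (h₂' : F₂'.obj y = G.tgt g')
    (h : twist θ₁ θ₂ x g y = twist θ₁ θ₂ x g' y) : g = g' := by
  rw [← untwist_twist (θ₁ := θ₁) (θ₂ := θ₂) h₁ h₂, h, untwist_twist h₁' h₂']

theorem smooth_twist {x : N → M₁.Obj} {g : N → G.Arr} {y : N → M₂.Obj} (hx : Smooth x)
    (hg : Smooth g) (hy : Smooth y) (h₁ : ∀ z, F₁'.obj (x z) = G.src (g z))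
    (h₂ : ∀ z, F₂'.obj (y z) = G.tgt (g z)) :
    Smooth (fun z => twist θ₁ θ₂ (x z) (g z) (y z)) :=
  smooth_mul_mul (G.smooth_inv.comp (θ₂.smooth_app.comp hy)) hg (θ₁.smooth_app.comp hx)
    (fun z => twist_left (h₂ z)) fun z => twist_right (h₁ z)

theorem smooth_untwist {x : N → M₁.Obj} {g : N → G.Arr} {y : N → M₂.Obj} (hx : Smooth x)
    (hg : Smooth g) (hy : Smooth y) (h₁ : ∀ z, F₁.obj (x z) = G.src (g z))
    (h₂ : ∀ z, F₂.obj (y z) = G.tgt (g z)) :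
    Smooth (fun z => untwist θ₁ θ₂ (x z) (g z) (y z)) :=
  smooth_mul_mul (θ₂.smooth_app.comp hy) hg (G.smooth_inv.comp (θ₁.smooth_app.comp hx))
    (fun z => untwist_left (h₂ z)) fun z => untwist_right (h₁ z)

theorem NatTransf.naturality_inv (θ : NatTransf F₁ F₁') (l : M₁.Arr) :
    G.mul (G.inv (θ.app (M₁.tgt l))) (F₁'.arr l) =
      G.mul (F₁.arr l) (G.inv (θ.app (M₁.src l))) := by
  have e1 : G.src (θ.app (M₁.tgt l)) = G.tgt (F₁.arr l) := by rw [θ.src_app, F₁.tgt_arr]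
  have e2 : G.src (F₁'.arr l) = G.tgt (θ.app (M₁.src l)) := by rw [θ.tgt_app, F₁'.src_arr]
  have e3 : G.src (G.inv (θ.app (M₁.tgt l))) = G.tgt (F₁'.arr l) := by
    rw [G.src_inv, θ.tgt_app, F₁'.tgt_arr]
  have h := G.cancel_right _ _ e2
  rw [← θ.naturality] at h
  rw [← h, ← G.mul_assoc _ _ _ (by rw [G.src_inv, G.tgt_mul _ _ e1]) (by
    rw [G.src_mul _ _ e1, G.tgt_inv, θ.src_app, F₁.src_arr]), G.cancel_left _ _ e1]

/-- Naturality moves `θ₁` past the image of `l`, the given square replaces `k` by `g`, and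
naturality moves `θ₂⁻¹` past the image of `m`. -/
theorem twist_square {l : M₁.Arr} {m : M₂.Arr} {k : G.Arr}
    (h₁ : F₁'.obj (M₁.src l) = G.src g) (h₂ : F₂'.obj (M₂.src m) = G.tgt g)
    (k₁ : F₁'.obj (M₁.tgt l) = G.src k) (k₂ : F₂'.obj (M₂.tgt m) = G.tgt k)
    (h : G.mul k (F₁'.arr l) = G.mul (F₂'.arr m) g) :
    G.mul (twist θ₁ θ₂ (M₁.tgt l) k (M₂.tgt m)) (F₁.arr l) =
      G.mul (F₂.arr m) (twist θ₁ θ₂ (M₁.src l) g (M₂.src m)) := by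
  have a1 := twist_left (θ₂ := θ₂) k₂
  have a2 := twist_right (θ₁ := θ₁) k₁
  have b1 := twist_left (θ₂ := θ₂) h₂
  have b2 := twist_right (θ₁ := θ₁) h₁
  have c1 : G.src (θ₁.app (M₁.tgt l)) = G.tgt (F₁.arr l) := by rw [θ₁.src_app, F₁.tgt_arr]
  have c2 : G.src (F₁'.arr l) = G.tgt (θ₁.app (M₁.src l)) := by rw [θ₁.tgt_app, F₁'.src_arr]
  have c3 : G.src k = G.tgt (F₁'.arr l) := by rw [F₁'.tgt_arr, k₁]
  have c4 : G.src (F₂'.arr m) = G.tgt g := by rw [F₂'.src_arr, h₂]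
  have c5 : G.src (G.inv (θ₂.app (M₂.tgt m))) = G.tgt (F₂'.arr m) := by
    rw [G.src_inv, θ₂.tgt_app, F₂'.tgt_arr]
  have c6 : G.src (F₂.arr m) = G.tgt (G.inv (θ₂.app (M₂.src m))) := by
    rw [G.tgt_inv, θ₂.src_app, F₂.src_arr]
  have d1 : G.src (G.mul (G.inv (θ₂.app (M₂.tgt m))) k) = G.tgt (F₁'.arr l) :=
    (G.src_mul _ _ a1).trans c3
  have d2 : G.src (G.mul (G.inv (θ₂.app (M₂.src m))) g) = G.tgt (θ₁.app (M₁.src l)) :=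
    (G.src_mul _ _ b1).trans b2
  unfold twist
  rw [G.mul_assoc _ _ _ ((G.src_mul _ _ a1).trans a2) c1, θ₁.naturality,
    ← G.mul_assoc _ _ _ d1 c2, G.mul_assoc _ _ _ a1 c3, h, ← G.mul_assoc _ _ _ c5 c4,
    θ₂.naturality_inv, G.mul_assoc _ _ _ c6 b1, G.mul_assoc _ _ _ (by
      rw [G.tgt_mul _ _ b1, c6]) d2]

end Twist

/-! ### Morphisms between homotopy fibre products -/

section HFibreMap

variable {M₁ M₂ L₁ L₂ H G : LieGroupoid.{u} 𝕜} {φ : H.Hom G} {μ₁ : L₁.Hom G} {μ₂ : L₂.Hom G}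
  {ψ₁ : M₁.Hom L₁} {ψ₂ : M₂.Hom L₂} {ν₁ : M₁.Hom H} {ν₂ : M₂.Hom H}
  (θ₁ : NatTransf (μ₁.comp ψ₁) (φ.comp ν₁)) (θ₂ : NatTransf (μ₂.comp ψ₂) (φ.comp ν₂))
  (ht : ArrTransverse G μ₁.obj μ₂.obj) {ht' : ArrTransverse H ν₁.obj ν₂.obj}

theorem hf_obj_src (q : hfObj ν₁ ν₂ ht') :
    (φ.comp ν₁).obj (fLeft q) = G.src (φ.arr (fMid q)) :=
  (congrArg φ.obj (fLeft_eq q)).trans (φ.src_arr _).symm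

theorem hf_obj_tgt (q : hfObj ν₁ ν₂ ht') :
    (φ.comp ν₂).obj (fRight q) = G.tgt (φ.arr (fMid q)) :=
  (congrArg φ.obj (fRight_eq q)).trans (φ.tgt_arr _).symm

/-- The arrow `θ₂⁻¹ φ(h) θ₁` for an object `(x, h, y)`. -/
def hfMapMid (q : hfObj ν₁ ν₂ ht') : G.Arr :=
  twist θ₁ θ₂ (fLeft q) (φ.arr (fMid q)) (fRight q)

/-- `(x, h, y) ↦ (ψ₁ x, θ₂⁻¹ φ(h) θ₁, ψ₂ y)`. -/
noncomputable def hfMapObj (q : hfObj ν₁ ν₂ ht') : hfObj μ₁ μ₂ ht :=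
  arrFibreMk _ _ _ (ψ₁.obj (fLeft q)) (hfMapMid θ₁ θ₂ q) (ψ₂.obj (fRight q))
    (src_twist (F₁ := μ₁.comp ψ₁) (hf_obj_src q) (hf_obj_tgt q))
    (tgt_twist (F₂ := μ₂.comp ψ₂) (hf_obj_src q) (hf_obj_tgt q))

/-- `(l, h, m) ↦ (ψ₁ l, θ₂⁻¹ φ(h) θ₁, ψ₂ m)`. -/
noncomputable def hfMapArr (q : hfArr ν₁ ν₂ ht') : hfArr μ₁ μ₂ ht :=
  arrFibreMk _ _ _ (ψ₁.arr (fLeft q)) (hfMapMid θ₁ θ₂ (hfSrc q)) (ψ₂.arr (fRight q))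
    ((congrArg μ₁.obj (ψ₁.src_arr _)).trans (fLeft_eq (hfMapObj θ₁ θ₂ ht (hfSrc q))))
    ((congrArg μ₂.obj (ψ₂.src_arr _)).trans (fRight_eq (hfMapObj θ₁ θ₂ ht (hfSrc q))))

theorem smooth_hfMapMid : Smooth (hfMapMid θ₁ θ₂ (ht' := ht')) :=
  smooth_twist smooth_left (φ.smooth_arr.comp smooth_mid) smooth_right hf_obj_src hf_obj_tgt

theorem smooth_hfMapObj : Smooth (hfMapObj θ₁ θ₂ ht (ht' := ht')) :=
  smooth_arrFibreMk (ψ₁.smooth_obj.comp smooth_left) (smooth_hfMapMid θ₁ θ₂)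
    (ψ₂.smooth_obj.comp smooth_right) _ _

theorem smooth_hfMapArr : Smooth (hfMapArr θ₁ θ₂ ht (ht' := ht')) :=
  smooth_arrFibreMk (ψ₁.smooth_arr.comp smooth_left)
    ((smooth_hfMapMid θ₁ θ₂).comp smooth_hfSrc) (ψ₂.smooth_arr.comp smooth_right) _ _

theorem hfSrc_hfMapArr (q : hfArr ν₁ ν₂ ht') :
    hfSrc (hfMapArr θ₁ θ₂ ht q) = hfMapObj θ₁ θ₂ ht (hfSrc q) :=
  arrFibre_ext (ψ₁.src_arr _) rfl (ψ₂.src_arr _)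

/-- The middle component of a target is the unique arrow completing a commutative square
(`hf_unique`). The square of `q`, mapped by `φ` and twisted, provides the completion. -/
theorem hfTgtMid_hfMapArr (q : hfArr ν₁ ν₂ ht') :
    hfTgtMid (hfMapArr θ₁ θ₂ ht q) = hfMapMid θ₁ θ₂ (hfTgt q) := by
  refine hf_unique (hfMapArr θ₁ θ₂ ht q) (hfMapMid θ₁ θ₂ (hfTgt q)) ?_ ?_
  · refine (src_twist (F₁ := μ₁.comp ψ₁) (hf_obj_src (hfTgt q)) (hf_obj_tgt (hfTgt q))).symm.trans ?_
    exact ((μ₁.comp ψ₁).tgt_arr _).symm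
  · refine twist_square (hf_obj_src (hfSrc q)) (hf_obj_tgt (hfSrc q)) (hf_obj_src (hfTgt q))
      (hf_obj_tgt (hfTgt q)) ?_
    have h := congrArg φ.arr (hf_square q)
    rw [φ.arr_mul _ _ ((hf_src_tgtMid q).symm.trans (ν₁.tgt_arr _).symm),
      φ.arr_mul _ _ (hf_comp1 q)] at h
    exact h

theorem hfTgt_hfMapArr (q : hfArr ν₁ ν₂ ht') :
    hfTgt (hfMapArr θ₁ θ₂ ht q) = hfMapObj θ₁ θ₂ ht (hfTgt q) :=
  arrFibre_ext (ψ₁.tgt_arr _) (hfTgtMid_hfMapArr θ₁ θ₂ ht q) (ψ₂.tgt_arr _)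

variable (ht') in
/-- The morphism of homotopy fibre products induced by a morphism `φ : H → G` and squares that
commute up to `θ₁` and `θ₂`. -/
noncomputable def hfMap : (hfGroupoid ν₁ ν₂ ht').Hom (hfGroupoid μ₁ μ₂ ht) where
  obj := hfMapObj θ₁ θ₂ ht
  arr := hfMapArr θ₁ θ₂ ht
  smooth_obj := smooth_hfMapObj θ₁ θ₂ ht
  smooth_arr := smooth_hfMapArr θ₁ θ₂ ht
  src_arr := hfSrc_hfMapArr θ₁ θ₂ ht
  tgt_arr := hfTgt_hfMapArr θ₁ θ₂ ht
  arr_mul q r h := by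
    have h' : hfSrc (hfMapArr θ₁ θ₂ ht q) = hfTgt (hfMapArr θ₁ θ₂ ht r) :=
      (hfSrc_hfMapArr θ₁ θ₂ ht q).trans ((congrArg (hfMapObj θ₁ θ₂ ht) h).trans
        (hfTgt_hfMapArr θ₁ θ₂ ht r).symm)
    have hs : hfSrc (hfMul q r) = hfSrc r := (hfGroupoid ν₁ ν₂ ht').src_mul q r h
    obtain ⟨h1, -, h3⟩ := hf_composable h
    refine arrFibre_ext ?_ ?_ ?_
    · exact (congrArg ψ₁.arr (hfMul_left h)).trans ((ψ₁.arr_mul _ _ h1).trans (hfMul_left h').symm)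
    · exact (congrArg (hfMapMid θ₁ θ₂) hs).trans (hfMul_mid h').symm
    · exact (congrArg ψ₂.arr (hfMul_right h)).trans
        ((ψ₂.arr_mul _ _ h3).trans (hfMul_right h').symm)

theorem hfMapObj_surjective (hφ : φ.IsMorita) (hψ₁ : ψ₁.IsMorita) (hψ₂ : ψ₂.IsMorita) :
    Function.Surjective (hfMapObj θ₁ θ₂ ht (ht' := ht')) := by
  intro p
  obtain ⟨x, hx⟩ := hψ₁.surjective (fLeft p)
  obtain ⟨y, hy⟩ := hψ₂.surjective (fRight p)
  have h₁ : (μ₁.comp ψ₁).obj x = G.src (fMid p) := (congrArg μ₁.obj hx).trans (fLeft_eq p)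
  have h₂ : (μ₂.comp ψ₂).obj y = G.tgt (fMid p) := (congrArg μ₂.obj hy).trans (fRight_eq p)
  -- Once the endpoints are lifted along `ψ₁` and `ψ₂`, the middle arrow is conjugated by the
  -- natural transformations so that its ends lie in the image of `φ`.
  obtain ⟨h, k1, k2, k3⟩ := hφ.exists_arr (src_untwist (θ₁ := θ₁) (θ₂ := θ₂) h₁ h₂)
    (tgt_untwist (θ₁ := θ₁) (θ₂ := θ₂) h₁ h₂)
  refine ⟨arrFibreMk _ _ _ x h y k1.symm k2.symm, arrFibre_ext hx ?_ hy⟩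
  change twist θ₁ θ₂ x (φ.arr h) y = _
  rw [k3, twist_untwist h₁ h₂]

theorem ArrTransverse.comp_submersive (ht : ArrTransverse G μ₁.obj μ₂.obj)
    (hψ₁ : Submersive ψ₁.obj) (hψ₂ : Submersive ψ₂.obj) :
    ArrTransverse G (μ₁.comp ψ₁).obj (μ₂.comp ψ₂).obj := by
  intro x g y hx hy a b
  obtain ⟨u, w, v, h1, h2⟩ := ht (ψ₁.obj x) g (ψ₂.obj y) hx hy a b
  obtain ⟨u, rfl⟩ := hψ₁ x u
  obtain ⟨v, rfl⟩ := hψ₂ y v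
  exact ⟨u, w, v, by rw [Hom.diff_comp_obj, h1], by rw [Hom.diff_comp_obj, h2]⟩

/-- Let `R` be the manifold of triples `(x, g, y)` with `g : μ₁ψ₁ x → μ₂ψ₂ y` an arrow of `G`.
Untwisting `g` and lifting it through `φ` gives a smooth map `E` from `R` to the objects `(x, h,
y)`. Composing with `E` turns the map in question into `P`, which only applies `ψ₁` and `ψ₂` and is
therefore a submersion. As every point `q` is of the form `E r₀`, submersivity follows. -/
theorem hfMapObj_submersive (hφ : φ.IsMorita) (hψ₁ : ψ₁.IsMorita) (hψ₂ : ψ₂.IsMorita) :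
    Submersive (hfMapObj θ₁ θ₂ ht (ht' := ht')) := by
  intro q k
  have hR := ht.comp_submersive hψ₁.submersive hψ₂.submersive
  let R := arrFibre (μ₁.comp ψ₁).smooth_obj (μ₂.comp ψ₂).smooth_obj hR
  obtain ⟨e, he, e1, e2, e3⟩ := hφ.exists_smooth_arr (N := R)
    (x := fun r => ν₁.obj (fLeft r)) (y := fun r => ν₂.obj (fRight r))
    (g := fun r => untwist θ₁ θ₂ (fLeft r) (fMid r) (fRight r))
    (ν₁.smooth_obj.comp smooth_left) (ν₂.smooth_obj.comp smooth_right)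
    (smooth_untwist smooth_left smooth_mid smooth_right fLeft_eq fRight_eq)
    (fun r => src_untwist (fLeft_eq r) (fRight_eq r))
    (fun r => tgt_untwist (fLeft_eq r) (fRight_eq r))
  let E : R → hfObj ν₁ ν₂ ht' := fun r =>
    arrFibreMk _ _ _ (fLeft r) (e r) (fRight r) (e1 r).symm (e2 r).symm
  have hE : Smooth E := smooth_arrFibreMk smooth_left he smooth_right _ _
  let r₀ : R := arrFibreMk _ _ _ (fLeft q) (hfMapMid θ₁ θ₂ q) (fRight q)
    (src_twist (F₁ := μ₁.comp ψ₁) (hf_obj_src q) (hf_obj_tgt q))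
    (tgt_twist (F₂ := μ₂.comp ψ₂) (hf_obj_src q) (hf_obj_tgt q))
  -- The lifted arrow and the middle arrow of `q` have the same endpoints and the same image under
  -- `φ`.
  have hE₀ : E r₀ = q := by
    refine arrFibre_ext rfl (hφ.arr_ext ((e1 r₀).trans (fLeft_eq q)) ((e2 r₀).trans (fRight_eq q))
      ((e3 r₀).trans ?_)) rfl
    exact untwist_twist (hf_obj_src q) (hf_obj_tgt q)
  let P : R → hfObj μ₁ μ₂ ht := fun r =>
    arrFibreMk _ _ _ (ψ₁.obj (fLeft r)) (fMid r) (ψ₂.obj (fRight r)) (fLeft_eq r) (fRight_eq r)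
  have hP : Smooth P := smooth_arrFibreMk (ψ₁.smooth_obj.comp smooth_left) smooth_mid
    (ψ₂.smooth_obj.comp smooth_right) _ _
  have hEP : (fun r => hfMapObj θ₁ θ₂ ht (E r)) = P := by
    funext r
    refine arrFibre_ext rfl ?_ rfl
    change twist θ₁ θ₂ (fLeft r) (φ.arr (e r)) (fRight r) = fMid r
    rw [e3, twist_untwist (fLeft_eq r) (fRight_eq r)]
  have hP₀ : P r₀ = hfMapObj θ₁ θ₂ ht q := rfl
  obtain ⟨a, ha⟩ := hψ₁.submersive (fLeft q)
    (diff (fun p : hfObj μ₁ μ₂ ht => fLeft p) (hfMapObj θ₁ θ₂ ht q) k)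
  obtain ⟨b, hb⟩ := hψ₂.submersive (fRight q)
    (diff (fun p : hfObj μ₁ μ₂ ht => fRight p) (hfMapObj θ₁ θ₂ ht q) k)
  obtain ⟨κ, κ1, κ2, κ3⟩ := arrFibre_tangent_exists r₀ a
    (diff (fun p : hfObj μ₁ μ₂ ht => fMid p) (hfMapObj θ₁ θ₂ ht q) k) b
    ((Hom.diff_comp_obj μ₁ ψ₁ (fLeft q) a).trans
      ((congrArg _ ha).trans (diff_fLeft_eq (hfMapObj θ₁ θ₂ ht q) k)))
    ((Hom.diff_comp_obj μ₂ ψ₂ (fRight q) b).trans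
      ((congrArg _ hb).trans (diff_fRight_eq (hfMapObj θ₁ θ₂ ht q) k)))
  have hk : diff P r₀ κ = k := by
    refine arrFibre_tangent_ext (hfMapObj θ₁ θ₂ ht q) ?_ ?_ ?_
    · refine (diff_comp smooth_left hP r₀ κ).symm.trans ?_
      exact (diff_comp ψ₁.smooth_obj smooth_left r₀ κ).trans ((congrArg _ κ1).trans ha)
    · exact (diff_comp smooth_mid hP r₀ κ).symm.trans κ2
    · refine (diff_comp smooth_right hP r₀ κ).symm.trans ?_
      exact (diff_comp ψ₂.smooth_obj smooth_right r₀ κ).trans ((congrArg _ κ3).trans hb)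
  have h := diff_comp (smooth_hfMapObj θ₁ θ₂ ht) hE r₀ κ
  rw [hEP, hE₀] at h
  exact ⟨_, h.symm.trans hk⟩

/-- The morphism of homotopy fibre products induced by Morita morphisms is a Morita morphism. -/
theorem hfMap_isMorita (hφ : φ.IsMorita) (hψ₁ : ψ₁.IsMorita) (hψ₂ : ψ₂.IsMorita) :
    (hfMap θ₁ θ₂ ht ht').IsMorita := by
  have hsub := hfMapObj_submersive θ₁ θ₂ ht (ht' := ht') hφ hψ₁ hψ₂
  let N := arrFibre (G := hfGroupoid μ₁ μ₂ ht) (hfMap θ₁ θ₂ ht ht').smooth_obj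
    (hfMap θ₁ θ₂ ht ht').smooth_obj (Submersive.arrTransverse hsub hsub)
  let q : N → hfObj ν₁ ν₂ ht' := fun p => fLeft p
  let q' : N → hfObj ν₁ ν₂ ht' := fun p => fRight p
  let a : N → hfArr μ₁ μ₂ ht := fun p => fMid p
  have hq : Smooth q := smooth_left
  have hq' : Smooth q' := smooth_right
  have ha : Smooth a := smooth_mid
  have es : ∀ p, hfMapObj θ₁ θ₂ ht (q p) = hfSrc (a p) := fun p => fLeft_eq p
  have et : ∀ p, hfMapObj θ₁ θ₂ ht (q' p) = hfTgt (a p) := fun p => fRight_eq p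
  -- Over a triple formed by an arrow `a` and lifts `q`, `q'` of its ends, the outer components of
  -- `a` lift through `ψ₁` and `ψ₂`. The middle component of an arrow is that of its source, so it
  -- is read off from `q`.
  obtain ⟨l, hl, l1, l2, l3⟩ := hψ₁.exists_smooth_arr (smooth_left.comp hq)
    (smooth_left.comp hq') (smooth_left.comp ha) (fun p => (congrArg fLeft (es p)).symm)
    (fun p => (congrArg fLeft (et p)).symm)
  obtain ⟨m, hm, m1, m2, m3⟩ := hψ₂.exists_smooth_arr (smooth_right.comp hq)
    (smooth_right.comp hq') (smooth_right.comp ha) (fun p => (congrArg fRight (es p)).symm)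
    (fun p => (congrArg fRight (et p)).symm)
  let k : N → hfArr ν₁ ν₂ ht' := fun p => arrFibreMk _ _ _ (l p) (fMid (q p)) (m p)
    ((congrArg ν₁.obj (l1 p)).trans (fLeft_eq (q p)))
    ((congrArg ν₂.obj (m1 p)).trans (fRight_eq (q p)))
  have hk : Smooth k := smooth_arrFibreMk hl (smooth_mid.comp hq) hm _ _
  have k1 : ∀ p, hfSrc (k p) = q p := fun p => arrFibre_ext (l1 p) rfl (m1 p)
  have k3 : ∀ p, hfMapArr θ₁ θ₂ ht (k p) = a p := fun p =>
    arrFibre_ext (l3 p) ((congrArg (hfMapMid θ₁ θ₂) (k1 p)).trans (congrArg fMid (es p))) (m3 p)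
  -- The middle component of the target was not prescribed. It is correct because its twist is the
  -- one prescribed by `a`, twisting is injective, and `φ` is faithful.
  have k2 : ∀ p, hfTgt (k p) = q' p := by
    intro p
    have e : hfMapMid θ₁ θ₂ (hfTgt (k p)) = hfMapMid θ₁ θ₂ (q' p) :=
      (hfTgtMid_hfMapArr θ₁ θ₂ ht (k p)).symm.trans
        ((congrArg hfTgtMid (k3 p)).trans (congrArg fMid (et p)).symm)
    have el : fLeft (hfTgt (k p)) = fLeft (q' p) := l2 p
    have er : fRight (hfTgt (k p)) = fRight (q' p) := m2 p
    refine arrFibre_ext el (hφ.arr_ext ?_ ?_ ?_) er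
    · exact (fLeft_eq (hfTgt (k p))).symm.trans ((congrArg ν₁.obj el).trans (fLeft_eq (q' p)))
    · exact (fRight_eq (hfTgt (k p))).symm.trans ((congrArg ν₂.obj er).trans (fRight_eq (q' p)))
    · refine twist_injective ((congrArg _ el.symm).trans (hf_obj_src (hfTgt (k p))))
        ((congrArg _ er.symm).trans (hf_obj_tgt (hfTgt (k p)))) (hf_obj_src (q' p))
        (hf_obj_tgt (q' p)) (Eq.trans ?_ e)
      unfold hfMapMid
      rw [el, er]
  refine Hom.IsMorita.of_faithful (hfMapObj_surjective θ₁ θ₂ ht hφ hψ₁ hψ₂) hsub ?_ k hk k1 k2 k3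
  intro (h : hfArr ν₁ ν₂ ht') (h' : hfArr ν₁ ν₂ ht') (hs : hfSrc h = hfSrc h')
    (hT : hfTgt h = hfTgt h') (hA : hfMapArr θ₁ θ₂ ht h = hfMapArr θ₁ θ₂ ht h')
  have hmid : fMid (hfSrc h) = fMid (hfSrc h') := congrArg fMid hs
  refine arrFibre_ext ?_ hmid ?_
  · exact hψ₁.arr_ext (congrArg fLeft hs) (congrArg fLeft hT) (congrArg fLeft hA)
  · exact hψ₂.arr_ext (congrArg fRight hs) (congrArg fRight hT) (congrArg fRight hA)

end HFibreMap

end ShiftedSymplectic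

namespace ShiftedSymplectic

variable {𝕜 : Type v} [RCLike 𝕜]

open LieGroupoid

/-! ### Composition of Lagrangian Morita equivalences -/

/-- The multiplicative form is additive on the product `θ₂⁻¹ g θ₁` and odd under inversion. -/
theorem QuasiSymplecticGroupoid.pullback_twist {G : QuasiSymplecticGroupoid.{u} 𝕜}
    {M₁ M₂ : LieGroupoid.{u} 𝕜} {F₁ F₁' : M₁.Hom G.toLieGroupoid} {F₂ F₂' : M₂.Hom G.toLieGroupoid}
    (θ₁ : NatTransf F₁ F₁') (θ₂ : NatTransf F₂ F₂') {N : Mfd.{u} 𝕜} {x : N → M₁.Obj}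
    {g : N → G.Arr} {y : N → M₂.Obj} (hx : Smooth x) (hg : Smooth g) (hy : Smooth y)
    (h₁ : ∀ z, F₁'.obj (x z) = G.src (g z)) (h₂ : ∀ z, F₂'.obj (y z) = G.tgt (g z)) :
    pullback (fun z => twist θ₁ θ₂ (x z) (g z) (y z)) G.Ω =
      pullback g G.Ω + pullback x (pullback θ₁.app G.Ω) - pullback y (pullback θ₂.app G.Ω) := by
  have hi : Smooth (fun z => θ₂.app (y z)) := θ₂.smooth_app.comp hy
  have hi' : Smooth (fun z => G.inv (θ₂.app (y z))) := G.smooth_inv.comp hi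
  have hx' : Smooth (fun z => θ₁.app (x z)) := θ₁.smooth_app.comp hx
  have e1 := fun z => twist_left (θ₂ := θ₂) (h₂ z)
  have e2 := fun z => twist_right (θ₁ := θ₁) (h₁ z)
  unfold twist
  rw [pullback_mul (smooth_mul_of hi' hg e1) hx' fun z => (G.src_mul _ _ (e1 z)).trans (e2 z),
    pullback_mul hi' hg e1, pullback_inv hi, pullback_pullback θ₁.smooth_app hx,
    pullback_pullback θ₂.smooth_app hy]
  module

/-- Natural transformations, pulled back along a morphism. -/
def NatTransf.whisker {K M G : LieGroupoid.{u} 𝕜} {F : M.Hom G}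
    {F' : M.Hom G} (θ : NatTransf F F') (ψ : K.Hom M) :
    NatTransf (F.comp ψ) (F'.comp ψ) where
  app x := θ.app (ψ.obj x)
  smooth_app := θ.smooth_app.comp ψ.smooth_obj
  src_app x := θ.src_app _
  tgt_app x := θ.tgt_app _
  naturality k := by
    rw [← ψ.tgt_arr, ← ψ.src_arr]
    exact θ.naturality (ψ.arr k)

section Comp

variable {G₁ G₂ G₃ G₁' G₂' G₃' : QuasiSymplecticGroupoid.{u} 𝕜}

/-- The 2-form of a composition, pulled back along an induced morphism. -/
theorem FormSpan.pullback_hfMapObj_γ {S₁ : FormSpan G₁ G₂} {S₂ : FormSpan G₂ G₃}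
    (h : S₁.Transverse S₂) {M₁ M₂ H : LieGroupoid.{u} 𝕜} {φ : H.Hom G₂.toLieGroupoid}
    {ψ₁ : M₁.Hom S₁.L} {ψ₂ : M₂.Hom S₂.L} {ν₁ : M₁.Hom H} {ν₂ : M₂.Hom H}
    (θ₁ : NatTransf (S₁.snd.comp ψ₁) (φ.comp ν₁)) (θ₂ : NatTransf (S₂.fst.comp ψ₂) (φ.comp ν₂))
    {t : ArrTransverse H ν₁.obj ν₂.obj} :
    pullback (hfMapObj θ₁ θ₂ h (ht' := t)) (S₁.comp S₂ h).γ =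
      pullback (fun q : hfObj ν₁ ν₂ t => fLeft q) (pullback ψ₁.obj S₁.γ) +
      pullback (fun q : hfObj ν₁ ν₂ t => fRight q) (pullback ψ₂.obj S₂.γ) -
      (pullback (fun q : hfObj ν₁ ν₂ t => fMid q) (pullback φ.arr G₂.Ω) +
        pullback (fun q : hfObj ν₁ ν₂ t => fLeft q) (pullback θ₁.app G₂.Ω) -
        pullback (fun q : hfObj ν₁ ν₂ t => fRight q) (pullback θ₂.app G₂.Ω)) := by
  have hm := smooth_hfMapObj θ₁ θ₂ h (ht' := t)
  have e := QuasiSymplecticGroupoid.pullback_twist θ₁ θ₂ (smooth_left (ht := t))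
    (φ.smooth_arr.comp smooth_mid) smooth_right hf_obj_src hf_obj_tgt
  have e1 : pullback (hfMapObj θ₁ θ₂ h (ht' := t)) (pullback (hfMid S₁.snd S₂.fst h) G₂.Ω) = _ :=
    (pullback_pullback smooth_mid hm _).trans e
  have e2 : pullback (hfMapObj θ₁ θ₂ h (ht' := t)) (pullback (hfFst S₁.snd S₂.fst h).obj S₁.γ) =
      pullback (fun q : hfObj ν₁ ν₂ t => fLeft q) (pullback ψ₁.obj S₁.γ) :=
    (pullback_pullback smooth_left hm _).trans (pullback_pullback ψ₁.smooth_obj smooth_left _).symm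
  have e3 : pullback (hfMapObj θ₁ θ₂ h (ht' := t)) (pullback (hfSnd S₁.snd S₂.fst h).obj S₂.γ) =
      pullback (fun q : hfObj ν₁ ν₂ t => fRight q) (pullback ψ₂.obj S₂.γ) :=
    (pullback_pullback smooth_right hm _).trans
      (pullback_pullback ψ₂.smooth_obj smooth_right _).symm
  have e4 : pullback (fun q : hfObj ν₁ ν₂ t => fMid q) (pullback φ.arr G₂.Ω) =
      pullback (φ.arr ∘ fMid) G₂.Ω := pullback_pullback φ.smooth_arr smooth_mid _
  refine (pullback_sub _ _ _).trans (congrArg₂ _ ((pullback_add _ _ _).trans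
    (congrArg₂ _ e2 e3)) (e1.trans ?_))
  rw [e4]

variable {E₁ : SymplecticMoritaEquiv G₁ G₁'} {E₂ : SymplecticMoritaEquiv G₂ G₂'}
  {E₃ : SymplecticMoritaEquiv G₃ G₃'} {S₁ : FormSpan G₁ G₂} {S₂ : FormSpan G₂ G₃}
  {S₁' : FormSpan G₁' G₂'} {S₂' : FormSpan G₂' G₃'}
  (A : LagrangianMoritaEquiv E₁ E₂ S₁ S₁') (B : LagrangianMoritaEquiv E₂ E₃ S₂ S₂')

namespace LagrangianMoritaEquiv

/-- The right-hand side refers neither to `G₂` nor to `G₂'`, so with `transverse_iff'` it links the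
transversality of the two pairs. -/
theorem transverse_iff : S₁.Transverse S₂ ↔ ArrTransverse E₂.L A.ν₂.obj B.ν₁.obj :=
  ⟨ArrTransverse.lift A.θ₂ B.θ₁ E₂.isMorita_fst A.isMorita_ψ B.isMorita_ψ,
    ArrTransverse.descend A.θ₂ B.θ₁ E₂.isMorita_fst A.isMorita_ψ B.isMorita_ψ⟩

theorem transverse_iff' : S₁'.Transverse S₂' ↔ ArrTransverse E₂.L A.ν₂.obj B.ν₁.obj :=
  ⟨ArrTransverse.lift A.θ₂' B.θ₁' E₂.isMorita_snd A.isMorita_ψ' B.isMorita_ψ',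
    ArrTransverse.descend A.θ₂' B.θ₁' E₂.isMorita_snd A.isMorita_ψ' B.isMorita_ψ'⟩

/-- The 2-forms on the middle groupoid of the composition. -/
theorem pullback_mid (E : SymplecticMoritaEquiv G₂ G₂') {M₁ M₂ : LieGroupoid.{u} 𝕜}
    {ν₁ : M₁.Hom E.L} {ν₂ : M₂.Hom E.L} {t : ArrTransverse E.L ν₁.obj ν₂.obj} :
    pullback (fun q : hfObj ν₁ ν₂ t => fMid q) (pullback E.fst.arr G₂.Ω) -
      pullback (fun q : hfObj ν₁ ν₂ t => fMid q) (pullback E.snd.arr G₂'.Ω) =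
    pullback (fun q : hfObj ν₁ ν₂ t => fRight q) (pullback ν₂.obj E.γ) -
      pullback (fun q : hfObj ν₁ ν₂ t => fLeft q) (pullback ν₁.obj E.γ) := by
  have e1 : (fun q : hfObj ν₁ ν₂ t => ν₂.obj (fRight q)) = fun q => E.L.tgt (fMid q) :=
    funext fRight_eq
  have e2 : (fun q : hfObj ν₁ ν₂ t => ν₁.obj (fLeft q)) = fun q => E.L.src (fMid q) :=
    funext fLeft_eq
  rw [← pullback_sub, E.isLagrangian.pullback_Ω, pullback_sub,
    pullback_pullback E.L.smooth_tgt smooth_mid, pullback_pullback E.L.smooth_src smooth_mid,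
    pullback_pullback ν₂.smooth_obj smooth_right, pullback_pullback ν₁.smooth_obj smooth_left,
    e1, e2]

/-- Composition of Lagrangian Morita equivalences. -/
noncomputable def comp (h : S₁.Transverse S₂) (h' : S₁'.Transverse S₂') :
    LagrangianMoritaEquiv E₁ E₃ (S₁.comp S₂ h) (S₁'.comp S₂' h') :=
  have t := (transverse_iff A B).1 h
  { M := hfGroupoid A.ν₂ B.ν₁ t
    ψ := hfMap A.θ₂ B.θ₁ h t
    ψ' := hfMap A.θ₂' B.θ₁' h' t
    isMorita_ψ := hfMap_isMorita A.θ₂ B.θ₁ h E₂.isMorita_fst A.isMorita_ψ B.isMorita_ψ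
    isMorita_ψ' := hfMap_isMorita A.θ₂' B.θ₁' h' E₂.isMorita_snd A.isMorita_ψ' B.isMorita_ψ'
    ν₁ := A.ν₁.comp (hfFst A.ν₂ B.ν₁ t)
    ν₂ := B.ν₂.comp (hfSnd A.ν₂ B.ν₁ t)
    θ₁ := A.θ₁.whisker (hfFst A.ν₂ B.ν₁ t)
    θ₂ := B.θ₂.whisker (hfSnd A.ν₂ B.ν₁ t)
    θ₁' := A.θ₁'.whisker (hfFst A.ν₂ B.ν₁ t)
    θ₂' := B.θ₂'.whisker (hfSnd A.ν₂ B.ν₁ t)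
    form_eq := by
      have hA := congrArg (pullback (fun q : hfObj A.ν₂ B.ν₁ t => fLeft q)) A.form_eq
      have hB := congrArg (pullback (fun q : hfObj A.ν₂ B.ν₁ t => fRight q)) B.form_eq
      have hm := pullback_mid E₂ (t := t)
      have h1 := FormSpan.pullback_hfMapObj_γ h A.θ₂ B.θ₁ (t := t)
      have h2 := FormSpan.pullback_hfMapObj_γ h' A.θ₂' B.θ₁' (t := t)
      have l {N : Mfd.{u} 𝕜} {f : A.M.Obj → N} (hf : Smooth f) (α : Form N 2) :
          pullback (fun q : hfObj A.ν₂ B.ν₁ t => fLeft q) (pullback f α) =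
            pullback (fun q : hfObj A.ν₂ B.ν₁ t => f (fLeft q)) α :=
        pullback_pullback hf smooth_left α
      have r {N : Mfd.{u} 𝕜} {f : B.M.Obj → N} (hf : Smooth f) (α : Form N 2) :
          pullback (fun q : hfObj A.ν₂ B.ν₁ t => fRight q) (pullback f α) =
            pullback (fun q : hfObj A.ν₂ B.ν₁ t => f (fRight q)) α :=
        pullback_pullback hf smooth_right α
      simp only [pullback_sub, pullback_add] at hA hB
      rw [l A.ν₁.smooth_obj, l A.θ₁.smooth_app, l A.θ₁'.smooth_app] at hA
      rw [r B.ν₂.smooth_obj, r B.θ₂.smooth_app, r B.θ₂'.smooth_app] at hB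
      have e : pullback (hfMapObj A.θ₂ B.θ₁ h (ht' := t)) (S₁.comp S₂ h).γ -
          pullback (hfMapObj A.θ₂' B.θ₁' h' (ht' := t)) (S₁'.comp S₂' h').γ =
        (pullback (fun q : hfObj A.ν₂ B.ν₁ t => A.ν₁.obj (fLeft q)) E₁.γ -
          pullback (fun q : hfObj A.ν₂ B.ν₁ t => B.ν₂.obj (fRight q)) E₃.γ) -
        (pullback (fun q : hfObj A.ν₂ B.ν₁ t => A.θ₁.app (fLeft q)) G₁.Ω -
          pullback (fun q : hfObj A.ν₂ B.ν₁ t => B.θ₂.app (fRight q)) G₃.Ω) +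
        (pullback (fun q : hfObj A.ν₂ B.ν₁ t => A.θ₁'.app (fLeft q)) G₁'.Ω -
          pullback (fun q : hfObj A.ν₂ B.ν₁ t => B.θ₂'.app (fRight q)) G₃'.Ω) := by
        rw [h1, h2]
        -- The terms of `θ₂` from `A` and of `θ₁` from `B`, with their primed versions, cancel
        -- against the twists in `h1` and `h2`; the two pullbacks of the form of `E₂` cancel against
        -- `hm`.
        linear_combination (norm := module) hA + hB - hm
      exact e }

end LagrangianMoritaEquiv

end Comp

end ShiftedSymplectic

namespace ShiftedSymplectic

variable {𝕜 : Type v} [RCLike 𝕜]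

open LieGroupoid

/-! ### The identity symplectic Morita equivalence -/

theorem smooth_id {M : Mfd.{u} 𝕜} : Smooth (fun x : M => x) := contMDiff_id

/-- The identity morphism. -/
def LieGroupoid.Hom.id (G : LieGroupoid.{u} 𝕜) : G.Hom G where
  obj x := x
  arr g := g
  smooth_obj := smooth_id
  smooth_arr := smooth_id
  src_arr _ := rfl
  tgt_arr _ := rfl
  arr_mul _ _ _ := rfl

theorem LieGroupoid.Hom.isMorita_id (G : LieGroupoid.{u} 𝕜) : (Hom.id G).IsMorita := by
  refine Hom.IsMorita.of_faithful (fun x => ⟨x, rfl⟩)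
    (fun x w => ⟨w, diff_id x w⟩) (fun _ _ _ _ h => h) (fun p => fMid p) smooth_mid
    (fun p => (fLeft_eq p).symm) (fun p => (fRight_eq p).symm) fun _ => rfl

theorem QuasiSymplecticGroupoid.eq_of_imForm (G : QuasiSymplecticGroupoid.{u} 𝕜) {x : G.Obj}
    {a b : G.Arr.Model} (ha : a ∈ G.algebroid x) (hb : b ∈ G.algebroid x)
    (h : G.anchor x a = G.anchor x b) (hσ : ∀ w, G.imForm x a w - G.imForm x b w = 0) : a = b := by
  refine sub_eq_zero.1 (G.eq_zero_of_imForm (sub_mem ha hb) ?_ fun w => ?_)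
  · rw [map_sub, h, sub_self]
  · rw [← G.imBilin_apply, map_sub, LinearMap.sub_apply]
    exact hσ w

/-- The span `G ← G → G` with the zero form. -/
def FormSpan.id (G : QuasiSymplecticGroupoid.{u} 𝕜) : FormSpan G G where
  L := G.toLieGroupoid
  fst := Hom.id _
  snd := Hom.id _
  γ := 0

/-- With zero form, the Lagrangian condition on `(v, a₁, a₂)` says `ρ(a₁) = v = ρ(a₂)` and `σ(a₁) =
σ(a₂)`. Injectivity of `(ρ, σ)` gives `a₁ = a₂`, so only the diagonal remains. -/
theorem FormSpan.isLagrangian_id (G : QuasiSymplecticGroupoid.{u} 𝕜) :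
    (FormSpan.id G).IsLagrangian where
  smooth_γ := SmoothForm.zero
  pullback_Ω := (sub_self _).trans (sub_self _).symm
  pullback_Φ := (sub_self _).trans ((congrArg Neg.neg extD_zero).trans neg_zero).symm
  nondegenerate x := by
    have hd : ∀ b, diff (fun g : G.Arr => g) (G.one x) b = b := diff_id _
    have hd' : ∀ v, diff (fun y : G.Obj => y) x v = v := diff_id x
    refine ⟨fun b hb => ?_, fun b _ c _ e => ?_, ?_⟩
    · refine ⟨Set.mem_of_eq_of_mem (hd b) hb, Set.mem_of_eq_of_mem (hd b) hb, ?_, ?_, fun w => ?_⟩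
      · exact (hd' _).trans (congrArg (G.anchor x) (hd b).symm)
      · exact (hd' _).trans (congrArg (G.anchor x) (hd b).symm)
      · exact (sub_self _).symm
    · exact (hd b).symm.trans ((congrArg (fun p => p.2.1) e).trans (hd c))
    · rintro ⟨v, a₁, a₂⟩ ⟨h1, h2, h3, h4, h5⟩
      have h3' : v = G.anchor x a₁ := (hd' v).symm.trans h3
      have h4' : v = G.anchor x a₂ := (hd' v).symm.trans h4
      have h6 : ∀ w, G.imForm x a₁ w - G.imForm x a₂ w = 0 := fun w =>
        (congrArg (fun u => G.imForm x a₁ u - G.imForm x a₂ u) (hd' w).symm).trans (h5 w).symm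
      have h7 := G.eq_of_imForm (x := x) h1 h2 (h3'.symm.trans h4') h6
      exact ⟨a₁, h1, Prod.ext h3'.symm (Prod.ext (hd a₁) ((hd a₁).trans h7))⟩

/-- The identity symplectic Morita equivalence. -/
def SymplecticMoritaEquiv.refl (G : QuasiSymplecticGroupoid.{u} 𝕜) :
    SymplecticMoritaEquiv G G where
  toFormSpan := FormSpan.id G
  isLagrangian := FormSpan.isLagrangian_id G
  isMorita_fst := Hom.isMorita_id _
  isMorita_snd := Hom.isMorita_id _

/-! ### Weak equivalences -/

/-- The identity natural transformation. -/
def NatTransf.id {H G : LieGroupoid.{u} 𝕜} (F : H.Hom G) : NatTransf F F where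
  app x := G.one (F.obj x)
  smooth_app := G.smooth_one.comp F.smooth_obj
  src_app _ := G.src_one _
  tgt_app _ := G.tgt_one _
  naturality h := by
    rw [← F.tgt_arr, ← F.src_arr, G.one_mul, G.mul_one]

/-- The inverse of a natural transformation. -/
def NatTransf.symm {H G : LieGroupoid.{u} 𝕜} {F F' : H.Hom G} (θ : NatTransf F F') :
    NatTransf F' F where
  app x := G.inv (θ.app x)
  smooth_app := G.smooth_inv.comp θ.smooth_app
  src_app x := (G.src_inv _).trans (θ.tgt_app x)
  tgt_app x := (G.tgt_inv _).trans (θ.src_app x)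
  naturality h := θ.naturality_inv h

theorem NatTransf.composable {H G : LieGroupoid.{u} 𝕜} {F F' F'' : H.Hom G}
    (θ : NatTransf F F') (θ' : NatTransf F' F'') (x : H.Obj) :
    G.src (θ'.app x) = G.tgt (θ.app x) := (θ'.src_app x).trans (θ.tgt_app x).symm

/-- The vertical composition of natural transformations. -/
def NatTransf.trans {H G : LieGroupoid.{u} 𝕜} {F F' F'' : H.Hom G} (θ : NatTransf F F')
    (θ' : NatTransf F' F'') : NatTransf F F'' where
  app x := G.mul (θ'.app x) (θ.app x)
  smooth_app := smooth_mul_of θ'.smooth_app θ.smooth_app (θ.composable θ')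
  src_app x := (G.src_mul _ _ (θ.composable θ' x)).trans (θ.src_app x)
  tgt_app x := (G.tgt_mul _ _ (θ.composable θ' x)).trans (θ'.tgt_app x)
  naturality h := by
    have e1 : G.src (θ.app (H.tgt h)) = G.tgt (F.arr h) := by rw [θ.src_app, F.tgt_arr]
    have e2 : G.src (θ'.app (H.tgt h)) = G.tgt (F'.arr h) := by rw [θ'.src_app, F'.tgt_arr]
    have e3 : G.src (F'.arr h) = G.tgt (θ.app (H.src h)) := by rw [θ.tgt_app, F'.src_arr]
    have e4 : G.src (F''.arr h) = G.tgt (θ'.app (H.src h)) := by rw [θ'.tgt_app, F''.src_arr]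
    rw [G.mul_assoc _ _ _ (θ.composable θ' _) e1, θ.naturality, ← G.mul_assoc _ _ _ e2 e3,
      θ'.naturality, G.mul_assoc _ _ _ e4 (θ.composable θ' _)]

section Weak

variable {G₁ G₂ G : QuasiSymplecticGroupoid.{u} 𝕜} {S S' : FormSpan G₁ G₂}
  {H : LieGroupoid.{u} 𝕜} {F F' F'' : H.Hom G.toLieGroupoid}

theorem NatTransf.pullback_id : pullback (NatTransf.id F).app G.Ω = 0 := by
  have h := pullback_pullback G.smooth_one F.smooth_obj G.Ω
  rw [G.pullback_one, pullback_zero] at h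
  exact h.symm

theorem NatTransf.pullback_symm (θ : NatTransf F F') :
    pullback θ.symm.app G.Ω = -pullback θ.app G.Ω :=
  QuasiSymplecticGroupoid.pullback_inv θ.smooth_app

theorem NatTransf.pullback_trans (θ : NatTransf F F') (θ' : NatTransf F' F'') :
    pullback (θ.trans θ').app G.Ω = pullback θ'.app G.Ω + pullback θ.app G.Ω :=
  QuasiSymplecticGroupoid.pullback_mul θ'.smooth_app θ.smooth_app (θ.composable θ')

/-- A weak equivalence is a Lagrangian Morita equivalence over the identities. -/
def WeakEquiv.toLagrangianMoritaEquiv (W : WeakEquiv S S') :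
    LagrangianMoritaEquiv (.refl G₁) (.refl G₂) S S' where
  M := W.M
  ψ := W.ψ
  ψ' := W.ψ'
  isMorita_ψ := W.isMorita_ψ
  isMorita_ψ' := W.isMorita_ψ'
  -- With the primed composite as the map to the identity equivalence, the primed transformations
  -- are identities, on which `Ω` pulls back to zero, and the unprimed ones are those of `W`.
  ν₁ := S'.fst.comp W.ψ'
  ν₂ := S'.snd.comp W.ψ'
  θ₁ := W.θ₁
  θ₂ := W.θ₂
  θ₁' := NatTransf.id (S'.fst.comp W.ψ')
  θ₂' := NatTransf.id (S'.snd.comp W.ψ')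
  form_eq := by
    have h1 := NatTransf.pullback_id (F := S'.fst.comp W.ψ')
    have h2 := NatTransf.pullback_id (F := S'.snd.comp W.ψ')
    have e : pullback W.ψ.obj S.γ - pullback W.ψ'.obj S'.γ =
        ((0 : Form W.M.Obj 2) - 0) - (pullback W.θ₁.app G₁.Ω - pullback W.θ₂.app G₂.Ω) +
          (0 - 0) := by
      rw [← W.form_eq]
      module
    exact e.trans (congrArg₂ _ rfl (congrArg₂ _ h1 h2).symm)

/-- A Lagrangian Morita equivalence over the identities is a weak equivalence. -/
def LagrangianMoritaEquiv.toWeakEquiv (A : LagrangianMoritaEquiv (.refl G₁) (.refl G₂) S S') :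
    WeakEquiv S S' where
  M := A.M
  ψ := A.ψ
  ψ' := A.ψ'
  isMorita_ψ := A.isMorita_ψ
  isMorita_ψ' := A.isMorita_ψ'
  -- Both transformations end at `ν₁`, so the second is inverted; the pulled back form is then the
  -- difference of the two, as the compatibility condition requires.
  θ₁ := A.θ₁.trans (NatTransf.symm A.θ₁')
  θ₂ := A.θ₂.trans (NatTransf.symm A.θ₂')
  form_eq := by
    have e1 : pullback A.ν₁.obj (SymplecticMoritaEquiv.refl G₁).γ = 0 := rfl
    have e2 : pullback A.ν₂.obj (SymplecticMoritaEquiv.refl G₂).γ = 0 := rfl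
    have h := A.form_eq
    rw [e1, e2] at h
    have h1 := (A.θ₁.pullback_trans (NatTransf.symm A.θ₁')).trans
      (congrArg (· + pullback A.θ₁.app G₁.Ω) (NatTransf.pullback_symm A.θ₁'))
    have h2 := (A.θ₂.pullback_trans (NatTransf.symm A.θ₂')).trans
      (congrArg (· + pullback A.θ₂.app G₂.Ω) (NatTransf.pullback_symm A.θ₂'))
    refine Eq.trans ?_ (congrArg₂ _ h1 h2).symm
    linear_combination (norm := module) -h

end Weak

end ShiftedSymplectic

/-! ### The proposition -/

theorem mainTheorem9 {𝕜 : Type v} [RCLike 𝕜] :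
    (∀ {G₁ G₂ G₃ G₁' G₂' G₃' : QuasiSymplecticGroupoid.{u} 𝕜}
      (E₁ : SymplecticMoritaEquiv G₁ G₁') (E₂ : SymplecticMoritaEquiv G₂ G₂')
      (E₃ : SymplecticMoritaEquiv G₃ G₃')
      (S₁ : FormSpan G₁ G₂) (S₂ : FormSpan G₂ G₃)
      (S₁' : FormSpan G₁' G₂') (S₂' : FormSpan G₂' G₃'),
      S₁.IsLagrangian → S₂.IsLagrangian → S₁'.IsLagrangian → S₂'.IsLagrangian →
      Nonempty (LagrangianMoritaEquiv E₁ E₂ S₁ S₁') →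
      Nonempty (LagrangianMoritaEquiv E₂ E₃ S₂ S₂') →
      (S₁.Transverse S₂ ↔ S₁'.Transverse S₂') ∧
      ∀ (h : S₁.Transverse S₂) (h' : S₁'.Transverse S₂'),
        (S₁.comp S₂ h).IsLagrangian ∧ (S₁'.comp S₂' h').IsLagrangian ∧
        Nonempty (LagrangianMoritaEquiv E₁ E₃ (S₁.comp S₂ h) (S₁'.comp S₂' h'))) ∧
    (∀ {G₁ G₂ G₃ : QuasiSymplecticGroupoid.{u} 𝕜}
      (S₁ S₁' : FormSpan G₁ G₂) (S₂ S₂' : FormSpan G₂ G₃),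
      S₁.IsLagrangian → S₂.IsLagrangian → S₁'.IsLagrangian → S₂'.IsLagrangian →
      Nonempty (WeakEquiv S₁ S₁') → Nonempty (WeakEquiv S₂ S₂') →
      (S₁.Transverse S₂ ↔ S₁'.Transverse S₂') ∧
      ∀ (h : S₁.Transverse S₂) (h' : S₁'.Transverse S₂'),
        (S₁.comp S₂ h).IsLagrangian ∧ (S₁'.comp S₂' h').IsLagrangian ∧
        Nonempty (WeakEquiv (S₁.comp S₂ h) (S₁'.comp S₂' h'))) := by
  refine ⟨?_, ?_⟩
  · rintro G₁ G₂ G₃ G₁' G₂' G₃' E₁ E₂ E₃ S₁ S₂ S₁' S₂' l₁ l₂ l₁' l₂' ⟨A⟩ ⟨B⟩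
    exact ⟨(A.transverse_iff B).trans (A.transverse_iff' B).symm, fun h h' =>
      ⟨FormSpan.IsLagrangian.comp h l₁ l₂, FormSpan.IsLagrangian.comp h' l₁' l₂',
        ⟨A.comp B h h'⟩⟩⟩
  · rintro G₁ G₂ G₃ S₁ S₁' S₂ S₂' l₁ l₂ l₁' l₂' ⟨A⟩ ⟨B⟩
    -- Weak equivalences are treated as Lagrangian Morita equivalences over the identities, composed
    -- as in the first part, and converted back.
    have A := A.toLagrangianMoritaEquiv
    have B := B.toLagrangianMoritaEquiv
    exact ⟨(A.transverse_iff B).trans (A.transverse_iff' B).symm, fun h h' =>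
      ⟨FormSpan.IsLagrangian.comp h l₁ l₂, FormSpan.IsLagrangian.comp h' l₁' l₂',
        ⟨(A.comp B h h').toWeakEquiv⟩⟩⟩
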